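/- **Setting.** Let $(V,\eta)$ be a five-dimensional real vector space with a mostly minus Lorentzian inner product and let $e_0,\dots,e_4$ be an orthonormal basis, $\eta_{\mu\nu}=\eta(e_\mu,e_\nu)=\mathrm{diag}(1,-1,-1,-1,-1)$. Indices are lowered and raised with $\eta_{\mu\nu}$ and its inverse, and $\epsilon_{\mu\nu\rho\sigma\tau}$ is the Levi-Civita symbol with $\epsilon_{01234}=1$. Let $\Sigma$ be the irreducible complex (four-dimensional) module of the Clifford algebra $v\cdot v=\eta(v,v)1$ on which $e_0e_1e_2e_3e_4$ acts as the identity. Let $\Gamma_\mu$ denote Clifford multiplication by $e_\mu$ and $\Gamma_{\mu\nu}=\frac12[\Gamma_\mu,\Gamma_\nu]$. Let $J$ be the invariant quaternionic structure of $\Sigma$ (antilinear, commuting with $\Gamma_\mu$, $J^2=-1$), and let $(s,t)\mapsto\bar s t$ be a complex symplectic form on $\Sigma$ with $\overline{\Gamma_\mu s}\,t=\bar s\,\Gamma_\mu t$ that is real, i.e. $\overline{Js}\,(Jt)=(\bar s t)^*$. Let $\Delta=\mathbb C^2$ with $\epsilon_{12}=\epsilon^{12}=1$ and its standard quaternionic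 structure; $\Delta$-indices are lowered and raised by $\epsilon_{AB}X^B{}_C=X_{AC}$ and $\epsilon^{AB}X_{AC}=X^B{}_C$. Let $\mathfrak{sp}(1)$ be the real Lie algebra of complex-linear endomorphisms of $\Delta$ that preserve $\epsilon$ and commute with the quaternionic structure. Let $S$ be the real eight-dimensional space of pairs $s=(s^1,s^2)\in\Sigma^2$ with $Js^A=\epsilon_{AB}s^B$; it is the real form of $\Sigma\otimes_{\mathbb C}\Delta$. On $S$ put $\langle s,t\rangle=\epsilon_{AB}\bar s^At^B$. For $s\in S$ put $\mu_s=\langle s,s\rangle$ and $\omega^{AB}_{\mu\nu}=\bar s^A\Gamma_{\mu\nu}s^B$, and define $\kappa_s\in V$ by $\eta(\kappa_s,v)=\langle s,v\cdot s\rangle$. Let $\mathfrak s=V\oplus S\oplus\mathfrak{so}(V)$, graded in degrees $-2,-1,0$, be the five-dimensional Poincaré superalgebra, with brackets $[A,B]=AB-BA$, $[A,v]=Av$, $[A,s]=\frac14A^{\mu\nu}\Gamma_{\mu\nu}s$, $[v,w]=0$, $[v,s]=0$, $[s,s]=\kappa_s$, where $Ae_\mu=e_\nu A^\nu{}_\mu$.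 Let $\mathfrak s_-=V\oplus S$ be its negative-degree part. Let $C^{2,p}(\mathfrak s_-;\mathfrak s)$ be the space of degree-2 linear maps $\wedge^p\mathfrak s_-\to\mathfrak s$ (with $\wedge$ in the super sense), let $\partial$ be the Chevalley–Eilenberg differential of $\mathfrak s_-$ with values in $\mathfrak s$ (the adjoint action), and let $H^{2,2}(\mathfrak s_-;\mathfrak s)=\ker(\partial|_{C^{2,2}})/\partial C^{2,1}$. The Lie algebra $\mathfrak{so}(V)\oplus\mathfrak{sp}(1)$ acts on $V$ and $\mathfrak{so}(V)$ through $\mathfrak{so}(V)$ and on $S$ through both summands, and hence acts on $H^{2,2}(\mathfrak s_-;\mathfrak s)$. A cocycle is called *normalised* if its component in $\operatorname{Hom}(\wedge^2V,V)$ vanishes; it then has the form $\beta+\gamma$ with $\beta:V\otimes S\to S$ and $\gamma:\odot^2S\to\mathfrak{so}(V)$. **Theorem.** There is an isomorphism of $\mathfrak{so}(V)\oplus\mathfrak{sp}(1)$-modules $$H^{2,2}(\mathfrak s_-;\mathfrak s)\;\cong\;(\wedge^2V\otimes\wedge^2\Delta)\oplus(V\otimes\odot^2\Delta),$$ where $\wedge^2\Delta$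 and $\odot^2\Delta$ stand for their real forms $\mathbb R\epsilon$ and $\cong\mathfrak{sp}(1)$. Under it, for $C\in\wedge^2V$ with components $C_{\mu\nu}$ and for an $\mathfrak{sp}(1)$-valued vector with components $F^\mu{}^A{}_B$ (equivalently $F^\mu_{AB}$, symmetric in $AB$), the element $(C_{\mu\nu}\epsilon_{AB},F^\mu_{AB})$ corresponds to the class whose unique normalised cocycle $\beta+\gamma$ is $$\beta(v,s)^B=\tfrac14\,v\cdot C\cdot s^B-\tfrac34\,C\cdot v\cdot s^B-\tfrac18\,v\cdot F^B{}_C\cdot s^C-\tfrac38\,F^B{}_C\cdot v\cdot s^C,$$ $$\gamma(s,s)_{\mu\nu}=2\mu_sC_{\mu\nu}+\tfrac12\,\kappa_s^\rho\,\epsilon_{\mu\nu\rho\sigma\tau}C^{\sigma\tau}+\tfrac14\,\epsilon_{\mu\nu\rho}{}^{\sigma\tau}F^\rho_{AB}\,\omega^{AB}_{\sigma\tau}.$$ Here $C$ acts on $\Sigma$ as $\frac12C_{\mu\nu}\Gamma^{\mu\nu}$, $F^B{}_C$ acts as $F^\mu{}^B{}_C\Gamma_\mu$, and $\gamma(s,s)_{\mu\nu}=\eta(e_\mu,\gamma(s,s)e_\nu)$.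 -/

import Mathlib

open scoped TensorProduct

namespace Spencer5

attribute [local instance] LieRing.ofAssociativeRing

/-! ### Lorentzian vector space and Clifford module -/

/-- The diagonal entries of the mostly minus Lorentzian metric. -/
def sgn (μ : Fin 5) : ℝ := if μ = 0 then 1 else -1

/-- An orthonormal basis of a five-dimensional mostly minus Lorentzian vector space `(V, η)`. -/
structure LorentzFrame {V : Type*} [AddCommGroup V] [Module ℝ V]
    (η : LinearMap.BilinForm ℝ V) where
  /-- the basis vectors -/
  basis : Module.Basis (Fin 5) ℝ V
  orthonormal : ∀ μ ν, η (basis μ) (basis ν) = if μ = ν then sgn μ else 0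

/-- The irreducible complex module of the Clifford algebra `v * v = η(v,v) 1` on which the volume
element acts as the identity, with its quaternionic structure `J` and its
symplectic structure `C`. -/
structure SpinorModule {V : Type*} [AddCommGroup V] [Module ℝ V]
    {η : LinearMap.BilinForm ℝ V} (e : LorentzFrame η)
    (Sg : Type*) [AddCommGroup Sg] [Module ℂ Sg] where
  /-- the Clifford action -/
  rho : CliffordAlgebra (LinearMap.BilinMap.toQuadraticMap η) →ₐ[ℝ] Module.End ℂ Sg
  finrank_eq : Module.finrank ℂ Sg = 4
  volume : rho (CliffordAlgebra.ι _ (e.basis 0) * CliffordAlgebra.ι _ (e.basis 1) *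
    CliffordAlgebra.ι _ (e.basis 2) * CliffordAlgebra.ι _ (e.basis 3) *
    CliffordAlgebra.ι _ (e.basis 4)) = 1
  /-- the quaternionic structure -/
  J : Sg →ₛₗ[starRingEnd ℂ] Sg
  J_J : ∀ s, J (J s) = -s
  J_rho : ∀ a s, J (rho a s) = rho a (J s)
  /-- the symplectic structure -/
  C : Sg →ₗ[ℂ] Sg →ₗ[ℂ] ℂ
  C_alt : ∀ s, C s s = 0
  C_nondeg : ∀ s, (∀ t, C s t = 0) → s = 0
  C_gamma : ∀ v s t, C (rho (CliffordAlgebra.ι _ v) s) t = C s (rho (CliffordAlgebra.ι _ v) t)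
  C_J : ∀ s t, C (J s) (J t) = starRingEnd ℂ (C s t)

/-- `so(V)`: the `η`-skew endomorphisms of `V`. -/
abbrev so {V : Type*} [AddCommGroup V] [Module ℝ V] (η : LinearMap.BilinForm ℝ V) :
    LieSubalgebra ℝ (Module.End ℝ V) :=
  skewAdjointLieSubalgebra η

/-- The Levi-Civita symbol of `Δ`, with `ε₁₂ = 1`. -/
def eps2 : Matrix (Fin 2) (Fin 2) ℂ := !![0, 1; -1, 0]

/-- `sp(1)`: the complex endomorphisms of `Δ = ℂ²` which preserve the symplectic form `ε` and
commute with the quaternionic structure `z ↦ -ε z̄`. -/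
def sp1 : LieSubalgebra ℝ (Matrix (Fin 2) (Fin 2) ℂ) where
  carrier := {a | a.transpose * eps2 + eps2 * a = 0 ∧ eps2 * a.map (starRingEnd ℂ) = a * eps2}
  zero_mem' := by simp
  add_mem' := by
    rintro a b ⟨ha, ha'⟩ ⟨hb, hb'⟩
    refine ⟨?_, ?_⟩
    · rw [Matrix.transpose_add, add_mul, mul_add, add_add_add_comm, ha, hb, add_zero]
    · rw [Matrix.map_add _ (by simp), mul_add, add_mul, ha', hb']
  smul_mem' := by
    rintro c a ⟨ha, ha'⟩
    refine ⟨?_, ?_⟩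
    · simp only [Matrix.transpose_smul, smul_mul_assoc, mul_smul_comm]
      rw [← smul_add, ha, smul_zero]
    · have : (c • a).map (starRingEnd ℂ) = c • a.map (starRingEnd ℂ) := by
        ext i j; simp [Matrix.map_apply]
      rw [this, mul_smul_comm, smul_mul_assoc, ha']
  lie_mem' := by
    rintro a b ⟨ha, ha'⟩ ⟨hb, hb'⟩
    have e1 : a.transpose * eps2 = -(eps2 * a) := eq_neg_of_add_eq_zero_left ha
    have e2 : b.transpose * eps2 = -(eps2 * b) := eq_neg_of_add_eq_zero_left hb
    refine ⟨?_, ?_⟩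
    · simp only [LieRing.of_associative_ring_bracket, Matrix.transpose_sub, Matrix.transpose_mul,
        sub_mul, mul_assoc, e1, e2, mul_neg, mul_sub]
      simp only [← mul_assoc, e1, e2]
      noncomm_ring
    · have : (⁅a, b⁆).map (starRingEnd ℂ) = a.map (starRingEnd ℂ) * b.map (starRingEnd ℂ) -
          b.map (starRingEnd ℂ) * a.map (starRingEnd ℂ) := by
        rw [LieRing.of_associative_ring_bracket, Matrix.map_sub _ (by simp), Matrix.map_mul,
          Matrix.map_mul]
      rw [this, mul_sub, ← mul_assoc, ← mul_assoc, ha', hb', mul_assoc, mul_assoc, ha', hb',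
        LieRing.of_associative_ring_bracket]
      noncomm_ring

/-- The Lie algebra `so(V) ⊕ sp(1)`. -/
abbrev SoSp {V : Type*} [AddCommGroup V] [Module ℝ V] (η : LinearMap.BilinForm ℝ V) : Type _ :=
  so η × sp1

section Modules

variable {V : Type*} [AddCommGroup V] [Module ℝ V] {η : LinearMap.BilinForm ℝ V}

/-- `so(V) ⊕ sp(1)` acts on `V` through `so(V)`. -/
instance vecBracket : LieRingModule (SoSp η) V where
  bracket X v := (X.1 : Module.End ℝ V) v
  add_lie X Y v := by simp
  lie_add X v w := by simp
  leibniz_lie X Y v := by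
    simp [LieRing.of_associative_ring_bracket]

theorem vec_lie (X : SoSp η) (v : V) : ⁅X, v⁆ = (X.1 : Module.End ℝ V) v := rfl

instance vecModule : LieModule ℝ (SoSp η) V where
  smul_lie c X v := by simp [vec_lie]
  lie_smul c X v := by simp [vec_lie]

/-- `so(V) ⊕ sp(1)` acts on `so(V)` by the adjoint action of `so(V)`. -/
instance soBracket : LieRingModule (SoSp η) (so η) where
  bracket X A := ⁅X.1, A⁆
  add_lie X Y v := by simp
  lie_add X v w := by simp
  leibniz_lie X Y v := by simp

theorem so_lie (X : SoSp η) (A : so η) : ⁅X, A⁆ = ⁅X.1, A⁆ := rfl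

instance soModule : LieModule ℝ (SoSp η) (so η) where
  smul_lie c X v := by simp [so_lie]
  lie_smul c X v := by simp [so_lie]

/-- `so(V) ⊕ sp(1)` acts on `Δ ⊗ Δ`, realised as the matrices of components `X^{AB}`,
through `sp(1)`. -/
instance deltaBracket : LieRingModule (SoSp η) (Matrix (Fin 2) (Fin 2) ℂ) where
  bracket X t := (X.2 : Matrix (Fin 2) (Fin 2) ℂ) * t +
    t * (X.2 : Matrix (Fin 2) (Fin 2) ℂ).transpose
  add_lie X Y v := by simp; noncomm_ring
  lie_add X v w := by noncomm_ring
  leibniz_lie X Y v := by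
    simp [LieRing.of_associative_ring_bracket]; noncomm_ring

theorem delta_lie (X : SoSp η) (t : Matrix (Fin 2) (Fin 2) ℂ) :
    ⁅X, t⁆ = (X.2 : Matrix (Fin 2) (Fin 2) ℂ) * t +
      t * (X.2 : Matrix (Fin 2) (Fin 2) ℂ).transpose := rfl

instance deltaModule : LieModule ℝ (SoSp η) (Matrix (Fin 2) (Fin 2) ℂ) where
  smul_lie c X v := by simp [delta_lie]
  lie_smul c X v := by simp [delta_lie]

/-- The direct sum of two modules of a Lie algebra. -/
instance prodBracket {L M N : Type*} [LieRing L] [AddCommGroup M] [AddCommGroup N]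
    [LieRingModule L M] [LieRingModule L N] : LieRingModule L (M × N) where
  bracket X p := (⁅X, p.1⁆, ⁅X, p.2⁆)
  add_lie X Y v := by simp
  lie_add X v w := by simp
  leibniz_lie X Y v := by simp

theorem prod_lie {L M N : Type*} [LieRing L] [AddCommGroup M] [AddCommGroup N]
    [LieRingModule L M] [LieRingModule L N] (X : L) (p : M × N) :
    ⁅X, p⁆ = (⁅X, p.1⁆, ⁅X, p.2⁆) := rfl

instance prodModule {L M N : Type*} [LieRing L] [LieAlgebra ℝ L] [AddCommGroup M]
    [AddCommGroup N] [Module ℝ M] [Module ℝ N] [LieRingModule L M] [LieRingModule L N]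
    [LieModule ℝ L M] [LieModule ℝ L N] : LieModule ℝ L (M × N) where
  smul_lie c X v := by simp [prod_lie]
  lie_smul c X v := by simp [prod_lie]

/-- The real structure `j ⊗ j` of `Δ ⊗ Δ`, where `j z = -ε z̄`. -/
def deltaReal (t : Matrix (Fin 2) (Fin 2) ℂ) : Matrix (Fin 2) (Fin 2) ℂ :=
  eps2 * t.map (starRingEnd ℂ) * eps2.transpose

theorem deltaReal_add (s t : Matrix (Fin 2) (Fin 2) ℂ) :
    deltaReal (s + t) = deltaReal s + deltaReal t := by
  rw [deltaReal, Matrix.map_add _ (by simp), mul_add, add_mul]; rfl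

theorem deltaReal_smul (c : ℝ) (t : Matrix (Fin 2) (Fin 2) ℂ) :
    deltaReal (c • t) = c • deltaReal t := by
  have : (c • t).map (starRingEnd ℂ) = c • t.map (starRingEnd ℂ) := by
    ext i j; simp [Matrix.map_apply]
  rw [deltaReal, this, mul_smul_comm, smul_mul_assoc]; rfl

theorem deltaReal_lie (X : SoSp η) (t : Matrix (Fin 2) (Fin 2) ℂ) :
    deltaReal ⁅X, t⁆ = ⁅X, deltaReal t⁆ := by
  have h := X.2.2.2
  have h' := congrArg Matrix.transpose h
  rw [Matrix.transpose_mul, Matrix.transpose_mul] at h'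
  rw [delta_lie, delta_lie, deltaReal, deltaReal, Matrix.map_add _ (by simp), Matrix.map_mul,
    Matrix.map_mul, Matrix.transpose_map, mul_add, add_mul]
  congr 1
  · rw [← mul_assoc, h]; simp only [mul_assoc]
  · rw [mul_assoc, mul_assoc, h']; simp only [mul_assoc]

/-- The real module underlying `∧²Δ`: the real skew-symmetric elements of `Δ ⊗ Δ`. -/
def wedge2Delta (η : LinearMap.BilinForm ℝ V) :
    LieSubmodule ℝ (SoSp η) (Matrix (Fin 2) (Fin 2) ℂ) where
  carrier := {t | t.transpose = -t ∧ deltaReal t = t}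
  zero_mem' := by simp [deltaReal]
  add_mem' := by
    rintro a b ⟨ha, ha'⟩ ⟨hb, hb'⟩
    refine ⟨?_, ?_⟩
    · rw [Matrix.transpose_add, ha, hb]; abel
    · rw [deltaReal_add, ha', hb']
  smul_mem' := by
    rintro c a ⟨ha, ha'⟩
    refine ⟨?_, ?_⟩
    · rw [Matrix.transpose_smul, ha, smul_neg]
    · rw [deltaReal_smul, ha']
  lie_mem := by
    rintro X a ⟨ha, ha'⟩
    refine ⟨?_, ?_⟩
    · rw [delta_lie]; simp [ha]
    · rw [deltaReal_lie, ha']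

/-- The real module underlying `⊙²Δ`: the real symmetric elements of `Δ ⊗ Δ`. -/
def sym2Delta (η : LinearMap.BilinForm ℝ V) :
    LieSubmodule ℝ (SoSp η) (Matrix (Fin 2) (Fin 2) ℂ) where
  carrier := {t | t.transpose = t ∧ deltaReal t = t}
  zero_mem' := by simp [deltaReal]
  add_mem' := by
    rintro a b ⟨ha, ha'⟩ ⟨hb, hb'⟩
    refine ⟨?_, ?_⟩
    · rw [Matrix.transpose_add, ha, hb]
    · rw [deltaReal_add, ha', hb']
  smul_mem' := by
    rintro c a ⟨ha, ha'⟩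
    refine ⟨?_, ?_⟩
    · rw [Matrix.transpose_smul, ha]
    · rw [deltaReal_smul, ha']
  lie_mem := by
    rintro X a ⟨ha, ha'⟩
    refine ⟨?_, ?_⟩
    · rw [delta_lie]; simp [ha, add_comm]
    · rw [deltaReal_lie, ha']

/-- The element `ε` of `∧²Δ`, with `ε¹² = 1`. -/
def epsUp (η : LinearMap.BilinForm ℝ V) : wedge2Delta η :=
  ⟨eps2, by
    refine ⟨?_, ?_⟩
    · ext i j; fin_cases i <;> fin_cases j <;> simp [eps2]
    · ext i j
      fin_cases i <;> fin_cases j <;>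
        simp [eps2, deltaReal, Matrix.mul_apply, Matrix.map_apply, Fin.sum_univ_two,
          -Matrix.cons_mul]⟩

/-- Lowering the second index: `X^A_B = ε_{BD} X^{AD}`. -/
def lowerIndex (t : Matrix (Fin 2) (Fin 2) ℂ) : Matrix (Fin 2) (Fin 2) ℂ :=
  t * eps2.transpose

/-- Lowering the second index identifies the real module `⊙²Δ` with `sp(1)`. -/
theorem mem_sym2Delta_iff (t : Matrix (Fin 2) (Fin 2) ℂ) :
    t ∈ sym2Delta η ↔ lowerIndex t ∈ sp1 := by
  change (t.transpose = t ∧ deltaReal t = t) ↔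
    ((lowerIndex t).transpose * eps2 + eps2 * lowerIndex t = 0 ∧
      eps2 * (lowerIndex t).map (starRingEnd ℂ) = lowerIndex t * eps2)
  have he : eps2.transpose * eps2 = 1 := by
    ext i j; fin_cases i <;> fin_cases j <;> simp [eps2, Matrix.mul_apply, Fin.sum_univ_two]
  have he1 : eps2 * eps2 = -1 := by
    ext i j; fin_cases i <;> fin_cases j <;> simp [eps2, Matrix.mul_apply, Fin.sum_univ_two]
  have he2 : eps2.transpose = -eps2 := by
    ext i j; fin_cases i <;> fin_cases j <;> simp [eps2]
  have he3 : eps2.map (starRingEnd ℂ) = eps2 := by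
    ext i j; fin_cases i <;> fin_cases j <;> simp [eps2]
  refine and_congr ?_ ?_
  · rw [lowerIndex, Matrix.transpose_mul, Matrix.transpose_transpose, he2, mul_neg, mul_neg,
      ← sub_eq_add_neg, sub_eq_zero]
    constructor
    · intro h; rw [h, mul_assoc]
    · intro h
      have := congrArg (fun m => eps2 * m * eps2) h
      simpa [mul_assoc, he1, ← mul_assoc eps2 eps2] using this
  · rw [lowerIndex, mul_assoc, he, mul_one, deltaReal, Matrix.map_mul, he2,
      Matrix.map_neg _ (by simp), he3, mul_neg, mul_neg, mul_neg, ← mul_assoc]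

/-- `∧²V`: the skew-symmetric elements of `V ⊗ V`, with `v ∧ w = v ⊗ w - w ⊗ v`. -/
def wedge2V (η : LinearMap.BilinForm ℝ V) : LieSubmodule ℝ (SoSp η) (V ⊗[ℝ] V) where
  carrier := {t | TensorProduct.comm ℝ V V t = -t}
  zero_mem' := by simp
  add_mem' := by
    intro a b ha hb
    change TensorProduct.comm ℝ V V (a + b) = -(a + b)
    change TensorProduct.comm ℝ V V a = -a at ha
    change TensorProduct.comm ℝ V V b = -b at hb
    rw [map_add, ha, hb]; abel
  smul_mem' := by
    intro c a ha
    change TensorProduct.comm ℝ V V (c • a) = -(c • a)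
    change TensorProduct.comm ℝ V V a = -a at ha
    rw [map_smul, ha, smul_neg]
  lie_mem := by
    intro X a ha
    have key : ∀ t : V ⊗[ℝ] V, TensorProduct.comm ℝ V V ⁅X, t⁆ = ⁅X, TensorProduct.comm ℝ V V t⁆ := by
      intro t
      induction t with
      | zero => simp
      | tmul v w => simp [TensorProduct.LieModule.lie_tmul_right, add_comm]
      | add s t hs ht => simp only [lie_add, map_add, hs, ht]
    change TensorProduct.comm ℝ V V ⁅X, a⁆ = -⁅X, a⁆
    rw [key, show TensorProduct.comm ℝ V V a = -a from ha, lie_neg]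

end Modules

section Spinors

variable {V : Type*} [AddCommGroup V] [Module ℝ V] {η : LinearMap.BilinForm ℝ V}

theorem sgn_mul_sgn (μ : Fin 5) : sgn μ * sgn μ = 1 := by
  unfold sgn; split_ifs <;> norm_num

namespace LorentzFrame

variable (e : LorentzFrame η)

theorem repr_eq (v : V) (μ : Fin 5) : e.basis.repr v μ = sgn μ * η (e.basis μ) v := by
  have h : η (e.basis μ) v = η (e.basis μ) (∑ ν, e.basis.repr v ν • e.basis ν) := by
    rw [e.basis.sum_repr]
  rw [h]
  simp only [map_sum, map_smul, e.orthonormal, smul_eq_mul, mul_ite, mul_zero,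
    Finset.sum_ite_eq, Finset.mem_univ, if_true]
  rw [mul_comm, mul_assoc, sgn_mul_sgn, mul_one]

theorem expand (v : V) : ∑ μ, (sgn μ * η (e.basis μ) v) • e.basis μ = v := by
  conv_rhs => rw [← e.basis.sum_repr v]
  simp [e.repr_eq]

theorem symm (e : LorentzFrame η) (v w : V) : η v w = η w v := by
  have : η = η.flip := by
    refine e.basis.ext fun μ => e.basis.ext fun ν => ?_
    change η (e.basis μ) (e.basis ν) = η (e.basis ν) (e.basis μ)
    rw [e.orthonormal, e.orthonormal]
    by_cases h : μ = ν
    · subst h; rfl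
    · rw [if_neg h, if_neg (Ne.symm h)]
  conv_lhs => rw [this]
  rfl

theorem nondeg (e : LorentzFrame η) {v w : V} (h : ∀ u, η v u = η w u) : v = w := by
  rw [← e.expand v, ← e.expand w]
  refine Finset.sum_congr rfl fun μ _ => ?_
  rw [e.symm _ v, e.symm _ w, h]

end LorentzFrame

theorem so_skew (A : so η) (v w : V) :
    η ((A : Module.End ℝ V) v) w = -η v ((A : Module.End ℝ V) w) := by
  have h : η.IsSkewAdjoint (A : Module.End ℝ V) := (LinearMap.mem_skewAdjointSubmodule _).1 A.2
  simpa using h v w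

theorem sum_skew (e : LorentzFrame η) {M : Type*} [AddCommGroup M] [Module ℝ M]
    (T : V →ₗ[ℝ] V →ₗ[ℝ] M) (A : so η) :
    ∑ μ, sgn μ • T (e.basis μ) ((A : Module.End ℝ V) (e.basis μ)) =
      -∑ μ, sgn μ • T ((A : Module.End ℝ V) (e.basis μ)) (e.basis μ) := by
  have h1 : ∀ μ, T (e.basis μ) ((A : Module.End ℝ V) (e.basis μ)) = ∑ ν,
      (sgn ν * η (e.basis ν) ((A : Module.End ℝ V) (e.basis μ))) • T (e.basis μ) (e.basis ν) := by
    intro μ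
    conv_lhs => rw [← e.expand ((A : Module.End ℝ V) (e.basis μ))]
    simp
  have h2 : ∀ μ, T ((A : Module.End ℝ V) (e.basis μ)) (e.basis μ) = ∑ ν,
      (sgn ν * η (e.basis ν) ((A : Module.End ℝ V) (e.basis μ))) • T (e.basis ν) (e.basis μ) := by
    intro μ
    conv_lhs => rw [← e.expand ((A : Module.End ℝ V) (e.basis μ))]
    simp
  simp only [h1, h2, Finset.smul_sum]
  rw [Finset.sum_comm, ← Finset.sum_neg_distrib]
  refine Finset.sum_congr rfl fun μ _ => ?_
  rw [← Finset.sum_neg_distrib]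
  refine Finset.sum_congr rfl fun ν _ => ?_
  rw [smul_smul, smul_smul, ← neg_smul, e.symm (e.basis ν), so_skew]
  congr 1
  ring

namespace SpinorModule

variable {e : LorentzFrame η} {Sg : Type*} [AddCommGroup Sg] [Module ℂ Sg]
  (D : SpinorModule e Sg)

/-- Clifford multiplication by a vector. -/
noncomputable def gamma : V →ₗ[ℝ] Module.End ℂ Sg := D.rho.toLinearMap ∘ₗ CliffordAlgebra.ι _

theorem gamma_comm (v w : V) :
    D.gamma v * D.gamma w = (2 * η v w) • 1 - D.gamma w * D.gamma v := by
  rw [eq_sub_iff_add_eq]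
  have h := congrArg D.rho (CliffordAlgebra.ι_mul_ι_add_swap
    (Q := LinearMap.BilinMap.toQuadraticMap η) v w)
  rw [map_add, map_mul, map_mul, AlgHom.commutes, LinearMap.BilinMap.polar_toQuadraticMap,
    e.symm w v, ← two_mul, Algebra.algebraMap_eq_smul_one] at h
  exact h

/-- The action of `so(V)` on `Σ`, `A s = ¼ A^{μν} Γ_{μν} s` where `A e_μ = e_ν A^ν_μ`. -/
noncomputable def spin : so η →ₗ[ℝ] Module.End ℂ Sg where
  toFun A := (1 / 4 : ℝ) • ∑ μ, sgn μ •
    (D.gamma ((A : Module.End ℝ V) (e.basis μ)) * D.gamma (e.basis μ))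
  map_add' A B := by
    simp [add_mul, Finset.sum_add_distrib]
  map_smul' c A := by
    have h : ∀ v, ((c • A : so η) : Module.End ℝ V) v = c • (A : Module.End ℝ V) v :=
      fun v => rfl
    simp only [h, map_smul, smul_mul_assoc, RingHom.id_apply, Finset.smul_sum]
    refine Finset.sum_congr rfl fun μ _ => ?_
    simp only [smul_smul]; congr 1; ring

theorem spin_apply (A : so η) : D.spin A = (1 / 4 : ℝ) • ∑ μ, sgn μ •
    (D.gamma ((A : Module.End ℝ V) (e.basis μ)) * D.gamma (e.basis μ)) := rfl

/-- `A (v · s) = (A v) · s + v · (A s)`. -/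
theorem spin_gamma (A : so η) (v : V) :
    D.spin A * D.gamma v = D.gamma ((A : Module.End ℝ V) v) + D.gamma v * D.spin A := by
  have key : ∀ μ, D.gamma ((A : Module.End ℝ V) (e.basis μ)) * D.gamma (e.basis μ) * D.gamma v =
      D.gamma v * (D.gamma ((A : Module.End ℝ V) (e.basis μ)) * D.gamma (e.basis μ)) +
      ((2 * η (e.basis μ) v) • D.gamma ((A : Module.End ℝ V) (e.basis μ)) +
        (2 * η (e.basis μ) ((A : Module.End ℝ V) v)) • D.gamma (e.basis μ)) := by
    intro μ
    rw [mul_assoc, D.gamma_comm (e.basis μ) v, mul_sub, ← mul_assoc,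
      D.gamma_comm _ v, sub_mul, ← mul_assoc, so_skew, mul_smul_comm, mul_one]
    rw [show ((2 * -η (e.basis μ) ((A : Module.End ℝ V) v)) • (1 : Module.End ℂ Sg)) *
      D.gamma (e.basis μ) = -((2 * η (e.basis μ) ((A : Module.End ℝ V) v)) •
        D.gamma (e.basis μ)) by
      rw [Algebra.smul_mul_assoc, one_mul, mul_neg, neg_smul]]
    abel
  have h1 : ∑ μ, (sgn μ * η (e.basis μ) v) • D.gamma ((A : Module.End ℝ V) (e.basis μ)) =
      D.gamma ((A : Module.End ℝ V) v) := by
    conv_rhs => rw [← e.expand v]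
    simp
  have h2 : ∑ μ, (sgn μ * η (e.basis μ) ((A : Module.End ℝ V) v)) • D.gamma (e.basis μ) =
      D.gamma ((A : Module.End ℝ V) v) := by
    conv_rhs => rw [← e.expand ((A : Module.End ℝ V) v)]
    simp
  have h3 : ∑ μ, sgn μ • ((2 * η (e.basis μ) v) • D.gamma ((A : Module.End ℝ V) (e.basis μ)) +
        (2 * η (e.basis μ) ((A : Module.End ℝ V) v)) • D.gamma (e.basis μ)) =
      (4 : ℝ) • D.gamma ((A : Module.End ℝ V) v) := by
    have : (4 : ℝ) • D.gamma ((A : Module.End ℝ V) v) =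
      (2 : ℝ) • D.gamma ((A : Module.End ℝ V) v) + (2 : ℝ) • D.gamma ((A : Module.End ℝ V) v) := by
      rw [← add_smul]; norm_num
    rw [this]
    nth_rewrite 1 [← h1]
    rw [← h2, Finset.smul_sum, Finset.smul_sum, ← Finset.sum_add_distrib]
    refine Finset.sum_congr rfl fun μ _ => ?_
    simp only [smul_add, smul_smul]
    congr 2 <;> ring
  simp only [spin_apply, smul_mul_assoc, Finset.sum_mul, mul_smul_comm, Finset.mul_sum]
  rw [Finset.sum_congr rfl fun μ _ => by rw [key μ, smul_add], Finset.sum_add_distrib, h3,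
    smul_add, smul_smul, add_comm]
  norm_num

theorem spin_lie (A B : so η) :
    D.spin ⁅A, B⁆ = D.spin A * D.spin B - D.spin B * D.spin A := by
  rw [eq_sub_iff_add_eq]
  have hB : D.spin A * D.spin B = (1 / 4 : ℝ) • ∑ μ, sgn μ •
      (D.gamma ((A : Module.End ℝ V) ((B : Module.End ℝ V) (e.basis μ))) * D.gamma (e.basis μ) +
        D.gamma ((B : Module.End ℝ V) (e.basis μ)) * D.gamma ((A : Module.End ℝ V) (e.basis μ)))
      + D.spin B * D.spin A := by
    rw [D.spin_apply B]
    simp only [mul_smul_comm, Finset.mul_sum, smul_mul_assoc, Finset.sum_mul]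
    rw [← smul_add, ← Finset.sum_add_distrib]
    congr 1
    refine Finset.sum_congr rfl fun μ _ => ?_
    rw [← smul_add]
    congr 1
    rw [← mul_assoc, D.spin_gamma, add_mul, mul_assoc _ (D.spin A), D.spin_gamma, mul_add,
      mul_assoc]
    abel
  rw [hB]
  congr 1
  have hT := sum_skew e ((LinearMap.mul ℝ (Module.End ℂ Sg)).compl₁₂
    (D.gamma ∘ₗ (B : Module.End ℝ V)) D.gamma) A
  simp only [LinearMap.compl₁₂_apply, LinearMap.mul_apply', LinearMap.comp_apply] at hT
  rw [D.spin_apply]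
  congr 1
  simp only [smul_add, Finset.sum_add_distrib, hT]
  rw [← sub_eq_add_neg, ← Finset.sum_sub_distrib]
  refine Finset.sum_congr rfl fun μ _ => ?_
  simp [LieRing.of_associative_ring_bracket, sub_mul, smul_sub]

theorem J_real (c : ℝ) (s : Sg) : D.J (c • s) = c • D.J s := by
  rw [← Complex.coe_smul, map_smulₛₗ]; simp

theorem J_gamma (v : V) (s : Sg) : D.J (D.gamma v s) = D.gamma v (D.J s) := D.J_rho _ s

theorem J_spin (A : so η) (s : Sg) : D.J (D.spin A s) = D.spin A (D.J s) := by
  simp [spin_apply, LinearMap.sum_apply, J_real, map_sum, J_gamma, -one_div]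

/-- The real eight-dimensional module `S` of symplectic Majorana spinors `(s¹, s²)`, the real
elements of `Σ ⊗ Δ`: with `J s = B⁻¹ s^*` the condition is `(s^A)^* = ε_{AB} B s^B`. -/
def majorana : Submodule ℝ (Fin 2 → Sg) where
  carrier := {s | ∀ a, D.J (s a) = ∑ b, eps2 a b • s b}
  zero_mem' := by intro a; simp
  add_mem' := by
    intro s t hs ht a
    simp [hs a, ht a, smul_add]; abel
  smul_mem' := by
    intro c s hs a
    simp only [Pi.smul_apply, J_real, hs a, Finset.smul_sum]
    exact Finset.sum_congr rfl fun b _ => smul_comm _ _ _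

/-- The type of elements of the real module `S`. -/
def S : Type _ := ↥D.majorana

noncomputable instance : AddCommGroup D.S := Submodule.addCommGroup D.majorana

noncomputable instance : Module ℝ D.S := Submodule.module D.majorana

/-- The element of `S` with given components. -/
def mkS (f : Fin 2 → Sg) (h : f ∈ D.majorana) : D.S := ⟨f, h⟩

@[simp] theorem mkS_val (f : Fin 2 → Sg) (h : f ∈ D.majorana) (a : Fin 2) :
    (D.mkS f h).1 a = f a := rfl

variable {D} in
theorem S_ext {s t : D.S} (h : ∀ a, s.1 a = t.1 a) : s = t := Subtype.ext (funext h)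

@[simp] theorem S_zero (a : Fin 2) : (0 : D.S).1 a = 0 := rfl

@[simp] theorem S_add (s t : D.S) (a : Fin 2) : (s + t).1 a = s.1 a + t.1 a := rfl

@[simp] theorem S_neg (s : D.S) (a : Fin 2) : (-s).1 a = -s.1 a := rfl

@[simp] theorem S_sub (s t : D.S) (a : Fin 2) : (s - t).1 a = s.1 a - t.1 a := rfl

@[simp] theorem S_smul (c : ℝ) (s : D.S) (a : Fin 2) : (c • s).1 a = c • s.1 a := rfl

/-- The component `s^A` as a linear map. -/
def compLin (a : Fin 2) : D.S →ₗ[ℝ] Sg where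
  toFun s := s.1 a
  map_add' _ _ := rfl
  map_smul' _ _ := rfl

@[simp] theorem S_sum {ι : Type*} (I : Finset ι) (f : ι → D.S) (a : Fin 2) :
    (∑ i ∈ I, f i).1 a = ∑ i ∈ I, (f i).1 a := map_sum (D.compLin a) f I

/-- The action of `so(V) ⊕ sp(1)` on `Σ ⊗ Δ`: `(X s)^A = A s^A + a^A_B s^B` for `X = (A, a)`. -/
noncomputable def actC (X : SoSp η) (s : Fin 2 → Sg) : Fin 2 → Sg := fun a =>
  D.spin X.1 (s a) + ∑ b, (X.2 : Matrix (Fin 2) (Fin 2) ℂ) a b • s b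

theorem actC_mem (X : SoSp η) {s : Fin 2 → Sg} (hs : s ∈ D.majorana) :
    D.actC X s ∈ D.majorana := by
  intro a
  have h := X.2.2.2
  have hs' : ∀ a, D.J (s a) = ∑ b, eps2 a b • s b := hs
  have h0 : ∀ i j, (eps2 * (X.2 : Matrix (Fin 2) (Fin 2) ℂ).map (starRingEnd ℂ)) i j =
      ((X.2 : Matrix (Fin 2) (Fin 2) ℂ) * eps2) i j := fun i j => by rw [h]
  have h00 := h0 0 0
  have h01 := h0 0 1
  have h10 := h0 1 0
  have h11 := h0 1 1
  simp [Matrix.mul_apply, Fin.sum_univ_two, eps2] at h00 h01 h10 h11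
  have hs0 := hs' 0
  have hs1 := hs' 1
  simp [Fin.sum_univ_two, eps2] at hs0 hs1
  fin_cases a
  · simp [actC, J_spin, Fin.sum_univ_two, eps2, hs0, hs1, h10, ← h11, map_smulₛₗ]
    abel
  · simp [actC, J_spin, Fin.sum_univ_two, eps2, hs0, hs1, h00, h01, map_smulₛₗ]
    abel

noncomputable instance spinorBracket : LieRingModule (SoSp η) D.S where
  bracket X s := D.mkS (D.actC X s.1) (D.actC_mem X s.2)
  add_lie X Y s := by
    refine S_ext fun a => ?_; simp [actC, Fin.sum_univ_two, add_smul]; abel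
  lie_add X s t := by
    refine S_ext fun a => ?_; simp [actC, Fin.sum_univ_two]; abel
  leibniz_lie X Y s := by
    refine S_ext fun a => ?_
    simp [actC, Fin.sum_univ_two, spin_lie, LieRing.of_associative_ring_bracket,
      Matrix.mul_apply, sub_smul, add_smul, mul_smul]
    abel

theorem spinor_lie (X : SoSp η) (s : D.S) (a : Fin 2) : (⁅X, s⁆ : D.S).1 a =
    D.spin X.1 (s.1 a) + ∑ b, (X.2 : Matrix (Fin 2) (Fin 2) ℂ) a b • s.1 b := rfl

instance spinorModule : LieModule ℝ (SoSp η) D.S where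
  smul_lie c X s := by
    refine S_ext fun a => ?_; simp [spinor_lie, Fin.sum_univ_two, mul_smul]
  lie_smul c X s := by
    refine S_ext fun a => ?_
    simp [spinor_lie, Fin.sum_univ_two, smul_comm c]

/-- Clifford multiplication by a vector on `S`. -/
noncomputable def cliff (v : V) (s : D.S) : D.S :=
  D.mkS (fun a => D.gamma v (s.1 a)) fun a => by
    have h : D.J (s.1 a) = ∑ b, eps2 a b • s.1 b := s.2 a
    rw [J_gamma, h]; simp

theorem cliff_val (v : V) (s : D.S) (a : Fin 2) : (D.cliff v s).1 a = D.gamma v (s.1 a) := rfl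

/-- `ε_{AB} s̄^A t^B`. -/
def pairing (s t : D.S) : ℂ := ∑ a, ∑ b, eps2 a b * D.C (s.1 a) (t.1 b)

/-- The inner product on `S` is real. -/
theorem pairing_real (s t : D.S) : starRingEnd ℂ (D.pairing s t) = D.pairing s t := by
  have hs : ∀ a, D.J (s.1 a) = ∑ b, eps2 a b • s.1 b := s.2
  have ht : ∀ a, D.J (t.1 a) = ∑ b, eps2 a b • t.1 b := t.2
  have hs0 := hs 0
  have hs1 := hs 1
  have ht0 := ht 0
  have ht1 := ht 1
  simp [Fin.sum_univ_two, eps2] at hs0 hs1 ht0 ht1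
  simp [pairing, Fin.sum_univ_two, eps2, ← D.C_J, hs0, hs1, ht0, ht1]
  ring

/-- The symmetric inner product `⟨s, t⟩ = ε_{AB} s̄^A t^B` on `S`. -/
noncomputable def ip : D.S →ₗ[ℝ] D.S →ₗ[ℝ] ℝ :=
  LinearMap.mk₂ ℝ (fun s t => (D.pairing s t).re)
    (by intro s s' t; simp [pairing, Fin.sum_univ_two, eps2]; ring)
    (by intro c s t; simp [pairing, Fin.sum_univ_two, eps2, ← Complex.coe_smul]; ring)
    (by intro s t t'; simp [pairing, Fin.sum_univ_two, eps2]; ring)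
    (by intro c s t; simp [pairing, Fin.sum_univ_two, eps2, ← Complex.coe_smul]; ring)

theorem ip_apply (s t : D.S) : (D.ip s t : ℂ) = D.pairing s t :=
  Complex.conj_eq_iff_re.1 (D.pairing_real s t)

theorem C_swap (x y : Sg) : D.C x y = -D.C y x := by
  have h := D.C_alt (x + y)
  simp [D.C_alt] at h
  exact eq_neg_of_add_eq_zero_left h

theorem ip_symm (s t : D.S) : D.ip s t = D.ip t s := by
  have : D.pairing s t = D.pairing t s := by
    simp [pairing, Fin.sum_univ_two, eps2, D.C_swap (s.1 0), D.C_swap (s.1 1)]; ring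
  change (D.pairing s t).re = (D.pairing t s).re
  rw [this]

theorem ip_cliff (v : V) (s t : D.S) : D.ip (D.cliff v s) t = D.ip s (D.cliff v t) := by
  have : D.pairing (D.cliff v s) t = D.pairing s (D.cliff v t) := by
    simp only [pairing, cliff_val, gamma, LinearMap.comp_apply, AlgHom.toLinearMap_apply, D.C_gamma]
  change (D.pairing (D.cliff v s) t).re = (D.pairing s (D.cliff v t)).re
  rw [this]

theorem C_spin (A : so η) (x y : Sg) : D.C (D.spin A x) y = -D.C x (D.spin A y) := by
  have hg : ∀ v x y, D.C (D.gamma v x) y = D.C x (D.gamma v y) := D.C_gamma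
  have hT := sum_skew e ((LinearMap.mul ℝ (Module.End ℂ Sg)).compl₁₂ D.gamma D.gamma) A
  simp only [LinearMap.compl₁₂_apply, LinearMap.mul_apply'] at hT
  have h1 : D.C (D.spin A x) y = D.C x (((1 / 4 : ℝ) • ∑ μ, sgn μ •
      (D.gamma (e.basis μ) * D.gamma ((A : Module.End ℝ V) (e.basis μ)))) y) := by
    simp only [spin_apply, LinearMap.smul_apply, LinearMap.sum_apply, Module.End.mul_apply,
      ← Complex.coe_smul, map_smul, map_sum, hg]
  rw [h1, hT, ← map_neg, smul_neg, ← spin_apply, LinearMap.neg_apply]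

theorem ip_lie (X : SoSp η) (s t : D.S) : D.ip ⁅X, s⁆ t = -D.ip s ⁅X, t⁆ := by
  have h := X.2.2.1
  have h0 : ∀ i j, ((X.2 : Matrix (Fin 2) (Fin 2) ℂ).transpose * eps2 +
      eps2 * (X.2 : Matrix (Fin 2) (Fin 2) ℂ)) i j = 0 := fun i j => by rw [h]; rfl
  have h01 := h0 0 1
  simp [Matrix.mul_apply, Fin.sum_univ_two, eps2, -Matrix.cons_mul] at h01
  have h3 := eq_neg_of_add_eq_zero_left h01
  have : D.pairing ⁅X, s⁆ t = -D.pairing s ⁅X, t⁆ := by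
    simp [pairing, Fin.sum_univ_two, spinor_lie, eps2, D.C_spin, h3]
    ring
  change (D.pairing ⁅X, s⁆ t).re = -(D.pairing s ⁅X, t⁆).re
  rw [this, Complex.neg_re]

theorem cliff_lie (X : SoSp η) (v : V) (s : D.S) :
    ⁅X, D.cliff v s⁆ = D.cliff ⁅X, v⁆ s + D.cliff v ⁅X, s⁆ := by
  refine S_ext fun a => ?_
  have h := LinearMap.congr_fun (D.spin_gamma X.1 v) (s.1 a)
  simp only [Module.End.mul_apply, LinearMap.add_apply] at h
  simp [spinor_lie, cliff_val, h, vec_lie, add_assoc]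

theorem cliff_add (v : V) (s t : D.S) : D.cliff v (s + t) = D.cliff v s + D.cliff v t := by
  refine S_ext fun a => ?_; simp [cliff_val]

theorem cliff_smul (v : V) (c : ℝ) (s : D.S) : D.cliff v (c • s) = c • D.cliff v s := by
  refine S_ext fun a => ?_; simp [cliff_val]

/-- The polarised Dirac current `S × S → V`, so that `κ_s = kappa s s`. -/
noncomputable def kappa : D.S →ₗ[ℝ] D.S →ₗ[ℝ] V :=
  LinearMap.mk₂ ℝ (fun s t => ∑ μ, (sgn μ * D.ip s (D.cliff (e.basis μ) t)) • e.basis μ)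
    (by intro s s' t; simp [mul_add, add_smul, Finset.sum_add_distrib])
    (by intro c s t; simp [Finset.smul_sum, smul_smul, mul_left_comm])
    (by intro s t t'; simp [cliff_add, mul_add, add_smul, Finset.sum_add_distrib])
    (by intro c s t; simp [cliff_smul, Finset.smul_sum, smul_smul, mul_left_comm])

theorem kappa_apply (s t : D.S) : D.kappa s t =
    ∑ μ, (sgn μ * D.ip s (D.cliff (e.basis μ) t)) • e.basis μ := rfl

/-- The defining property of the Dirac current: `η(κ(s,t), v) = ⟨s, v · t⟩`. -/
theorem eta_kappa (s t : D.S) (v : V) : η (D.kappa s t) v = D.ip s (D.cliff v t) := by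
  have h : D.cliff v t = ∑ μ, (sgn μ * η (e.basis μ) v) • D.cliff (e.basis μ) t := by
    refine S_ext fun a => ?_
    conv_lhs => rw [← e.expand v]
    simp [cliff_val]
  rw [h, kappa_apply]
  simp only [map_sum, map_smul, LinearMap.sum_apply, LinearMap.smul_apply, smul_eq_mul]
  exact Finset.sum_congr rfl fun μ _ => by ring

theorem kappa_symm (s t : D.S) : D.kappa s t = D.kappa t s :=
  e.nondeg fun v => by rw [eta_kappa, eta_kappa, ← ip_cliff, ip_symm]

theorem kappa_lie (X : SoSp η) (s t : D.S) :
    ⁅X, D.kappa s t⁆ = D.kappa ⁅X, s⁆ t + D.kappa s ⁅X, t⁆ :=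
  e.nondeg fun v => by
    have h : D.cliff ⁅X, v⁆ t = ⁅X, D.cliff v t⁆ - D.cliff v ⁅X, t⁆ := by
      rw [cliff_lie, add_sub_cancel_right]
    rw [vec_lie, so_skew, eta_kappa, ← vec_lie X v, h, map_add, LinearMap.add_apply, eta_kappa,
      eta_kappa, map_sub, ip_lie]
    ring

end SpinorModule

end Spinors

section Superalgebra

variable {V : Type*} [AddCommGroup V] [Module ℝ V] {η : LinearMap.BilinForm ℝ V}
  {e : LorentzFrame η} {Sg : Type*} [AddCommGroup Sg] [Module ℂ Sg] (D : SpinorModule e Sg)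

/-- The space `s = V ⊕ S ⊕ so(V)` underlying the Poincaré superalgebra. -/
abbrev Poinc : Type _ := V × D.S × so η

/-- The space `s₋ = V ⊕ S` underlying the negative-degree subalgebra. -/
abbrev Neg : Type _ := V × D.S

/-- The action of `A ∈ so(V)` on `S`. -/
noncomputable def soS : so η →ₗ[ℝ] D.S →ₗ[ℝ] D.S :=
  LinearMap.mk₂ ℝ (fun A s => ⁅((A, 0) : SoSp η), s⁆)
    (by intro A B s; rw [← add_lie]; simp)
    (by intro c A s; rw [← smul_lie]; simp)
    (by intro A s t; rw [lie_add])
    (by intro c A s; rw [lie_smul])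

theorem soS_apply (A : so η) (s : D.S) : soS D A s = ⁅((A, 0) : SoSp η), s⁆ := rfl

/-- The bracket of the Poincaré superalgebra: `[A,B] = AB - BA`, `[A,v] = Av`, `[A,s] = ½ω_A · s`,
`[s,t] = κ(s,t)`, `[v,w] = 0`, `[v,s] = 0`. -/
noncomputable def bracket : Poinc D →ₗ[ℝ] Poinc D →ₗ[ℝ] Poinc D :=
  LinearMap.mk₂ ℝ (fun p q =>
    ((p.2.2 : Module.End ℝ V) q.1 - (q.2.2 : Module.End ℝ V) p.1 + D.kappa p.2.1 q.2.1,
      soS D p.2.2 q.2.1 - soS D q.2.2 p.2.1, ⁅p.2.2, q.2.2⁆))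
    (by intro p p' q; ext1 <;> [skip; ext1] <;> simp <;> abel)
    (by intro c p q; ext1 <;> [skip; ext1] <;> simp [smul_add, smul_sub])
    (by intro p q q'; ext1 <;> [skip; ext1] <;> simp <;> abel)
    (by intro c p q; ext1 <;> [skip; ext1] <;> simp [smul_add, smul_sub])

theorem bracket_apply (p q : Poinc D) : bracket D p q =
    ((p.2.2 : Module.End ℝ V) q.1 - (q.2.2 : Module.End ℝ V) p.1 + D.kappa p.2.1 q.2.1,
      soS D p.2.2 q.2.1 - soS D q.2.2 p.2.1, ⁅p.2.2, q.2.2⁆) := rfl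

/-- The inclusion of `s₋` in `s`. -/
noncomputable def incl : Neg D →ₗ[ℝ] Poinc D where
  toFun x := (x.1, x.2, 0)
  map_add' x y := by simp
  map_smul' c x := by simp

theorem incl_apply (x : Neg D) : incl D x = (x.1, x.2, 0) := rfl

/-- The bracket of `s₋`. -/
noncomputable def bracketNeg : Neg D →ₗ[ℝ] Neg D →ₗ[ℝ] Neg D :=
  LinearMap.mk₂ ℝ (fun x y => (D.kappa x.2 y.2, 0))
    (by intro p p' q; simp)
    (by intro c p q; simp)
    (by intro p q q'; simp)
    (by intro c p q; simp)

theorem bracketNeg_apply (x y : Neg D) : bracketNeg D x y = (D.kappa x.2 y.2, 0) := rfl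

theorem incl_bracketNeg (x y : Neg D) :
    incl D (bracketNeg D x y) = bracket D (incl D x) (incl D y) := by
  simp [incl_apply, bracketNeg_apply, bracket_apply]

/-- The projections of `s₋` to its even part `V` and to its odd part `S`. -/
noncomputable def par (x : Fin 2) : Neg D →ₗ[ℝ] Neg D :=
  if x = 0 then LinearMap.inl ℝ V D.S ∘ₗ LinearMap.fst ℝ V D.S
  else LinearMap.inr ℝ V D.S ∘ₗ LinearMap.snd ℝ V D.S

theorem par_zero (X : Neg D) : par D 0 X = (X.1, 0) := rfl

theorem par_one (X : Neg D) : par D 1 X = (0, X.2) := rfl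

theorem par_lie (x : Fin 2) (T : SoSp η) (X : Neg D) : par D x ⁅T, X⁆ = ⁅T, par D x X⁆ := by
  fin_cases x
  · change par D 0 _ = ⁅T, par D 0 X⁆
    simp [par_zero, prod_lie]
  · change par D 1 _ = ⁅T, par D 1 X⁆
    simp [par_one, prod_lie]

theorem incl_lie (T : SoSp η) (X : Neg D) : incl D ⁅T, X⁆ = ⁅T, incl D X⁆ := by
  simp [incl_apply, prod_lie]

theorem soS_lie (T : SoSp η) (A : so η) (s : D.S) :
    ⁅T, soS D A s⁆ = soS D ⁅T, A⁆ s + soS D A ⁅T, s⁆ := by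
  rw [soS_apply, soS_apply, soS_apply, so_lie, leibniz_lie]
  simp

/-- `so(V) ⊕ sp(1)` acts on the Poincaré superalgebra by derivations. -/
theorem bracket_lie (T : SoSp η) (p q : Poinc D) :
    ⁅T, bracket D p q⁆ = bracket D ⁅T, p⁆ q + bracket D p ⁅T, q⁆ := by
  have h1 : ∀ (A : so η) (v : V), ⁅T, (A : Module.End ℝ V) v⁆ =
      ((⁅T, A⁆ : so η) : Module.End ℝ V) v + (A : Module.End ℝ V) ⁅T, v⁆ := by
    intro A v
    simp [vec_lie, so_lie, LieRing.of_associative_ring_bracket]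
  simp only [bracket_apply, prod_lie, Prod.mk_add_mk, lie_add, lie_sub, h1, soS_lie, D.kappa_lie]
  refine Prod.ext ?_ (Prod.ext ?_ ?_)
  · simp only; abel
  · simp only; abel
  · simp only [so_lie, leibniz_lie T.1 p.2.2 q.2.2]

theorem bracketNeg_lie (T : SoSp η) (p q : Neg D) :
    ⁅T, bracketNeg D p q⁆ = bracketNeg D ⁅T, p⁆ q + bracketNeg D p ⁅T, q⁆ := by
  simp [bracketNeg_apply, prod_lie, D.kappa_lie]

/-! ### The Spencer complex -/

/-- The differential of a 1-cochain on homogeneous `X`, `Y` of parity `x`, `y`. -/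
noncomputable def d1h (f : Neg D →ₗ[ℝ] Poinc D) (x y : Fin 2) (X Y : Neg D) : Poinc D :=
  bracket D (incl D X) (f Y) - (-1 : ℝ) ^ ((x : ℕ) * y) • bracket D (incl D Y) (f X)
    - f (bracketNeg D X Y)

/-- The differential of a 2-cochain on homogeneous `X`, `Y`, `Z` of parity `x`, `y`, `z`. -/
noncomputable def d2h (f : Neg D →ₗ[ℝ] Neg D →ₗ[ℝ] Poinc D) (x y z : Fin 2) (X Y Z : Neg D) :
    Poinc D :=
  bracket D (incl D X) (f Y Z)
    + (-1 : ℝ) ^ ((x : ℕ) * (y + z)) • bracket D (incl D Y) (f Z X)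
    + (-1 : ℝ) ^ ((z : ℕ) * (x + y)) • bracket D (incl D Z) (f X Y)
    - f (bracketNeg D X Y) Z
    - (-1 : ℝ) ^ ((x : ℕ) * (y + z)) • f (bracketNeg D Y Z) X
    - (-1 : ℝ) ^ ((z : ℕ) * (x + y)) • f (bracketNeg D Z X) Y

/-- The Chevalley-Eilenberg differential on even 1-cochains of `s₋` with values in `s`. -/
noncomputable def d1 :
    (Neg D →ₗ[ℝ] Poinc D) →ₗ⁅ℝ, SoSp η⁆ (Neg D →ₗ[ℝ] Neg D →ₗ[ℝ] Poinc D) where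
  toFun f := LinearMap.mk₂ ℝ (fun X Y => ∑ x, ∑ y, d1h D f x y (par D x X) (par D y Y))
    (by
      intro X X' Y
      simp only [← Finset.sum_add_distrib]
      refine Finset.sum_congr rfl fun x _ => Finset.sum_congr rfl fun y _ => ?_
      simp only [d1h, map_add, LinearMap.add_apply]; module)
    (by
      intro c X Y
      simp only [Finset.smul_sum]
      refine Finset.sum_congr rfl fun x _ => Finset.sum_congr rfl fun y _ => ?_
      simp only [d1h, map_smul, LinearMap.smul_apply]; module)
    (by
      intro X Y Y'
      simp only [← Finset.sum_add_distrib]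
      refine Finset.sum_congr rfl fun x _ => Finset.sum_congr rfl fun y _ => ?_
      simp only [d1h, map_add, LinearMap.add_apply]; module)
    (by
      intro c X Y
      simp only [Finset.smul_sum]
      refine Finset.sum_congr rfl fun x _ => Finset.sum_congr rfl fun y _ => ?_
      simp only [d1h, map_smul, LinearMap.smul_apply]; module)
  map_add' f g := by
    refine LinearMap.ext fun X => LinearMap.ext fun Y => ?_
    simp only [LinearMap.mk₂_apply, LinearMap.add_apply, ← Finset.sum_add_distrib]
    refine Finset.sum_congr rfl fun x _ => Finset.sum_congr rfl fun y _ => ?_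
    simp only [d1h, map_add, LinearMap.add_apply]; module
  map_smul' c f := by
    refine LinearMap.ext fun X => LinearMap.ext fun Y => ?_
    simp only [LinearMap.mk₂_apply, LinearMap.smul_apply, Finset.smul_sum, RingHom.id_apply]
    refine Finset.sum_congr rfl fun x _ => Finset.sum_congr rfl fun y _ => ?_
    simp only [d1h, map_smul, LinearMap.smul_apply]; module
  map_lie' := by
    intro T f
    refine LinearMap.ext fun X => LinearMap.ext fun Y => ?_
    simp only [LinearMap.mk₂_apply, LieHom.lie_apply, LinearMap.sub_apply, lie_sum,
       ← Finset.sum_sub_distrib]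
    refine Finset.sum_congr rfl fun x _ => Finset.sum_congr rfl fun y _ => ?_
    simp only [d1h, par_lie, incl_lie, LieHom.lie_apply, bracket_lie, bracketNeg_lie, lie_sub,
      lie_smul, map_add, map_sub]
    module

theorem d1_apply (f : Neg D →ₗ[ℝ] Poinc D) (X Y : Neg D) :
    d1 D f X Y = ∑ x, ∑ y, d1h D f x y (par D x X) (par D y Y) := rfl

/-- The Chevalley-Eilenberg differential on even 2-cochains of `s₋` with values in `s`. -/
noncomputable def d2 (f : Neg D →ₗ[ℝ] Neg D →ₗ[ℝ] Poinc D) (X Y Z : Neg D) : Poinc D :=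
  ∑ x, ∑ y, ∑ z, d2h D f x y z (par D x X) (par D y Y) (par D z Z)

theorem d2_add (f g : Neg D →ₗ[ℝ] Neg D →ₗ[ℝ] Poinc D) (X Y Z : Neg D) :
    d2 D (f + g) X Y Z = d2 D f X Y Z + d2 D g X Y Z := by
  simp only [d2, ← Finset.sum_add_distrib]
  refine Finset.sum_congr rfl fun x _ => Finset.sum_congr rfl fun y _ =>
    Finset.sum_congr rfl fun z _ => ?_
  simp only [d2h, map_add, LinearMap.add_apply]
  module

theorem d2_smul (c : ℝ) (f : Neg D →ₗ[ℝ] Neg D →ₗ[ℝ] Poinc D) (X Y Z : Neg D) :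
    d2 D (c • f) X Y Z = c • d2 D f X Y Z := by
  simp only [d2, Finset.smul_sum]
  refine Finset.sum_congr rfl fun x _ => Finset.sum_congr rfl fun y _ =>
    Finset.sum_congr rfl fun z _ => ?_
  simp only [d2h, map_smul, LinearMap.smul_apply]
  module

theorem d2h_lie (T : SoSp η) (f : Neg D →ₗ[ℝ] Neg D →ₗ[ℝ] Poinc D) (x y z : Fin 2)
    (X Y Z : Neg D) : d2h D ⁅T, f⁆ x y z X Y Z = ⁅T, d2h D f x y z X Y Z⁆ -
      d2h D f x y z ⁅T, X⁆ Y Z - d2h D f x y z X ⁅T, Y⁆ Z - d2h D f x y z X Y ⁅T, Z⁆ := by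
  simp only [d2h, incl_lie, LieHom.lie_apply, LinearMap.sub_apply, bracket_lie,
    bracketNeg_lie, lie_sub, lie_add, lie_smul, map_add, map_sub, LinearMap.add_apply]
  module

theorem d2_lie (T : SoSp η) (f : Neg D →ₗ[ℝ] Neg D →ₗ[ℝ] Poinc D) (X Y Z : Neg D) :
    d2 D ⁅T, f⁆ X Y Z =
      ⁅T, d2 D f X Y Z⁆ - d2 D f ⁅T, X⁆ Y Z - d2 D f X ⁅T, Y⁆ Z - d2 D f X Y ⁅T, Z⁆ := by
  simp only [d2, lie_sum, ← Finset.sum_sub_distrib, d2h_lie, par_lie]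

/-- The grading of `s`: `V`, `S`, `so(V)` in degrees `-2`, `-1`, `0`. -/
def gr (i : ℤ) : LieSubmodule ℝ (SoSp η) (Poinc D) where
  carrier := {p | (i ≠ -2 → p.1 = 0) ∧ (i ≠ -1 → p.2.1 = 0) ∧ (i ≠ 0 → p.2.2 = 0)}
  zero_mem' := by simp
  add_mem' := by
    rintro p q ⟨h1, h2, h3⟩ ⟨k1, k2, k3⟩
    exact ⟨fun h => by simp [h1 h, k1 h], fun h => by simp [h2 h, k2 h],
      fun h => by simp [h3 h, k3 h]⟩
  smul_mem' := by
    rintro c p ⟨h1, h2, h3⟩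
    exact ⟨fun h => by simp [h1 h], fun h => by simp [h2 h], fun h => by simp [h3 h]⟩
  lie_mem := by
    rintro T p ⟨h1, h2, h3⟩
    exact ⟨fun h => by simp [prod_lie, h1 h], fun h => by simp [prod_lie, h2 h],
      fun h => by simp [prod_lie, h3 h]⟩

/-- The grading of `s₋`. -/
def grNeg (i : ℤ) : LieSubmodule ℝ (SoSp η) (Neg D) where
  carrier := {p | (i ≠ -2 → p.1 = 0) ∧ (i ≠ -1 → p.2 = 0)}
  zero_mem' := by simp
  add_mem' := by
    rintro p q ⟨h1, h2⟩ ⟨k1, k2⟩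
    exact ⟨fun h => by simp [h1 h, k1 h], fun h => by simp [h2 h, k2 h]⟩
  smul_mem' := by
    rintro c p ⟨h1, h2⟩
    exact ⟨fun h => by simp [h1 h], fun h => by simp [h2 h]⟩
  lie_mem := by
    rintro T p ⟨h1, h2⟩
    exact ⟨fun h => by simp [prod_lie, h1 h], fun h => by simp [prod_lie, h2 h]⟩

/-- `C^{2,1}(s₋; s)`: the linear maps `s₋ → s` of degree `2`. -/
def C21 : LieSubmodule ℝ (SoSp η) (Neg D →ₗ[ℝ] Poinc D) where
  carrier := {f | ∀ i, ∀ X ∈ grNeg D i, f X ∈ gr D (i + 2)}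
  zero_mem' := fun i _ _ => (gr D (i + 2)).zero_mem
  add_mem' hf hg := fun i X hX => (gr D (i + 2)).add_mem (hf i X hX) (hg i X hX)
  smul_mem' c _ hf := fun i X hX => (gr D (i + 2)).smul_mem c (hf i X hX)
  lie_mem hf := fun i X hX => (gr D (i + 2)).sub_mem
    ((gr D (i + 2)).lie_mem (hf i X hX)) (hf i _ ((grNeg D i).lie_mem hX))

/-- `C^{2,2}(s₋; s)`: the super-skew-symmetric bilinear maps `s₋ × s₋ → s` of degree `2`. -/
def C22 : LieSubmodule ℝ (SoSp η) (Neg D →ₗ[ℝ] Neg D →ₗ[ℝ] Poinc D) where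
  carrier := {f | (∀ i j, ∀ X ∈ grNeg D i, ∀ Y ∈ grNeg D j, f X Y ∈ gr D (i + j + 2)) ∧
    ∀ (x y : Fin 2) (X Y : Neg D), f (par D x X) (par D y Y) =
      -((-1 : ℝ) ^ ((x : ℕ) * y) • f (par D y Y) (par D x X))}
  zero_mem' := ⟨fun i j X _ Y _ => (gr D (i + j + 2)).zero_mem, fun x y X Y => by simp⟩
  add_mem' hf hg := ⟨fun i j X hX Y hY =>
      (gr D (i + j + 2)).add_mem (hf.1 i j X hX Y hY) (hg.1 i j X hX Y hY), fun x y X Y => by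
      rw [LinearMap.add_apply, LinearMap.add_apply, hf.2, hg.2, LinearMap.add_apply,
        LinearMap.add_apply, smul_add, neg_add]⟩
  smul_mem' c _ hf := ⟨fun i j X hX Y hY =>
      (gr D (i + j + 2)).smul_mem c (hf.1 i j X hX Y hY), fun x y X Y => by
      rw [LinearMap.smul_apply, LinearMap.smul_apply, hf.2, LinearMap.smul_apply,
        LinearMap.smul_apply, smul_neg, smul_comm]⟩
  lie_mem {T f} hf := ⟨fun i j X hX Y hY => by
      simp only [LieHom.lie_apply, LinearMap.sub_apply]
      exact (gr D (i + j + 2)).sub_mem ((gr D (i + j + 2)).sub_mem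
        ((gr D (i + j + 2)).lie_mem (hf.1 i j X hX Y hY))
        (hf.1 i j _ hX _ ((grNeg D j).lie_mem hY)))
        (hf.1 i j _ ((grNeg D i).lie_mem hX) _ hY), fun x y X Y => by
      simp only [LieHom.lie_apply, LinearMap.sub_apply, ← par_lie]
      rw [hf.2 x y X Y, hf.2 x y X ⁅T, Y⁆, hf.2 x y ⁅T, X⁆ Y, lie_neg, lie_smul]
      module⟩

/-- The cocycles `Z^{2,2}(s₋; s)`. -/
noncomputable def Z22 : LieSubmodule ℝ (SoSp η) (Neg D →ₗ[ℝ] Neg D →ₗ[ℝ] Poinc D) where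
  carrier := {f | f ∈ C22 D ∧ ∀ X Y Z, d2 D f X Y Z = 0}
  zero_mem' := ⟨(C22 D).zero_mem, fun X Y Z => by simpa using d2_smul D 0 0 X Y Z⟩
  add_mem' hf hg := ⟨(C22 D).add_mem hf.1 hg.1, fun X Y Z => by
    rw [d2_add, hf.2, hg.2, add_zero]⟩
  smul_mem' c _ hf := ⟨(C22 D).smul_mem c hf.1, fun X Y Z => by
    rw [d2_smul, hf.2, smul_zero]⟩
  lie_mem hf := ⟨(C22 D).lie_mem hf.1, fun X Y Z => by
    rw [d2_lie, hf.2, hf.2, hf.2, hf.2]; simp⟩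

/-- The coboundaries `∂ C^{2,1}(s₋; s)`. -/
noncomputable def B22 : LieSubmodule ℝ (SoSp η) (Neg D →ₗ[ℝ] Neg D →ₗ[ℝ] Poinc D) :=
  (C21 D).map (d1 D)

/-- The coboundaries as a submodule of the cocycles. -/
noncomputable def B22' : LieSubmodule ℝ (SoSp η) (Z22 D) := (B22 D).comap (Z22 D).incl

/-- The Spencer cohomology `H^{2,2}(s₋; s)`, a module of `so(V) ⊕ sp(1)`. -/
abbrev H22 : Type _ := Z22 D ⧸ B22' D

theorem d1_explicit {f : Neg D →ₗ[ℝ] Poinc D} (hf : f ∈ C21 D) (X Y : Neg D) :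
    d1 D f X Y = (((f (X.1, 0)).2.2 : Module.End ℝ V) Y.1 - ((f (Y.1, 0)).2.2 : Module.End ℝ V) X.1,
      soS D (f (X.1, 0)).2.2 Y.2 - soS D (f (Y.1, 0)).2.2 X.2,
      -(f (D.kappa X.2 Y.2, 0)).2.2) := by
  have hV : ∀ v : V, f (v, 0) = (0, 0, (f (v, 0)).2.2) := by
    intro v
    have h := hf (-2) (v, 0) ⟨fun h => absurd rfl h, fun _ => rfl⟩
    exact Prod.ext (h.1 (by norm_num)) (Prod.ext (h.2.1 (by norm_num)) rfl)
  have hS : ∀ s : D.S, f (0, s) = 0 := by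
    intro s
    have h := hf (-1) (0, s) ⟨fun _ => rfl, fun h => absurd rfl h⟩
    exact Prod.ext (h.1 (by norm_num)) (Prod.ext (h.2.1 (by norm_num)) (h.2.2 (by norm_num)))
  rw [d1_apply]
  simp only [Fin.sum_univ_two, d1h, par_zero, par_one, hS, bracketNeg_apply, map_zero,
    LinearMap.zero_apply]
  rw [hV X.1, hV Y.1, hV (D.kappa X.2 Y.2)]
  simp [bracket_apply, incl_apply]
  exact ⟨by abel, by abel⟩

/-- Coboundaries are cocycles. -/
theorem B22_le_Z22 : B22 D ≤ Z22 D := by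
  rintro g hg
  obtain ⟨f, hf, rfl⟩ := (LieSubmodule.mem_map g).1 hg
  obtain ⟨φ, hφ⟩ : ∃ φ : V →ₗ[ℝ] so η, ∀ X Y, d1 D f X Y =
      ((φ X.1 : Module.End ℝ V) Y.1 - (φ Y.1 : Module.End ℝ V) X.1,
        soS D (φ X.1) Y.2 - soS D (φ Y.1) X.2, -φ (D.kappa X.2 Y.2)) :=
    ⟨LinearMap.snd ℝ D.S (so η) ∘ₗ LinearMap.snd ℝ V (D.S × so η) ∘ₗ f ∘ₗ
      LinearMap.inl ℝ V D.S, d1_explicit D hf⟩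
  refine ⟨⟨?_, ?_⟩, ?_⟩
  · rintro i j X ⟨hX, hX'⟩ Y ⟨hY, hY'⟩
    rw [hφ]
    refine ⟨fun h => ?_, fun h => ?_, fun h => ?_⟩
    · by_cases hi : i = -2
      · rw [show Y.1 = 0 from hY (by omega)]; simp
      · rw [hX hi]; simp
    · by_cases hi : i = -2
      · rw [show Y.2 = 0 from hY' (by omega), show X.2 = 0 from hX' (by omega)]; simp
      · rw [hX hi]
        by_cases hj : j = -2
        · rw [show X.2 = 0 from hX' (by omega)]; simp
        · rw [hY hj]; simp
    · by_cases hi : i = -1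
      · rw [show Y.2 = 0 from hY' (by omega)]; simp
      · rw [hX' hi]; simp
  · intro x y X Y
    rw [hφ, hφ]
    fin_cases x <;> fin_cases y <;> simp [par_zero, par_one, D.kappa_symm X.2 Y.2]
  · intro X Y Z
    have hk : ∀ (A : so η) (s t : D.S), (A : Module.End ℝ V) (D.kappa s t) =
        D.kappa (soS D A s) t + D.kappa s (soS D A t) :=
      fun A s t => D.kappa_lie ((A, 0) : SoSp η) s t
    refine Finset.sum_eq_zero fun x _ => Finset.sum_eq_zero fun y _ =>
      Finset.sum_eq_zero fun z _ => ?_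
    simp only [d2h, hφ, bracketNeg_apply, bracket_apply, incl_apply]
    fin_cases x <;> fin_cases y <;> fin_cases z <;>
      simp [par_zero, par_one]
    · rw [hk (φ X.1), D.kappa_symm (soS D (φ X.1) Y.2)]; abel
    · rw [hk (φ Y.1), D.kappa_symm X.2]; abel
    · rw [hk (φ Z.1), D.kappa_symm (soS D (φ Z.1) X.2)]; abel

/-- The normalised cochains: those whose component in `Hom(∧²V, V)` vanishes. -/
def IsNormalised (f : Neg D →ₗ[ℝ] Neg D →ₗ[ℝ] Poinc D) : Prop :=
  ∀ v w : V, (f (v, 0) (w, 0)).1 = 0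

end Superalgebra

section Formulas

variable {V : Type*} [AddCommGroup V] [Module ℝ V] {η : LinearMap.BilinForm ℝ V}
  {e : LorentzFrame η} {Sg : Type*} [AddCommGroup Sg] [Module ℂ Sg] (D : SpinorModule e Sg)

/-- The Levi-Civita symbol `ε_{μνρστ}` of `V`, with `ε₀₁₂₃₄ = 1`. -/
def levi (μ ν ρ σ τ : Fin 5) : ℝ :=
  Matrix.det (Matrix.of fun a b : Fin 5 => if ![μ, ν, ρ, σ, τ] a = b then (1 : ℝ) else 0)

/-- The components `C^{μν}` of `C = ½ C^{μν} e_μ ∧ e_ν`. -/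
noncomputable def upC (e : LorentzFrame η) (C : wedge2V η) (μ ν : Fin 5) : ℝ :=
  (e.basis.tensorProduct e.basis).repr (C : V ⊗[ℝ] V) (μ, ν)

/-- The components `C_{μν}`. -/
noncomputable def downC (e : LorentzFrame η) (C : wedge2V η) (μ ν : Fin 5) : ℝ :=
  sgn μ * sgn ν * upC e C μ ν

/-- `Γ_{μν} = ½ [Γ_μ, Γ_ν]`. -/
noncomputable def gamma2 (μ ν : Fin 5) : Module.End ℂ Sg :=
  (1 / 2 : ℝ) • (D.gamma (e.basis μ) * D.gamma (e.basis ν) -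
    D.gamma (e.basis ν) * D.gamma (e.basis μ))

/-- The Clifford action of `C`: `½ C^{μν} Γ_{μν}`. -/
noncomputable def cliffC (C : wedge2V η) : Module.End ℂ Sg :=
  (1 / 2 : ℝ) • ∑ μ, ∑ ν, upC e C μ ν • gamma2 D μ ν

/-- The component `F^{μ A}_B` of the `sp(1)`-valued vector with components `F^{μ AB}`. -/
noncomputable def mixedF (F : Fin 5 → sym2Delta η) (μ : Fin 5) (a b : Fin 2) : ℂ :=
  lowerIndex (F μ : Matrix (Fin 2) (Fin 2) ℂ) a b

/-- The component `F^μ_{AB} = ε_{AC} F^{μ C}_B`. -/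
noncomputable def downF (F : Fin 5 → sym2Delta η) (μ : Fin 5) (a b : Fin 2) : ℂ :=
  ∑ c, eps2 a c * mixedF F μ c b

/-- The Clifford action of `F^A_B`: `F^{μ A}_B Γ_μ`. -/
noncomputable def cliffF (F : Fin 5 → sym2Delta η) (a b : Fin 2) : Module.End ℂ Sg :=
  ∑ μ, mixedF F μ a b • D.gamma (e.basis μ)

/-- The bilinear `ω^{AB}_{μν} = s̄^A Γ_{μν} s^B`. -/
noncomputable def omega (s : D.S) (a b : Fin 2) (μ ν : Fin 5) : ℂ :=
  D.C (s.1 a) (gamma2 D μ ν (s.1 b))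

/-- `β(v,s)^B = ¼ v·C·s^B - ¾ C·v·s^B - ⅛ v·F^B_C·s^C - ⅜ F^B_C·v·s^C`. -/
noncomputable def betaFormula (C : wedge2V η) (F : Fin 5 → sym2Delta η) (v : V) (s : D.S)
    (b : Fin 2) : Sg :=
  (1 / 4 : ℝ) • D.gamma v (cliffC D C (s.1 b)) - (3 / 4 : ℝ) • cliffC D C (D.gamma v (s.1 b))
    - (1 / 8 : ℝ) • ∑ c, D.gamma v (cliffF D F b c (s.1 c))
    - (3 / 8 : ℝ) • ∑ c, cliffF D F b c (D.gamma v (s.1 c))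

/-- `γ(s,s)_{μν} = 2 μ_s C_{μν} + ½ κ^ρ ε_{μνρστ} C^{στ} + ¼ ε_{μνρ}^{στ} F^ρ_{AB} ω^{AB}_{στ}`. -/
noncomputable def gammaFormula (C : wedge2V η) (F : Fin 5 → sym2Delta η) (s : D.S)
    (μ ν : Fin 5) : ℂ :=
  2 * D.ip s s * downC e C μ ν
    + 1 / 2 * ∑ ρ, ∑ σ, ∑ τ, e.basis.repr (D.kappa s s) ρ * levi μ ν ρ σ τ * upC e C σ τ
    + 1 / 4 * ∑ ρ, ∑ σ, ∑ τ, levi μ ν ρ σ τ * sgn σ * sgn τ *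
        ∑ a, ∑ b, downF F ρ a b * omega D s a b σ τ

end Formulas


end Spencer5

/-! A degree-2 one-cochain is a map `V → so(V)`, and the `Hom(∧²V, V)` component of its differential
is the torsion of the corresponding metric connection. Since torsion determines a metric connection
and is arbitrary (`so_eq_zero_of_symm`, `exists_so_of_torsion`), each class has exactly one
normalised representative, and the cohomology is the space of normalised cocycles β + γ.

On `V ⊗ ⊙²S` the cocycle condition reads γ(s,s)v = -2κ(s, β(v,s)). So β determines γ, and γ has
values in `so(V)` exactly when ⟨s, v·β(v,s)⟩ = 0 for all v and s. On `⊙³S` it reads β(κ_s, s) +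
γ(s,s)s = 0. These two conditions on β define `cocycleBeta`.

The first condition is linear algebra in the 28-dimensional space of skew operators on the
8-dimensional `S`. The products of two distinct operators among the five Γ_μ and the three
quaternion units span it (`skewOp_expand`), and comparing coefficients gives β(v) = v·P + (C + F)·v
with P skew, C a bivector and F an `sp(1)`-valued vector (`exists_of_skew`).

For the second condition, write C·v = v·C + (Cv)· and F·v = -v·F + 2F(v), where Cv and F(v) are the
contractions with v. The cubic expressions of the three building blocks v·P, (Cv)· and F(v) are 3/2,
-1 and 1/2 times (μ_s + κ_s) applied to Ps, Cs and Fs. The first uses a Fierz identity (`fierz`),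
the other two use κ_s·s = μ_s s (`cl_kappa_self`). Altogether the cubic expression is 3/2 (μ_s +
κ_s)P's with P' = P + C/3 - F/3, and a skew P' for which this vanishes identically is zero
(`eq_zero_of_coord`). Hence P = (F - C)/3, and rescaling C by -4/3 and F by -8/3 gives the
coefficients of the stated β (`exists_betaMap`).

C and F are recovered from β by contracting with the Γ^μ (`eq_zero_of_betaMap`). All the
constructions are equivariant, so (C, F) ↦ β induces the isomorphism. The formula for γ comes from
-2κ(s, β(v,s)) together with the duality Γ_0Γ_1Γ_2Γ_3Γ_4 = 1, which produces the Levi-Civita terms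
(`ip_gamma_four`, `ip_gamma_three`).

The identities on `S` that depend on the dimension are checked in an explicit basis
(`nonempty_spinFrame`) on which the Γ_μ and the quaternion units act by signed permutations. They
become polynomial identities or finite computations with signs. -/

open scoped TensorProduct

namespace Spencer5

attribute [local instance] LieRing.ofAssociativeRing

/-! ### The real module `S`: commuting Clifford and quaternion actions, and the inner product. -/

section SpinorBasis

variable {V : Type*} [AddCommGroup V] [Module ℝ V] {η : LinearMap.BilinForm ℝ V}
  {e : LorentzFrame η} {Sg : Type*} [AddCommGroup Sg] [Module ℂ Sg]

/-- The three quaternion units of `sp(1)`. -/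
noncomputable def quatMatrix : Fin 3 → Matrix (Fin 2) (Fin 2) ℂ :=
  ![!![Complex.I, 0; 0, -Complex.I], !![0, 1; -1, 0], !![0, Complex.I; Complex.I, 0]]

theorem mem_sp1_iff (a : Matrix (Fin 2) (Fin 2) ℂ) :
    a ∈ sp1 ↔ a.transpose * eps2 + eps2 * a = 0 ∧
      eps2 * a.map (starRingEnd ℂ) = a * eps2 := Iff.rfl

theorem quatMatrix_mem (k : Fin 3) : quatMatrix k ∈ sp1 := by
  rw [mem_sp1_iff]
  fin_cases k <;> refine ⟨?_, ?_⟩ <;> ext i j <;> fin_cases i <;> fin_cases j <;>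
    simp [quatMatrix, eps2, Matrix.mul_apply, Fin.sum_univ_two, -Matrix.cons_mul]

noncomputable def quatUnit (k : Fin 3) : sp1 := ⟨quatMatrix k, quatMatrix_mem k⟩

/-- Every element of `sp(1)` is an imaginary quaternion. -/
theorem sp1_eq_sum (a : sp1) : ∃ f : Fin 3 → ℝ, a = ∑ k, f k • quatUnit k := by
  obtain ⟨a, h, h'⟩ := a
  have h0 : ∀ i j, (a.transpose * eps2 + eps2 * a) i j = 0 := fun i j => by rw [h]; rfl
  have h0' : ∀ i j, (eps2 * a.map (starRingEnd ℂ)) i j = (a * eps2) i j :=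
    fun i j => by rw [h']
  have t01 := h0 0 1
  have r00 := h0' 0 0
  have r01 := h0' 0 1
  have r10 := h0' 1 0
  have r11 := h0' 1 1
  simp [Matrix.mul_apply, Fin.sum_univ_two, eps2, -Matrix.cons_mul] at t01 r00 r01 r10 r11
  refine ⟨![(a 0 0).im, (a 0 1).re, (a 0 1).im], ?_⟩
  refine Subtype.ext ?_
  simp only [AddSubmonoidClass.coe_finsetSum, SetLike.val_smul, quatUnit]
  have hre : (a 0 0).re = 0 := by
    have e1 := congrArg Complex.re t01
    have e2 := congrArg Complex.re r10
    simp at e1 e2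
    linarith
  have e1 := congrArg Complex.re t01
  have e2 := congrArg Complex.im t01
  have e3 := congrArg Complex.re r00
  have e4 := congrArg Complex.im r00
  simp at e1 e2 e3 e4
  ext i j
  fin_cases i <;> fin_cases j <;> apply Complex.ext <;>
    simp [Fin.sum_univ_three, quatMatrix] <;> linarith

namespace SpinorModule

variable (D : SpinorModule e Sg)

/-- Clifford multiplication on `S` as a linear map. -/
noncomputable def cl : V →ₗ[ℝ] Module.End ℝ D.S :=
  LinearMap.mk₂ ℝ D.cliff
    (fun v w s => S_ext fun a => by simp [cliff_val])
    (fun c v s => S_ext fun a => by simp [cliff_val])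
    D.cliff_add (fun c v s => D.cliff_smul v c s)

theorem cl_val (v : V) (s : D.S) (a : Fin 2) : (D.cl v s).1 a = D.gamma v (s.1 a) := rfl

/-- The action of `sp(1)` on `S` as a linear map. -/
noncomputable def qu : sp1 →ₗ[ℝ] Module.End ℝ D.S :=
  LinearMap.mk₂ ℝ (fun a s => ⁅((0, a) : SoSp η), s⁆)
    (by intro A B s; rw [← add_lie]; simp)
    (by intro c A s; rw [← smul_lie]; simp)
    (by intro A s t; rw [lie_add])
    (by intro c A s; rw [lie_smul])

theorem qu_apply (a : sp1) (s : D.S) : D.qu a s = ⁅((0, a) : SoSp η), s⁆ := rfl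

theorem qu_val (a : sp1) (s : D.S) (i : Fin 2) :
    (D.qu a s).1 i = ∑ j, (a : Matrix (Fin 2) (Fin 2) ℂ) i j • s.1 j := by
  rw [qu_apply, spinor_lie]; simp

theorem cl_mul_cl (v w : V) :
    D.cl v * D.cl w = (2 * η v w) • 1 - D.cl w * D.cl v := by
  refine LinearMap.ext fun s => S_ext fun a => ?_
  have := LinearMap.congr_fun (D.gamma_comm v w) (s.1 a)
  simpa [cl_val] using this

theorem cl_qu (v : V) (a : sp1) : D.cl v * D.qu a = D.qu a * D.cl v := by
  refine LinearMap.ext fun s => S_ext fun i => ?_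
  simp [cl_val, qu_val, Fin.sum_univ_two]

theorem qu_mul_qu (a b c : sp1)
    (h : (a : Matrix (Fin 2) (Fin 2) ℂ) * (b : Matrix (Fin 2) (Fin 2) ℂ) = c) :
    D.qu a * D.qu b = D.qu c := by
  refine LinearMap.ext fun s => S_ext fun i => ?_
  simp only [Module.End.mul_apply, qu_val, ← h, Matrix.mul_apply, Fin.sum_univ_two, smul_add,
    smul_smul, add_smul]
  abel

theorem cl_volume : D.cl (e.basis 0) * (D.cl (e.basis 1) * (D.cl (e.basis 2) *
    (D.cl (e.basis 3) * D.cl (e.basis 4)))) = 1 := by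
  refine LinearMap.ext fun s => S_ext fun i => ?_
  have := LinearMap.congr_fun D.volume (s.1 i)
  simpa [cl_val, gamma, mul_assoc] using this

theorem qu_unit_mul_self (k : Fin 3) : D.qu (quatUnit k) * D.qu (quatUnit k) = -1 := by
  refine LinearMap.ext fun s => S_ext fun i => ?_
  simp only [Module.End.mul_apply, qu_val]
  fin_cases k <;> fin_cases i <;> simp [quatUnit, quatMatrix, smul_smul]

theorem qu_unit_mul_zero_one :
    D.qu (quatUnit 0) * D.qu (quatUnit 1) = D.qu (quatUnit 2) := by
  refine D.qu_mul_qu _ _ _ ?_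
  ext i j; fin_cases i <;> fin_cases j <;> simp [quatUnit, quatMatrix]

theorem qu_unit_mul_one_zero :
    D.qu (quatUnit 1) * D.qu (quatUnit 0) = -D.qu (quatUnit 2) := by
  refine LinearMap.ext fun s => S_ext fun i => ?_
  simp only [Module.End.mul_apply, qu_val, LinearMap.neg_apply, S_neg]
  fin_cases i <;> simp [quatUnit, quatMatrix, smul_smul]

theorem ip_cl (v : V) (s t : D.S) : D.ip (D.cl v s) t = D.ip s (D.cl v t) := D.ip_cliff v s t

theorem ip_qu (a : sp1) (s t : D.S) : D.ip (D.qu a s) t = -D.ip s (D.qu a t) :=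
  D.ip_lie (0, a) s t

theorem J_comp_zero (s : D.S) : D.J (s.1 0) = s.1 1 := by
  have h : D.J (s.1 0) = ∑ b, eps2 0 b • s.1 b := s.2 0
  simpa [eps2] using h

/-- A symplectic Majorana spinor is determined by its first component, which is arbitrary. -/
noncomputable def compEquiv : D.S ≃ₗ[ℝ] Sg where
  toFun s := s.1 0
  map_add' _ _ := rfl
  map_smul' _ _ := rfl
  invFun ψ := D.mkS ![ψ, D.J ψ] (by intro a; fin_cases a <;> simp [eps2, J_J])
  left_inv s := by
    refine S_ext fun a => ?_
    fin_cases a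
    · rfl
    · exact D.J_comp_zero s
  right_inv ψ := rfl

theorem compEquiv_symm_val_zero (ψ : Sg) : (D.compEquiv.symm ψ).1 0 = ψ := rfl

theorem finrank_S : Module.finrank ℝ D.S = 8 := by
  rw [D.compEquiv.finrank_eq, finrank_real_of_complex, D.finrank_eq]

/-- The inner product of `S` is nondegenerate. -/
theorem ip_nondeg (s : D.S) (h : ∀ t, D.ip s t = 0) : s = 0 := by
  have h1 : ∀ ψ, D.C (s.1 0) (D.J ψ) = 0 := by
    have key : ∀ ψ, (D.C (s.1 0) (D.J ψ)).re = 0 := by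
      intro ψ
      have h2 := D.ip_apply s (D.compEquiv.symm ψ)
      rw [h] at h2
      -- Reality of the symplectic form turns the pairing with the spinor of first component ψ into
      -- twice the real part of C(s¹, Jψ). Replacing ψ by iψ below gives the imaginary part.
      have h3 : D.C (D.J (s.1 0)) ψ = -starRingEnd ℂ (D.C (s.1 0) (D.J ψ)) := by
        rw [← D.C_J, J_J]; simp
      simp [pairing, Fin.sum_univ_two, eps2, compEquiv_symm_val_zero,
        ← J_comp_zero, h3] at h2
      have := congrArg Complex.re h2
      simp at this
      linarith
    intro ψ
    refine Complex.ext (key ψ) ?_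
    have := key (Complex.I • ψ)
    simpa [map_smulₛₗ] using this
  have h2 : s.1 0 = 0 := by
    refine D.C_nondeg _ fun t => ?_
    have := h1 (-D.J t)
    rwa [map_neg, J_J, neg_neg] at this
  exact D.compEquiv.injective (show s.1 0 = (0 : D.S).1 0 from h2)

end SpinorModule

end SpinorBasis

/-! ### A joint eigenvector of commuting involutions. -/

theorem exists_fixed_of_anticomm {M : Type*} [AddCommGroup M] [Module ℝ M]
    (A T : Module.End ℝ M) (P : M → Prop) (hP : ∀ x y, P x → P y → P (x + y))
    (hPA : ∀ x, P x → P (A x)) (hPT : ∀ x, P x → P (T x)) (hA : ∀ x, A (A x) = x)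
    (hTA : ∀ x, A (T x) = -T (A x)) (hT : ∀ x, T x = 0 → x = 0)
    (h : ∃ x, x ≠ 0 ∧ P x) : ∃ x, x ≠ 0 ∧ P x ∧ A x = x := by
  obtain ⟨t, ht, hPt⟩ := h
  -- `t + A t` is fixed by the involution. If it vanishes then `t` has eigenvalue -1, and the
  -- anticommuting injective `T` moves it to eigenvalue +1.
  by_cases h0 : t + A t = 0
  · refine ⟨T t, fun h => ht (hT _ h), hPT _ hPt, ?_⟩
    rw [hTA, eq_neg_of_add_eq_zero_right h0, map_neg, neg_neg]
  · refine ⟨t + A t, h0, hP _ _ hPt (hPA _ hPt), ?_⟩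
    rw [map_add, hA, add_comm]

section SpinorBasis

variable {V : Type*} [AddCommGroup V] [Module ℝ V] {η : LinearMap.BilinForm ℝ V}
  {e : LorentzFrame η} {Sg : Type*} [AddCommGroup Sg] [Module ℂ Sg]

namespace SpinorModule

variable (D : SpinorModule e Sg)

theorem cl_basis_sq (μ : Fin 5) (x : D.S) :
    D.cl (e.basis μ) (D.cl (e.basis μ) x) = sgn μ • x := by
  have h := LinearMap.congr_fun (D.cl_mul_cl (e.basis μ) (e.basis μ)) x
  rw [e.orthonormal, if_pos rfl] at h
  simp only [Module.End.mul_apply, LinearMap.sub_apply, LinearMap.smul_apply,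
    Module.End.one_apply] at h
  rw [eq_sub_iff_add_eq, ← two_smul ℝ, mul_smul] at h
  exact smul_right_injective _ (two_ne_zero' ℝ) h

theorem cl_basis_swap {μ ν : Fin 5} (h : μ ≠ ν) (x : D.S) :
    D.cl (e.basis μ) (D.cl (e.basis ν) x) = -D.cl (e.basis ν) (D.cl (e.basis μ) x) := by
  have h' := LinearMap.congr_fun (D.cl_mul_cl (e.basis μ) (e.basis ν)) x
  rw [e.orthonormal, if_neg h] at h'
  simpa using h'

theorem cl_qu_apply (v : V) (a : sp1) (x : D.S) : D.cl v (D.qu a x) = D.qu a (D.cl v x) :=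
  LinearMap.congr_fun (D.cl_qu v a) x

theorem qu_unit_sq (k : Fin 3) (x : D.S) :
    D.qu (quatUnit k) (D.qu (quatUnit k) x) = -x :=
  LinearMap.congr_fun (D.qu_unit_mul_self k) x

theorem qu_unit_zero_one (x : D.S) :
    D.qu (quatUnit 0) (D.qu (quatUnit 1) x) = D.qu (quatUnit 2) x :=
  LinearMap.congr_fun D.qu_unit_mul_zero_one x

theorem qu_unit_one_zero (x : D.S) :
    D.qu (quatUnit 1) (D.qu (quatUnit 0) x) = -D.qu (quatUnit 2) x :=
  LinearMap.congr_fun D.qu_unit_mul_one_zero x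

theorem qu_unit_zero_two (x : D.S) :
    D.qu (quatUnit 0) (D.qu (quatUnit 2) x) = -D.qu (quatUnit 1) x := by
  rw [← qu_unit_zero_one, qu_unit_sq]

theorem qu_unit_two_one (x : D.S) :
    D.qu (quatUnit 2) (D.qu (quatUnit 1) x) = -D.qu (quatUnit 0) x := by
  rw [← qu_unit_zero_one, qu_unit_sq, map_neg]

theorem qu_unit_one_two (x : D.S) :
    D.qu (quatUnit 1) (D.qu (quatUnit 2) x) = D.qu (quatUnit 0) x := by
  rw [← neg_eq_iff_eq_neg.2 (D.qu_unit_one_zero x), map_neg, qu_unit_sq, neg_neg]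

theorem qu_unit_two_zero (x : D.S) :
    D.qu (quatUnit 2) (D.qu (quatUnit 0) x) = D.qu (quatUnit 1) x := by
  rw [← neg_eq_iff_eq_neg.2 (D.qu_unit_one_zero (D.qu (quatUnit 0) x)), qu_unit_sq, map_neg,
    neg_neg]

/-- Γ_0, Γ_1Γ_2q_2 and Γ_2Γ_3q_0 are commuting involutions. They are treated in turn: each
anticommutes with an injective operator that preserves the eigenspaces already fixed, so its
eigenvalue +1 occurs there. -/
theorem exists_vacuum : ∃ s : D.S, s ≠ 0 ∧ D.cl (e.basis 0) s = s ∧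
    D.cl (e.basis 1) (D.cl (e.basis 2) (D.qu (quatUnit 2) s)) = s ∧
    D.cl (e.basis 2) (D.cl (e.basis 3) (D.qu (quatUnit 0) s)) = s := by
  have hne : ∃ x : D.S, x ≠ 0 ∧ True := by
    have : Nontrivial D.S := Module.nontrivial_of_finrank_pos (R := ℝ) (by rw [D.finrank_S]; norm_num)
    obtain ⟨x, hx⟩ := exists_ne (0 : D.S)
    exact ⟨x, hx, trivial⟩
  have sw : ∀ μ ν : Fin 5, ν < μ → ∀ x : D.S, D.cl (e.basis μ) (D.cl (e.basis ν) x) =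
      -D.cl (e.basis ν) (D.cl (e.basis μ) x) := fun μ ν h x => D.cl_basis_swap (ne_of_gt h) x
  have sw10 := sw 1 0 (by decide)
  have sw20 := sw 2 0 (by decide)
  have sw30 := sw 3 0 (by decide)
  have sw40 := sw 4 0 (by decide)
  have sw21 := sw 2 1 (by decide)
  have sw31 := sw 3 1 (by decide)
  have sw32 := sw 3 2 (by decide)
  have qinj : ∀ k, ∀ x : D.S, D.qu (quatUnit k) x = 0 → x = 0 := fun k x h => by
    rw [← neg_eq_zero, ← D.qu_unit_sq k x, h, map_zero]
  -- Γ_4 anticommutes with Γ_0.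
  have h1 := exists_fixed_of_anticomm (D.cl (e.basis 0)) (D.cl (e.basis 4)) (fun _ => True)
    (fun _ _ _ _ => trivial) (fun _ _ => trivial) (fun _ _ => trivial)
    (fun x => by rw [cl_basis_sq]; simp [sgn]) (fun x => by rw [sw40, neg_neg])
    (fun x h => by
      have := D.cl_basis_sq 4 x
      rw [h, map_zero] at this
      simpa [sgn] using this.symm) hne
  -- The unit q_0 anticommutes with q_2, hence with Γ_1Γ_2q_2, and commutes with Γ_0.
  have h2 := exists_fixed_of_anticomm
    (D.cl (e.basis 1) * D.cl (e.basis 2) * D.qu (quatUnit 2)) (D.qu (quatUnit 0))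
    (fun x => D.cl (e.basis 0) x = x)
    (fun x y hx hy => by rw [map_add, hx, hy])
    (fun x hx => by
      simp only [Module.End.mul_apply, cl_qu_apply]
      rw [D.cl_basis_swap (by decide : (0 : Fin 5) ≠ 1),
        D.cl_basis_swap (by decide : (0 : Fin 5) ≠ 2), hx]
      simp)
    (fun x hx => by simp only [cl_qu_apply, hx])
    (fun x => by
      simp only [Module.End.mul_apply, cl_qu_apply, qu_unit_sq, sw21, cl_basis_sq, map_neg,
        map_smul, sgn]
      simp)
    (fun x => by
      simp only [Module.End.mul_apply, cl_qu_apply, qu_unit_two_zero, qu_unit_zero_two, neg_neg])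
    (qinj 0) (by obtain ⟨x, hx, -, hx'⟩ := h1; exact ⟨x, hx, hx'⟩)
  -- The unit q_2 anticommutes with q_0, and commutes with Γ_0 and with Γ_1Γ_2q_2.
  have h3 := exists_fixed_of_anticomm
    (D.cl (e.basis 2) * D.cl (e.basis 3) * D.qu (quatUnit 0)) (D.qu (quatUnit 2))
    (fun x => D.cl (e.basis 0) x = x ∧
      (D.cl (e.basis 1) * D.cl (e.basis 2) * D.qu (quatUnit 2)) x = x)
    (fun x y hx hy => by
      rw [map_add, map_add, hx.1, hy.1, hx.2, hy.2]; exact ⟨rfl, rfl⟩)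
    (fun x hx => by
      refine ⟨?_, ?_⟩
      · simp only [Module.End.mul_apply, cl_qu_apply]
        rw [D.cl_basis_swap (by decide : (0 : Fin 5) ≠ 2),
          D.cl_basis_swap (by decide : (0 : Fin 5) ≠ 3), hx.1]
        simp
      · conv_rhs => rw [← hx.2]
        simp only [Module.End.mul_apply, cl_qu_apply, qu_unit_two_zero, qu_unit_zero_two, sw21,
          sw31, sw32, map_neg, neg_neg, cl_basis_sq, map_smul])
    (fun x hx => by
      refine ⟨?_, ?_⟩
      · simp only [cl_qu_apply, hx.1]
      · conv_rhs => rw [← hx.2]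
        simp only [Module.End.mul_apply, cl_qu_apply])
    (fun x => by
      simp only [Module.End.mul_apply, cl_qu_apply, qu_unit_sq, sw32, cl_basis_sq, map_neg,
        map_smul, sgn]
      simp)
    (fun x => by
      simp only [Module.End.mul_apply, cl_qu_apply, qu_unit_two_zero, qu_unit_zero_two, map_neg])
    (qinj 2) (by obtain ⟨x, hx, hx', hx''⟩ := h2; exact ⟨x, hx, hx', hx''⟩)
  obtain ⟨x, hx, ⟨hx0, hx1⟩, hx2⟩ := h3
  exact ⟨x, hx, hx0, hx1, hx2⟩

end SpinorModule

end SpinorBasis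

/-! ### A standard basis of `S` permuted up to sign by the generators. -/

/-- The signs with which the Clifford generators `0, …, 4` and the quaternion units `5, 6, 7` act
on the standard basis of `S`. -/
def opSign : Fin 8 → Fin 8 → ℤ :=
  ![![1, 1, 1, 1, -1, -1, -1, -1],
    ![1, -1, -1, 1, 1, -1, -1, 1],
    ![1, 1, -1, -1, 1, 1, -1, -1],
    ![1, -1, 1, -1, 1, -1, 1, -1],
    ![1, 1, 1, 1, -1, -1, -1, -1],
    ![1, -1, 1, -1, 1, -1, 1, -1],
    ![1, -1, -1, 1, 1, -1, -1, 1],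
    ![1, 1, -1, -1, 1, 1, -1, -1]]

/-- The Clifford generators and the quaternion units permute the lines spanned by the standard
basis vectors by adding these elements of `(ℤ/2)³`. -/
def opShift : Fin 8 → Fin 8 := ![0, 5, 6, 7, 4, 1, 2, 3]

/-- The signature of the inner product of `S`. -/
def spinSign : Fin 8 → ℤ := ![1, 1, 1, 1, -1, -1, -1, -1]

section SpinorBasis

variable {V : Type*} [AddCommGroup V] [Module ℝ V] {η : LinearMap.BilinForm ℝ V}
  {e : LorentzFrame η} {Sg : Type*} [AddCommGroup Sg] [Module ℂ Sg]

namespace SpinorModule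

variable (D : SpinorModule e Sg)

/-- The Clifford generators and the quaternion units as operators on `S`. -/
noncomputable def op : Fin 8 → Module.End ℝ D.S :=
  ![D.cl (e.basis 0), D.cl (e.basis 1), D.cl (e.basis 2), D.cl (e.basis 3), D.cl (e.basis 4),
    D.qu (quatUnit 0), D.qu (quatUnit 1), D.qu (quatUnit 2)]

/-- A basis of `S` on which the operators `op` act by signed permutations. -/
structure SpinFrame where
  b : Module.Basis (Fin 8) ℝ D.S
  c : ℝ
  c_ne : c ≠ 0
  op_b : ∀ a j, D.op a (b j) = (opSign a j : ℝ) • b (j ^^^ opShift a)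
  ip_b : ∀ i j, D.ip (b i) (b j) = if i = j then c * spinSign i else 0

/-- The volume element is 1 and Γ_0 fixes s, so Γ_1Γ_2Γ_3Γ_4 fixes s and its quaternion multiples.
Combined with the other two eigenvalue equations this expresses each Γ_i s through the single spinor
Γ_4 s. The quaternion multiples of s and Γ_4 s are then stable under every Clifford generator. -/
theorem cl_vacuum {s : D.S} (h0 : D.cl (e.basis 0) s = s)
    (h2 : D.cl (e.basis 1) (D.cl (e.basis 2) (D.qu (quatUnit 2) s)) = s)
    (h3 : D.cl (e.basis 2) (D.cl (e.basis 3) (D.qu (quatUnit 0) s)) = s) :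
    D.cl (e.basis 1) s = D.qu (quatUnit 0) (D.cl (e.basis 4) s) ∧
    D.cl (e.basis 2) s = D.qu (quatUnit 1) (D.cl (e.basis 4) s) ∧
    D.cl (e.basis 3) s = D.qu (quatUnit 2) (D.cl (e.basis 4) s) := by
  have vol : ∀ x, D.cl (e.basis 0) x = x → D.cl (e.basis 1) (D.cl (e.basis 2)
      (D.cl (e.basis 3) (D.cl (e.basis 4) x))) = x := by
    intro x hx
    have := LinearMap.congr_fun D.cl_volume x
    simp only [Module.End.mul_apply, Module.End.one_apply] at this
    have h := congrArg (D.cl (e.basis 0)) this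
    rw [cl_basis_sq, hx] at h
    simpa [sgn] using h
  have sw : ∀ μ ν : Fin 5, μ ≠ ν → ∀ x : D.S, D.cl (e.basis μ) (D.cl (e.basis ν) x) =
      -D.cl (e.basis ν) (D.cl (e.basis μ) x) := fun μ ν h x => D.cl_basis_swap h x
  have sq4 : ∀ x : D.S, D.cl (e.basis 4) (D.cl (e.basis 4) x) = -x := fun x => by
    rw [cl_basis_sq]; simp [sgn]
  have sq1 : ∀ x : D.S, D.cl (e.basis 1) (D.cl (e.basis 1) x) = -x := fun x => by
    rw [cl_basis_sq]; simp [sgn]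
  have g1 : D.cl (e.basis 1) s = D.qu (quatUnit 0) (D.cl (e.basis 4) s) := by
    have v := vol (D.qu (quatUnit 0) s) (by rw [cl_qu_apply, h0])
    rw [sw 3 4 (by decide), map_neg, sw 2 4 (by decide), neg_neg, h3, sw 1 4 (by decide)] at v
    have := congrArg (D.cl (e.basis 4)) v
    rw [map_neg, sq4, neg_neg, cl_qu_apply] at this
    exact this
  have g3 : D.cl (e.basis 3) s = D.qu (quatUnit 2) (D.cl (e.basis 4) s) := by
    have v := vol (D.qu (quatUnit 2) s) (by rw [cl_qu_apply, h0])
    rw [sw 2 3 (by decide), map_neg, sw 2 4 (by decide), map_neg, map_neg, neg_neg,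
      sw 1 3 (by decide), sw 1 4 (by decide), map_neg, neg_neg, h2, sw 3 4 (by decide)] at v
    have := congrArg (D.cl (e.basis 4)) v
    rw [map_neg, sq4, neg_neg, cl_qu_apply] at this
    exact this
  refine ⟨g1, ?_, g3⟩
  have h := congrArg (D.cl (e.basis 1)) h2
  rw [sq1, cl_qu_apply, g1] at h
  have h' := congrArg (D.qu (quatUnit 2)) h
  rw [map_neg, qu_unit_sq, neg_neg, qu_unit_two_zero] at h'
  exact h'

/-- The quaternion multiples of two spinors. -/
noncomputable def quatFamily (s r : D.S) : Fin 8 → D.S :=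
  ![s, D.qu (quatUnit 0) s, D.qu (quatUnit 1) s, D.qu (quatUnit 2) s,
    r, D.qu (quatUnit 0) r, D.qu (quatUnit 1) r, D.qu (quatUnit 2) r]

/-- Multiplying by the conjugate quaternion turns the relation into norm times x. -/
theorem quat_smul_eq_zero {x : D.S} (hx : x ≠ 0) (a b c d : ℝ)
    (h : a • x + b • D.qu (quatUnit 0) x + c • D.qu (quatUnit 1) x +
      d • D.qu (quatUnit 2) x = 0) : a = 0 ∧ b = 0 ∧ c = 0 ∧ d = 0 := by
  have h' : (a ^ 2 + b ^ 2 + c ^ 2 + d ^ 2) • x = 0 := by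
    have e0 := congrArg (fun y => a • y - b • D.qu (quatUnit 0) y - c • D.qu (quatUnit 1) y -
      d • D.qu (quatUnit 2) y) h
    simp only [map_add, map_smul, map_zero, qu_unit_sq, qu_unit_zero_one,
      qu_unit_one_zero, qu_unit_zero_two, qu_unit_two_zero, qu_unit_one_two,
      qu_unit_two_one, smul_zero, sub_zero] at e0
    rw [← e0]
    module
  have h2 : a ^ 2 + b ^ 2 + c ^ 2 + d ^ 2 = 0 := (smul_eq_zero.1 h').resolve_right hx
  have ha := sq_nonneg a
  have hb := sq_nonneg b
  have hc := sq_nonneg c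
  have hd := sq_nonneg d
  exact ⟨pow_eq_zero_iff two_ne_zero |>.1 (by linarith),
    pow_eq_zero_iff two_ne_zero |>.1 (by linarith),
    pow_eq_zero_iff two_ne_zero |>.1 (by linarith),
    pow_eq_zero_iff two_ne_zero |>.1 (by linarith)⟩

/-- The multiples of s and those of r lie in opposite eigenspaces of Γ_0, so adding and subtracting
the image of a relation under Γ_0 separates them. -/
theorem linearIndependent_quatFamily {s r : D.S} (hs : s ≠ 0) (hr : r ≠ 0)
    (h0 : D.cl (e.basis 0) s = s) (r0 : D.cl (e.basis 0) r = -r) :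
    LinearIndependent ℝ (D.quatFamily s r) := by
  rw [Fintype.linearIndependent_iff]
  intro g hg
  rw [Fin.sum_univ_eight] at hg
  have hg' := congrArg (D.cl (e.basis 0)) hg
  simp only [quatFamily, map_add, map_smul, map_zero, Matrix.cons_val, cl_qu_apply, h0, r0,
    map_neg] at hg hg'
  have k1 := D.quat_smul_eq_zero hs (g 0) (g 1) (g 2) (g 3) (by
    have := congrArg₂ (· + ·) hg hg'
    simp only [add_zero] at this
    refine smul_right_injective D.S (two_ne_zero' ℝ) ?_
    simp only [smul_zero]
    rw [← this]
    module)
  have k2 := D.quat_smul_eq_zero hr (g 4) (g 5) (g 6) (g 7) (by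
    have := congrArg₂ (· - ·) hg hg'
    simp only [sub_zero] at this
    refine smul_right_injective D.S (two_ne_zero' ℝ) ?_
    simp only [smul_zero]
    rw [← this]
    module)
  intro i
  fin_cases i
  exacts [k1.1, k1.2.1, k1.2.2.1, k1.2.2.2, k2.1, k2.2.1, k2.2.2.1, k2.2.2.2]

theorem ip_qu_unit_self (k : Fin 3) (x : D.S) : D.ip x (D.qu (quatUnit k) x) = 0 := by
  have := D.ip_qu (quatUnit k) x x
  rw [D.ip_symm] at this
  linarith

/-- Γ_0 is self-adjoint, so its eigenspaces are orthogonal. -/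
theorem ip_eq_zero_of_cl {x y : D.S} (hx : D.cl (e.basis 0) x = x)
    (hy : D.cl (e.basis 0) y = -y) : D.ip x y = 0 ∧ D.ip y x = 0 := by
  have := D.ip_cl (e.basis 0) x y
  rw [hx, hy, map_neg] at this
  have h : D.ip x y = 0 := by linarith
  exact ⟨h, by rw [D.ip_symm, h]⟩

theorem ip_quatFamily {s r : D.S} (h0 : D.cl (e.basis 0) s = s) (r0 : D.cl (e.basis 0) r = -r)
    (hrr : D.ip r r = -D.ip s s) (i j : Fin 8) :
    D.ip (D.quatFamily s r i) (D.quatFamily s r j) =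
      if i = j then D.ip s s * spinSign i else 0 := by
  have q0 : ∀ a : sp1, D.cl (e.basis 0) (D.qu a s) = D.qu a s := fun a => by
    rw [cl_qu_apply, h0]
  have q1 : ∀ a : sp1, D.cl (e.basis 0) (D.qu a r) = -D.qu a r := fun a => by
    rw [cl_qu_apply, r0, map_neg]
  have m1 := fun a b => (D.ip_eq_zero_of_cl (q0 a) (q1 b)).1
  have m2 := fun a b => (D.ip_eq_zero_of_cl (q0 a) (q1 b)).2
  have m3 := fun b => (D.ip_eq_zero_of_cl h0 (q1 b)).1
  have m4 := fun a => (D.ip_eq_zero_of_cl (q0 a) r0).1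
  have m5 := fun a => (D.ip_eq_zero_of_cl h0 (q1 a)).2
  have m6 := fun b => (D.ip_eq_zero_of_cl (q0 b) r0).2
  have m7 := (D.ip_eq_zero_of_cl h0 r0).1
  have m8 := (D.ip_eq_zero_of_cl h0 r0).2
  have sk := D.ip_qu_unit_self
  fin_cases i <;> fin_cases j <;>
    simp [quatFamily, spinSign, m1, m2, m3, m4, m5, m6, m7, m8, ip_qu, sk, hrr,
      qu_unit_sq, qu_unit_zero_one,
      qu_unit_one_zero, qu_unit_zero_two, qu_unit_two_zero, qu_unit_one_two,
      qu_unit_two_one]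

theorem op_quatFamily {s r : D.S} (h0 : D.cl (e.basis 0) s = s) (r0 : D.cl (e.basis 0) r = -r)
    (g1 : D.cl (e.basis 1) s = D.qu (quatUnit 0) r) (g2 : D.cl (e.basis 2) s = D.qu (quatUnit 1) r)
    (g3 : D.cl (e.basis 3) s = D.qu (quatUnit 2) r) (g4 : D.cl (e.basis 4) s = r)
    (r1 : D.cl (e.basis 1) r = D.qu (quatUnit 0) s) (r2 : D.cl (e.basis 2) r = D.qu (quatUnit 1) s)
    (r3 : D.cl (e.basis 3) r = D.qu (quatUnit 2) s) (r4 : D.cl (e.basis 4) r = -s)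
    (a j : Fin 8) : D.op a (D.quatFamily s r j) =
      (opSign a j : ℝ) • D.quatFamily s r (j ^^^ opShift a) := by
  -- In an index, the bit of weight 4 distinguishes s from r and the other two bits label 1, q_0,
  -- q_1, q_2. Up to sign the quaternion units multiply by adding labels mod 2, so every generator
  -- acts by a fixed shift. The rows tabulate these shifts.
  have x : ∀ a j : Fin 8, D.quatFamily s r (j ^^^ opShift a) = D.quatFamily s r (
      (![![0, 1, 2, 3, 4, 5, 6, 7], ![5, 4, 7, 6, 1, 0, 3, 2], ![6, 7, 4, 5, 2, 3, 0, 1],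
        ![7, 6, 5, 4, 3, 2, 1, 0], ![4, 5, 6, 7, 0, 1, 2, 3], ![1, 0, 3, 2, 5, 4, 7, 6],
        ![2, 3, 0, 1, 6, 7, 4, 5], ![3, 2, 1, 0, 7, 6, 5, 4]] : Fin 8 → Fin 8 → Fin 8) a j) := by
    intro a j
    congr 1
    revert a j
    decide
  rw [x]
  fin_cases a <;> fin_cases j <;>
    simp [quatFamily, op, opSign, cl_qu_apply, h0, g1, g2, g3, g4, r0, r1, r2, r3,
      r4, qu_unit_sq, qu_unit_zero_one,
      qu_unit_one_zero, qu_unit_zero_two, qu_unit_two_zero, qu_unit_one_two,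
      qu_unit_two_one]

theorem nonempty_spinFrame : Nonempty D.SpinFrame := by
  obtain ⟨s, hs, h0, h12, h23⟩ := D.exists_vacuum
  obtain ⟨g1, g2, g3⟩ := D.cl_vacuum h0 h12 h23
  obtain ⟨r, hr⟩ : ∃ r, r = D.cl (e.basis 4) s := ⟨_, rfl⟩
  rw [← hr] at g1 g2 g3
  have r0 : D.cl (e.basis 0) r = -r := by
    rw [hr, D.cl_basis_swap (by decide), h0]
  have r4 : D.cl (e.basis 4) r = -s := by
    rw [hr, cl_basis_sq]; simp [sgn]
  have hr' : ∀ (μ : Fin 5) (k : Fin 3), μ ≠ 4 → D.cl (e.basis μ) s = D.qu (quatUnit k) r →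
      D.cl (e.basis μ) r = D.qu (quatUnit k) s := by
    intro μ k hμ h
    rw [hr, D.cl_basis_swap hμ, h, cl_qu_apply, r4, map_neg, neg_neg]
  have hr0 : r ≠ 0 := fun h => hs (by rw [← neg_eq_zero, ← r4, h, map_zero])
  have hrr : D.ip r r = -D.ip s s := by
    conv_lhs => rw [hr, ip_cl, ← hr, r4, map_neg]
  have hip := D.ip_quatFamily h0 r0 hrr
  have hop := D.op_quatFamily h0 r0 g1 g2 g3 hr.symm (hr' 1 0 (by decide) g1)
    (hr' 2 1 (by decide) g2) (hr' 3 2 (by decide) g3) r4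
  let b := basisOfLinearIndependentOfCardEqFinrank
    (D.linearIndependent_quatFamily hs hr0 h0 r0) (by rw [D.finrank_S, Fintype.card_fin])
  have hb : ∀ i, b i = D.quatFamily s r i := fun i => by
    simp only [b, coe_basisOfLinearIndependentOfCardEqFinrank]
  refine ⟨⟨b, D.ip s s, ?_, ?_, ?_⟩⟩
  -- If ⟨s, s⟩ vanished, s would be orthogonal to the whole basis, contrary to nondegeneracy. Only c
  -- ≠ 0 is obtained; the sign of c is left open.
  · intro h
    refine hs (D.ip_nondeg s fun t => ?_)
    rw [← b.sum_repr t, map_sum]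
    refine Finset.sum_eq_zero fun j _ => ?_
    have h' : D.ip s (D.quatFamily s r j) = 0 := by
      have := hip 0 j
      rwa [h, zero_mul, ite_self] at this
    rw [map_smul, hb, h', smul_zero]
  · intro a j
    rw [hb, hb, hop]
  · intro i j
    rw [hb, hb, hip]

end SpinorModule

end SpinorBasis

/-! ### Fierz identities, as polynomial identities in coordinates. -/

/-- The operators `op` in coordinates. -/
def opCoord : Fin 8 → (Fin 8 → ℝ) → Fin 8 → ℝ :=
  ![fun x => ![x 0, x 1, x 2, x 3, -x 4, -x 5, -x 6, -x 7],
    fun x => ![-x 5, x 4, x 7, -x 6, -x 1, x 0, x 3, -x 2],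
    fun x => ![-x 6, -x 7, x 4, x 5, -x 2, -x 3, x 0, x 1],
    fun x => ![-x 7, x 6, -x 5, x 4, -x 3, x 2, -x 1, x 0],
    fun x => ![-x 4, -x 5, -x 6, -x 7, x 0, x 1, x 2, x 3],
    fun x => ![-x 1, x 0, -x 3, x 2, -x 5, x 4, -x 7, x 6],
    fun x => ![-x 2, x 3, x 0, -x 1, -x 6, x 7, x 4, -x 5],
    fun x => ![-x 3, -x 2, x 1, x 0, -x 7, -x 6, x 5, x 4]]

/-- The inner product of `S` in coordinates, up to a scale. -/
def ipCoord (x y : Fin 8 → ℝ) : ℝ :=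
  x 0 * y 0 + x 1 * y 1 + x 2 * y 2 + x 3 * y 3 - x 4 * y 4 - x 5 * y 5 - x 6 * y 6 - x 7 * y 7

/-- The Clifford generators in coordinates. -/
def clCoord (μ : Fin 5) : (Fin 8 → ℝ) → Fin 8 → ℝ := opCoord (Fin.castLE (by norm_num) μ)

theorem fierz_coord_self (x : Fin 8 → ℝ) :
    ∑ μ, (sgn μ * ipCoord x (clCoord μ x)) • clCoord μ x = ipCoord x x • x := by
  ext i
  simp only [Fin.sum_univ_five, Pi.add_apply, Pi.smul_apply, smul_eq_mul]
  fin_cases i <;> simp [clCoord, opCoord, ipCoord, sgn] <;> ring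

-- This is the rearrangement needed to evaluate γ(s,s)s when β(v,s) = v·Ps, with z in the role of
-- Ps. The unknown scale of the inner product is absent here and is restored in `fierz`.
set_option maxHeartbeats 1000000 in
theorem fierz_coord (x z : Fin 8 → ℝ) :
    ∑ μ, ∑ ν, (sgn μ * sgn ν * ipCoord x (clCoord ν (clCoord μ z))) • clCoord ν (clCoord μ x) =
    (9 * ipCoord x z) • x - (3 * ipCoord x x) • z -
      ∑ μ, (sgn μ * ipCoord x (clCoord μ x)) • clCoord μ z := by
  ext i
  simp only [Fin.sum_univ_five, Pi.add_apply, Pi.sub_apply, Pi.smul_apply, smul_eq_mul]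
  fin_cases i <;> simp [clCoord, opCoord, ipCoord, sgn] <;> ring

section SpinorBasis

variable {V : Type*} [AddCommGroup V] [Module ℝ V] {η : LinearMap.BilinForm ℝ V}
  {e : LorentzFrame η} {Sg : Type*} [AddCommGroup Sg] [Module ℂ Sg]

namespace SpinorModule

variable {D : SpinorModule e Sg} (B : D.SpinFrame)

namespace SpinFrame

theorem repr_op_apply (a : Fin 8) (s : D.S) (i : Fin 8) : B.b.repr (D.op a s) i =
    opSign a (i ^^^ opShift a) * B.b.repr s (i ^^^ opShift a) := by
  have hx : ∀ i j k : Fin 8, j ^^^ k = i ↔ j = i ^^^ k := by decide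
  conv_lhs => rw [← B.b.sum_repr s]
  simp only [map_sum, map_smul, B.op_b]
  simp [-Module.Basis.sum_repr, Finsupp.single_apply, hx, mul_comm]

theorem repr_op (a : Fin 8) (s : D.S) : ⇑(B.b.repr (D.op a s)) = opCoord a (B.b.repr s) := by
  ext i
  rw [repr_op_apply]
  generalize ⇑(B.b.repr s) = x
  fin_cases a <;> fin_cases i <;> simp [opShift, opSign, opCoord]

theorem ip_eq (s t : D.S) : D.ip s t = B.c * ipCoord (B.b.repr s) (B.b.repr t) := by
  conv_lhs => rw [← B.b.sum_repr s, ← B.b.sum_repr t]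
  simp only [map_sum, map_smul, LinearMap.sum_apply, LinearMap.smul_apply, B.ip_b]
  simp [Fin.sum_univ_eight, spinSign, ipCoord]
  ring

theorem op_castLE (μ : Fin 5) : D.op (Fin.castLE (by norm_num) μ) = D.cl (e.basis μ) := by
  fin_cases μ <;> rfl

theorem repr_cl (μ : Fin 5) (s : D.S) :
    ⇑(B.b.repr (D.cl (e.basis μ) s)) = clCoord μ (B.b.repr s) := by
  rw [← op_castLE, repr_op]; rfl

end SpinFrame

variable (D)

theorem kappa_eq (s t : D.S) :
    D.kappa s t = ∑ μ, (sgn μ * D.ip s (D.cl (e.basis μ) t)) • e.basis μ := rfl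

/-- The Fierz identity `κ_s · s = μ_s s`. -/
theorem cl_kappa_self (s : D.S) : D.cl (D.kappa s s) s = D.ip s s • s := by
  obtain ⟨B⟩ := D.nonempty_spinFrame
  refine B.b.repr.injective (DFunLike.coe_injective ?_)
  simp only [kappa_eq, map_sum, map_smul, LinearMap.sum_apply, LinearMap.smul_apply,
    Finsupp.coe_finsetSum, Finsupp.coe_smul, B.repr_cl, B.ip_eq]
  have := fierz_coord_self (B.b.repr s)
  rw [mul_smul, ← this, Finset.smul_sum]
  refine Finset.sum_congr rfl fun μ _ => ?_
  rw [smul_smul]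
  congr 1
  ring

/-- The Fierz identity for `⟨s, Γ^ν Γ^μ z⟩ Γ_ν Γ_μ s`. -/
theorem fierz (s z : D.S) :
    ∑ μ, ∑ ν, (sgn μ * sgn ν * D.ip s (D.cl (e.basis ν) (D.cl (e.basis μ) z))) •
      D.cl (e.basis ν) (D.cl (e.basis μ) s) =
    (9 * D.ip s z) • s - (3 * D.ip s s) • z - D.cl (D.kappa s s) z := by
  obtain ⟨B⟩ := D.nonempty_spinFrame
  refine B.b.repr.injective (DFunLike.coe_injective ?_)
  simp only [kappa_eq, map_sum, map_smul, map_sub, LinearMap.sum_apply, LinearMap.smul_apply,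
    Finsupp.coe_finsetSum, Finsupp.coe_smul, Finsupp.coe_sub, B.repr_cl, B.ip_eq]
  have := congrArg (fun y => B.c • y) (fierz_coord (B.b.repr s) (B.b.repr z))
  simp only [Finset.smul_sum, smul_sub, smul_smul] at this
  simp only [mul_left_comm _ B.c]
  exact this

end SpinorModule

end SpinorBasis

/-! ### The conditions on β, and the family of solutions. -/

section Cocycles

variable {V : Type*} [AddCommGroup V] [Module ℝ V] {η : LinearMap.BilinForm ℝ V}
  {e : LorentzFrame η} {Sg : Type*} [AddCommGroup Sg] [Module ℂ Sg]
  {M : Type*} [AddCommGroup M] [Module ℝ M]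

namespace SpinorModule

variable (D : SpinorModule e Sg)

/-- The linear extension to all of `End V` of the spin representation on `S`. -/
noncomputable def spinEnd : Module.End ℝ V →ₗ[ℝ] Module.End ℝ D.S where
  toFun A := (1 / 4 : ℝ) • ∑ μ, sgn μ • (D.cl (A (e.basis μ)) * D.cl (e.basis μ))
  map_add' A B := by simp [add_mul, Finset.sum_add_distrib]
  map_smul' c A := by
    simp only [LinearMap.smul_apply, map_smul, smul_mul_assoc, RingHom.id_apply, Finset.smul_sum]
    refine Finset.sum_congr rfl fun μ _ => ?_
    module

theorem spinEnd_apply (A : Module.End ℝ V) (s : D.S) : D.spinEnd A s =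
    (1 / 4 : ℝ) • ∑ μ, sgn μ • D.cl (A (e.basis μ)) (D.cl (e.basis μ) s) := by
  simp [spinEnd]

theorem soS_eq (A : so η) (s : D.S) : soS D A s = D.spinEnd A s := by
  refine S_ext fun a => ?_
  rw [soS_apply, spinor_lie, spin_apply, spinEnd_apply]
  simp [cl_val]

theorem cl_cl_add_apply (v w : V) (s : D.S) :
    D.cl v (D.cl w s) + D.cl w (D.cl v s) = (2 * η v w) • s := by
  have := LinearMap.congr_fun (D.cl_mul_cl v w) s
  simp only [Module.End.mul_apply, LinearMap.sub_apply, LinearMap.smul_apply,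
    Module.End.one_apply] at this
  rw [this, sub_add_cancel]

theorem cl_cl_self (v : V) (s : D.S) : D.cl v (D.cl v s) = η v v • s := by
  have := D.cl_cl_add_apply v v s
  rw [← two_smul ℝ, mul_smul] at this
  exact smul_right_injective _ (two_ne_zero' ℝ) this

/-- Clifford multiplication is self-adjoint, so the left side is symmetric in v and w, and the
Clifford relation fixes the symmetric part. -/
theorem ip_cl_cl_self (v w : V) (s : D.S) : D.ip s (D.cl v (D.cl w s)) = η v w * D.ip s s := by
  have h := congrArg (D.ip s) (D.cl_cl_add_apply v w s)
  have h2 : D.ip s (D.cl w (D.cl v s)) = D.ip s (D.cl v (D.cl w s)) := by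
    rw [← ip_cl, ip_symm, ip_cl]
  rw [map_add, h2, map_smul, smul_eq_mul] at h
  linarith

/-- A self-adjoint and a skew operator that commute have a skew product. -/
theorem ip_cl_qu_self (v : V) (a : sp1) (s : D.S) : D.ip s (D.cl v (D.qu a s)) = 0 := by
  have h : D.ip s (D.cl v (D.qu a s)) = -D.ip s (D.cl v (D.qu a s)) := by
    conv_lhs => rw [cl_qu_apply, ← neg_eq_iff_eq_neg.2 (D.ip_qu a s (D.cl v s)), ip_symm, ip_cl]
  linarith

theorem eta_kappa_cl (s t : D.S) (v : V) : η (D.kappa s t) v = D.ip s (D.cl v t) :=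
  D.eta_kappa s t v

theorem kappa_cl_self (s : D.S) (w : V) : D.kappa s (D.cl w s) = D.ip s s • w :=
  e.nondeg fun u => by
    rw [eta_kappa_cl, ip_cl_cl_self, map_smul, LinearMap.smul_apply, e.symm, smul_eq_mul, mul_comm]

theorem kappa_qu_self (s : D.S) (a : sp1) : D.kappa s (D.qu a s) = 0 :=
  e.nondeg fun u => by
    rw [eta_kappa_cl, ip_cl_qu_self, map_zero, LinearMap.zero_apply]

/-- The component `γ(s,t) : V → V` determined by `β` through the cocycle condition on `V ⊗ ⊙²S`. -/
noncomputable def gammaEnd (β : V →ₗ[ℝ] Module.End ℝ D.S) :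
    D.S →ₗ[ℝ] D.S →ₗ[ℝ] Module.End ℝ V :=
  LinearMap.mk₂ ℝ (fun s t => -(D.kappa s ∘ₗ β.flip t + D.kappa t ∘ₗ β.flip s))
    (by intro s s' t; ext v; simp; abel)
    (by intro c s t; ext v; simp)
    (by intro s t t'; ext v; simp; abel)
    (by intro c s t; ext v; simp)

theorem gammaEnd_apply (β : V →ₗ[ℝ] Module.End ℝ D.S) (s t : D.S) (v : V) :
    D.gammaEnd β s t v = -(D.kappa s (β v t) + D.kappa t (β v s)) := rfl

theorem gammaEnd_self (β : V →ₗ[ℝ] Module.End ℝ D.S) (s : D.S) (v : V) :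
    D.gammaEnd β s s v = (-2 : ℝ) • D.kappa s (β v s) := by
  rw [gammaEnd_apply]; module

theorem gammaEnd_symm (β : V →ₗ[ℝ] Module.End ℝ D.S) (s t : D.S) :
    D.gammaEnd β s t = D.gammaEnd β t s := by
  ext v; rw [gammaEnd_apply, gammaEnd_apply, add_comm]

/-- The left hand side of the cocycle condition on `⊙³S`. -/
noncomputable def cubic (β : V →ₗ[ℝ] Module.End ℝ D.S) (s : D.S) : D.S :=
  β (D.kappa s s) s + D.spinEnd (D.gammaEnd β s s) s

theorem cubic_add (β β' : V →ₗ[ℝ] Module.End ℝ D.S) (s : D.S) :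
    D.cubic (β + β') s = D.cubic β s + D.cubic β' s := by
  have : D.gammaEnd (β + β') s s = D.gammaEnd β s s + D.gammaEnd β' s s := by
    ext v; simp [gammaEnd_self]
  rw [cubic, this, cubic, cubic]
  simp only [map_add, LinearMap.add_apply]
  abel

theorem cubic_smul (c : ℝ) (β : V →ₗ[ℝ] Module.End ℝ D.S) (s : D.S) :
    D.cubic (c • β) s = c • D.cubic β s := by
  have : D.gammaEnd (c • β) s s = c • D.gammaEnd β s s := by
    ext v; simp only [gammaEnd_self, LinearMap.smul_apply, map_smul]; module
  rw [cubic, this, cubic]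
  simp only [map_smul, LinearMap.smul_apply, smul_add]

/-- The maps `β : V ⊗ S → S` which are components of normalised cocycles. -/
def cocycleBeta : Submodule ℝ (V →ₗ[ℝ] Module.End ℝ D.S) where
  -- The first condition is η(γ(s,s)v, v) = 0, the skewness of γ(s,s); the second is the cocycle
  -- condition on the diagonal of `⊙³S`.
  carrier := {β | (∀ v s, D.ip s (D.cl v (β v s)) = 0) ∧ ∀ s, D.cubic β s = 0}
  zero_mem' := ⟨fun v s => by simp, fun s => by simpa using D.cubic_smul 0 0 s⟩
  add_mem' hf hg := ⟨fun v s => by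
      rw [LinearMap.add_apply, LinearMap.add_apply, map_add, map_add, hf.1, hg.1, add_zero],
    fun s => by rw [cubic_add, hf.2, hg.2, add_zero]⟩
  smul_mem' c _ hf := ⟨fun v s => by
      rw [LinearMap.smul_apply, LinearMap.smul_apply, map_smul, map_smul, hf.1, smul_zero],
    fun s => by rw [cubic_smul, hf.2, smul_zero]⟩

/-- `v ↦ v · P`. -/
noncomputable def clMul (P : Module.End ℝ D.S) : V →ₗ[ℝ] Module.End ℝ D.S :=
  LinearMap.mulRight ℝ P ∘ₗ D.cl

/-- `v ↦ P · v`. -/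
noncomputable def mulCl (P : Module.End ℝ D.S) : V →ₗ[ℝ] Module.End ℝ D.S :=
  LinearMap.mulLeft ℝ P ∘ₗ D.cl

theorem clMul_apply (P : Module.End ℝ D.S) (v : V) (s : D.S) :
    D.clMul P v s = D.cl v (P s) := rfl

theorem mulCl_apply (P : Module.End ℝ D.S) (v : V) (s : D.S) :
    D.mulCl P v s = P (D.cl v s) := rfl

theorem cl_kappa (s t u : D.S) : D.cl (D.kappa s t) u =
    ∑ μ, (sgn μ * D.ip s (D.cl (e.basis μ) t)) • D.cl (e.basis μ) u := by
  simp [kappa_eq]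

/-- The factor -2 in γ and the 1/4 of the spin representation give -1/2 times the left side of
`fierz` at z = Ps. The term with coefficient 9 vanishes because ⟨s, Ps⟩ = 0, leaving 3/2 μ_s + 1/2
κ_s, and β(κ_s, s) contributes one more κ_s. -/
theorem cubic_clMul (P : Module.End ℝ D.S) (s : D.S) (h : D.ip s (P s) = 0) :
    D.cubic (D.clMul P) s = (3 / 2 : ℝ) • (D.ip s s • P s + D.cl (D.kappa s s) (P s)) := by
  have hF := D.fierz s (P s)
  have : D.spinEnd (D.gammaEnd (D.clMul P) s s) s = (-1 / 2 : ℝ) •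
      ∑ μ, ∑ ν, (sgn μ * sgn ν * D.ip s (D.cl (e.basis ν) (D.cl (e.basis μ) (P s)))) •
        D.cl (e.basis ν) (D.cl (e.basis μ) s) := by
    rw [spinEnd_apply, Finset.smul_sum, Finset.smul_sum]
    refine Finset.sum_congr rfl fun μ _ => ?_
    rw [gammaEnd_self, map_smul, LinearMap.smul_apply, cl_kappa, clMul_apply, Finset.smul_sum,
      Finset.smul_sum, Finset.smul_sum, Finset.smul_sum]
    refine Finset.sum_congr rfl fun ν _ => ?_
    module
  rw [cubic, this, hF, h, clMul_apply]
  module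

/-- The Clifford action of `V ⊗ V ∋ v ⊗ w ↦ ¼ [v, w]` on `S`. -/
noncomputable def cliffTwo : V ⊗[ℝ] V →ₗ[ℝ] Module.End ℝ D.S :=
  TensorProduct.lift ((1 / 4 : ℝ) • ((LinearMap.mul ℝ (Module.End ℝ D.S)).compl₁₂ D.cl D.cl -
    ((LinearMap.mul ℝ (Module.End ℝ D.S)).compl₁₂ D.cl D.cl).flip))

theorem cliffTwo_tmul (v w : V) : D.cliffTwo (v ⊗ₜ w) =
    (1 / 4 : ℝ) • (D.cl v * D.cl w - D.cl w * D.cl v) := rfl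

/-- The endomorphism of `V` defined by a bivector. -/
noncomputable def bivectorEnd (η : LinearMap.BilinForm ℝ V) : V ⊗[ℝ] V →ₗ[ℝ] Module.End ℝ V :=
  TensorProduct.lift (LinearMap.mk₂ ℝ
    (fun v w => (η w).smulRight v - (η v).smulRight w)
    (by intro v v' w; ext u; simp; module)
    (by intro c v w; ext u; simp; module)
    (by intro v w w'; ext u; simp; module)
    (by intro c v w; ext u; simp; module))

theorem bivectorEnd_tmul (v w u : V) : bivectorEnd η (v ⊗ₜ w) u =
    η w u • v - η v u • w := rfl

theorem eta_bivectorEnd (e : LorentzFrame η) (t : V ⊗[ℝ] V) (u : V) :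
    η u (bivectorEnd η t u) = 0 := by
  induction t with
  | zero => simp
  | tmul v w => simp [bivectorEnd_tmul, e.symm u v, e.symm u w]; ring
  | add s t hs ht => rw [map_add, LinearMap.add_apply, map_add, hs, ht, add_zero]

/-- The commutator of a bivector with a vector is again a vector. -/
theorem cliffTwo_cl (t : V ⊗[ℝ] V) (u : V) (s : D.S) : D.cliffTwo t (D.cl u s) =
    D.cl u (D.cliffTwo t s) + D.cl (bivectorEnd η t u) s := by
  induction t with
  | zero => simp
  | tmul v w =>
    have h : ∀ (v : V) (s : D.S), D.cl v (D.cl u s) = (2 * η v u) • s - D.cl u (D.cl v s) :=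
      fun v s => eq_sub_iff_add_eq.2 (D.cl_cl_add_apply v u s)
    simp only [cliffTwo_tmul, bivectorEnd_tmul, LinearMap.smul_apply, LinearMap.sub_apply,
      Module.End.mul_apply, map_smul, map_sub, h]
    module
  | add s t hs ht =>
    simp only [map_add, LinearMap.add_apply, hs, ht]; abel

theorem spinEnd_bivectorEnd (t : V ⊗[ℝ] V) : D.spinEnd (bivectorEnd η t) = D.cliffTwo t := by
  induction t with
  | zero => simp
  | tmul v w =>
    refine LinearMap.ext fun s => ?_
    have h : ∀ w : V, ∑ μ, (sgn μ * η w (e.basis μ)) • D.cl (e.basis μ) s = D.cl w s := by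
      intro w
      conv_rhs => rw [← e.expand w]
      simp [e.symm w]
    rw [spinEnd_apply, cliffTwo_tmul, LinearMap.smul_apply, LinearMap.sub_apply,
      Module.End.mul_apply, Module.End.mul_apply, ← h w, ← h v, map_sum, map_sum,
      ← Finset.sum_sub_distrib]
    congr 1
    refine Finset.sum_congr rfl fun μ _ => ?_
    simp only [bivectorEnd_tmul, map_sub, map_smul, LinearMap.sub_apply, LinearMap.smul_apply]
    module
  | add s t hs ht => rw [map_add, map_add, map_add, hs, ht]

theorem ip_cliffTwo_self (t : V ⊗[ℝ] V) (s : D.S) : D.ip s (D.cliffTwo t s) = 0 := by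
  induction t with
  | zero => simp
  | tmul v w =>
    simp only [cliffTwo_tmul, LinearMap.smul_apply, LinearMap.sub_apply, Module.End.mul_apply,
      map_smul, map_sub, ip_cl_cl_self, e.symm w v, sub_self, smul_zero]
  | add s t hs ht => rw [map_add, LinearMap.add_apply, map_add, hs, ht, add_zero]

theorem mulCl_cliffTwo (t : V ⊗[ℝ] V) : D.mulCl (D.cliffTwo t) =
    D.clMul (D.cliffTwo t) + D.cl ∘ₗ bivectorEnd η t :=
  LinearMap.ext fun u => LinearMap.ext fun s => D.cliffTwo_cl t u s

/-- Write A for the endomorphism and C for its spin action. Here γ(s,s) = -2μ_s A, which acts as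
-2μ_s C. The other term is (Aκ_s)·s = C κ_s s - κ_s C s, and κ_s s = μ_s s. -/
theorem cubic_cl_comp (t : V ⊗[ℝ] V) (s : D.S) : D.cubic (D.cl ∘ₗ bivectorEnd η t) s =
    -(D.ip s s • D.cliffTwo t s + D.cl (D.kappa s s) (D.cliffTwo t s)) := by
  have h : D.gammaEnd (D.cl ∘ₗ bivectorEnd η t) s s = (-2 * D.ip s s) • bivectorEnd η t := by
    ext v
    rw [gammaEnd_self, LinearMap.comp_apply, kappa_cl_self, LinearMap.smul_apply, smul_smul]
  rw [cubic, h, map_smul, spinEnd_bivectorEnd, LinearMap.comp_apply,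
    eq_sub_iff_add_eq'.2 (D.cliffTwo_cl t (D.kappa s s) s).symm, cl_kappa_self,
    LinearMap.smul_apply, map_smul]
  module

/-- The Clifford action of `V ⊗ ⊙²Δ` on `S`. -/
noncomputable def cliffOne (φ : M →ₗ[ℝ] sp1) : V ⊗[ℝ] M →ₗ[ℝ] Module.End ℝ D.S :=
  TensorProduct.lift ((LinearMap.mul ℝ (Module.End ℝ D.S)).compl₁₂ D.cl (D.qu ∘ₗ φ))

theorem cliffOne_tmul (φ : M →ₗ[ℝ] sp1) (v : V) (f : M) : D.cliffOne φ (v ⊗ₜ f) =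
    D.cl v * D.qu (φ f) := rfl

/-- Contraction of an `sp(1)`-valued vector with a vector. -/
noncomputable def contractOne (η : LinearMap.BilinForm ℝ V) (φ : M →ₗ[ℝ] sp1) :
    V ⊗[ℝ] M →ₗ[ℝ] V →ₗ[ℝ] sp1 :=
  TensorProduct.lift (LinearMap.mk₂ ℝ (fun v f => (η v).smulRight (φ f))
    (by intro v v' w; ext1 u; simp [add_smul])
    (by intro c v w; ext1 u; simp [mul_smul])
    (by intro v w w'; ext1 u; simp)
    (by intro c v w; ext1 u; simp [smul_comm c]))

theorem contractOne_tmul (φ : M →ₗ[ℝ] sp1) (v u : V) (f : M) :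
    contractOne η φ (v ⊗ₜ f) u = η v u • φ f := rfl

/-- Quaternions commute with vectors, so this is the Clifford relation with `sp(1)` coefficients. -/
theorem cliffOne_cl (φ : M →ₗ[ℝ] sp1) (t : V ⊗[ℝ] M) (u : V) (s : D.S) :
    D.cliffOne φ t (D.cl u s) =
      -D.cl u (D.cliffOne φ t s) + (2 : ℝ) • D.qu (contractOne η φ t u) s := by
  induction t with
  | zero => simp
  | tmul v f =>
    have := D.cl_cl_add_apply v u (D.qu (φ f) s)
    simp only [cliffOne_tmul, contractOne_tmul, LinearMap.smul_apply,
      Module.End.mul_apply, map_smul, smul_smul, ← this, ← cl_qu_apply]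
    abel
  | add s t hs ht =>
    simp only [map_add, LinearMap.add_apply, hs, ht]; module

theorem ip_cliffOne_self (φ : M →ₗ[ℝ] sp1) (t : V ⊗[ℝ] M) (s : D.S) :
    D.ip s (D.cliffOne φ t s) = 0 := by
  induction t with
  | zero => simp
  | tmul v w => rw [cliffOne_tmul, Module.End.mul_apply, ip_cl_qu_self]
  | add s t hs ht => rw [map_add, LinearMap.add_apply, map_add, hs, ht, add_zero]

theorem mulCl_cliffOne (φ : M →ₗ[ℝ] sp1) (t : V ⊗[ℝ] M) : D.mulCl (D.cliffOne φ t) =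
    (-1 : ℝ) • D.clMul (D.cliffOne φ t) + (2 : ℝ) • (D.qu ∘ₗ contractOne η φ t) :=
  LinearMap.ext fun u => LinearMap.ext fun s => by
    rw [mulCl_apply, cliffOne_cl]; simp [clMul_apply]

/-- γ vanishes because κ(s, qs) = 0 for q in `sp(1)`. What remains is half the anticommutator of F
with κ_s, and κ_s s = μ_s s. -/
theorem cubic_qu_comp (φ : M →ₗ[ℝ] sp1) (t : V ⊗[ℝ] M) (s : D.S) :
    D.cubic (D.qu ∘ₗ contractOne η φ t) s = (1 / 2 : ℝ) •
      (D.ip s s • D.cliffOne φ t s + D.cl (D.kappa s s) (D.cliffOne φ t s)) := by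
  have h : D.gammaEnd (D.qu ∘ₗ contractOne η φ t) s s = 0 := by
    ext v
    rw [gammaEnd_self, LinearMap.comp_apply, kappa_qu_self, smul_zero, LinearMap.zero_apply]
  have h2 := D.cliffOne_cl φ t (D.kappa s s) s
  rw [cl_kappa_self, map_smul] at h2
  rw [cubic, h, map_zero, h2, LinearMap.comp_apply, LinearMap.zero_apply]
  module

/-- The map `(C, F) ↦ β`. -/
noncomputable def betaMap (φ : M →ₗ[ℝ] sp1) :
    (V ⊗[ℝ] V) × (V ⊗[ℝ] M) →ₗ[ℝ] V →ₗ[ℝ] Module.End ℝ D.S where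
  toFun x := (1 / 4 : ℝ) • D.clMul (D.cliffTwo x.1) - (3 / 4 : ℝ) • D.mulCl (D.cliffTwo x.1) -
    (1 / 8 : ℝ) • D.clMul (D.cliffOne φ x.2) - (3 / 8 : ℝ) • D.mulCl (D.cliffOne φ x.2)
  map_add' x y := by
    refine LinearMap.ext fun v => LinearMap.ext fun s => ?_
    simp only [Prod.fst_add, Prod.snd_add, map_add, LinearMap.add_apply, LinearMap.sub_apply,
      LinearMap.smul_apply, clMul_apply, mulCl_apply]
    module
  map_smul' c x := by
    refine LinearMap.ext fun v => LinearMap.ext fun s => ?_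
    simp only [Prod.smul_fst, Prod.smul_snd, map_smul, LinearMap.sub_apply,
      LinearMap.smul_apply, clMul_apply, mulCl_apply, RingHom.id_apply]
    module

theorem betaMap_apply (φ : M →ₗ[ℝ] sp1) (x : (V ⊗[ℝ] V) × (V ⊗[ℝ] M)) (v : V) (s : D.S) :
    D.betaMap φ x v s = (1 / 4 : ℝ) • D.cl v (D.cliffTwo x.1 s) -
      (3 / 4 : ℝ) • D.cliffTwo x.1 (D.cl v s) - (1 / 8 : ℝ) • D.cl v (D.cliffOne φ x.2 s) -
      (3 / 8 : ℝ) • D.cliffOne φ x.2 (D.cl v s) := rfl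

/-- All vectors are moved to the left, so that β is a combination of the three kinds of building
block whose cubic expressions are known. -/
theorem betaMap_eq (φ : M →ₗ[ℝ] sp1) (x : (V ⊗[ℝ] V) × (V ⊗[ℝ] M)) : D.betaMap φ x =
    (-1 / 2 : ℝ) • D.clMul (D.cliffTwo x.1) + (-3 / 4 : ℝ) • (D.cl ∘ₗ bivectorEnd η x.1) +
    (1 / 4 : ℝ) • D.clMul (D.cliffOne φ x.2) +
    (-3 / 4 : ℝ) • (D.qu ∘ₗ contractOne η φ x.2) := by
  have h : D.betaMap φ x = (1 / 4 : ℝ) • D.clMul (D.cliffTwo x.1) -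
    (3 / 4 : ℝ) • D.mulCl (D.cliffTwo x.1) - (1 / 8 : ℝ) • D.clMul (D.cliffOne φ x.2) -
    (3 / 8 : ℝ) • D.mulCl (D.cliffOne φ x.2) := rfl
  rw [h, mulCl_cliffTwo, mulCl_cliffOne]
  module

theorem betaMap_mem (φ : M →ₗ[ℝ] sp1) (x : (V ⊗[ℝ] V) × (V ⊗[ℝ] M)) :
    D.betaMap φ x ∈ D.cocycleBeta := by
  refine ⟨fun v s => ?_, fun s => ?_⟩
  · rw [betaMap_eq]
    simp only [LinearMap.add_apply, LinearMap.smul_apply, clMul_apply, LinearMap.comp_apply,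
      map_add, map_smul, cl_cl_self, ip_cliffTwo_self, ip_cliffOne_self, ip_cl_qu_self,
      ip_cl_cl_self, eta_bivectorEnd e]
    simp
  · rw [betaMap_eq]
    -- The coefficients cancel: -1/2 · 3/2 + 3/4 = 0 for C, and 1/4 · 3/2 - 3/4 · 1/2 = 0 for F.
    simp only [cubic_add, cubic_smul, cubic_clMul _ _ _ (D.ip_cliffTwo_self x.1 s),
      cubic_clMul _ _ _ (D.ip_cliffOne_self φ x.2 s), cubic_cl_comp, cubic_qu_comp]
    module

end SpinorModule

end Cocycles

/-! ### Skew operators on `S` as combinations of products of two generators. -/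

/-- The sign with which two of the operators `op` commute. -/
def commSign (a b : Fin 8) : ℤ :=
  if a = b then 1 else if (a < 5 ↔ b < 5) then -1 else 1

/-- The signs of the squares of the operators `op`. -/
def sqSign (a : Fin 8) : ℤ := if a = 0 then 1 else -1

/-- The sign with which the diagonal of the matrix `op a * op b` in the standard basis is weighted. -/
def pairSign (a b i : Fin 8) : ℤ :=
  opSign a (i ^^^ opShift a) * opSign b (i ^^^ opShift a ^^^ opShift b)

theorem commSign_spec : ∀ a b j : Fin 8, opSign a (j ^^^ opShift b) * opSign b j =
    commSign a b * (opSign b (j ^^^ opShift a) * opSign a j) := by decide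

theorem xor_comm_shift : ∀ a b j : Fin 8, j ^^^ a ^^^ b = j ^^^ b ^^^ a := by decide

/-- The index set of a basis of the skew operators on `S`. -/
def opPairs : Finset (Fin 8 × Fin 8) := Finset.univ.filter fun p => p.1 < p.2

-- The completeness relation of the 28 products: weighted by the signs of their squares, their
-- matrix entries sum to 4 times the antisymmetriser for the form of signature (4,4). With the 1/8
-- of `opCoef` this is the projection onto the skew operators.
set_option maxRecDepth 100000 in
theorem pairSign_completeness : ∀ i k j : Fin 8,
    (∑ p ∈ opPairs, if k = i ^^^ opShift p.1 ^^^ opShift p.2 then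
      commSign p.1 p.2 * sqSign p.1 * sqSign p.2 * pairSign p.1 p.2 j * pairSign p.1 p.2 i else 0) =
    if i = k then 0 else
      4 * ((if j = k then 1 else 0) - if j = i then spinSign i * spinSign k else 0) := by
  decide +kernel

/-- A product of two generators commutes with Γ_μΓ_ν when it contains both of Γ_μ, Γ_ν or neither.
-/
theorem commSign_pair : ∀ a b : Fin 8, ∀ μ ν : Fin 8, a < b → μ < 5 → ν < 5 → μ ≠ ν →
    ((a = μ ∨ b = μ) ↔ (a = ν ∨ b = ν)) →
    commSign μ a * commSign μ b * (commSign ν a * commSign ν b) = 1 := by decide +kernel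

section SkewOperators

variable {V : Type*} [AddCommGroup V] [Module ℝ V] {η : LinearMap.BilinForm ℝ V}
  {e : LorentzFrame η} {Sg : Type*} [AddCommGroup Sg] [Module ℂ Sg]

namespace SpinorModule

variable (D : SpinorModule e Sg)

theorem op_comm (a b : Fin 8) : D.op a * D.op b = (commSign a b : ℝ) • (D.op b * D.op a) := by
  obtain ⟨B⟩ := D.nonempty_spinFrame
  refine B.b.ext fun j => ?_
  simp only [Module.End.mul_apply, LinearMap.smul_apply, B.op_b, map_smul, smul_smul]
  rw [xor_comm_shift (opShift a)]
  congr 1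
  have := commSign_spec a b j
  rw [mul_comm (opSign b j : ℝ), mul_comm (opSign a j : ℝ)]
  exact_mod_cast this

theorem op_mul_pair (μ a b : Fin 8) : D.op μ * (D.op a * D.op b) =
    ((commSign μ a * commSign μ b : ℤ) : ℝ) • (D.op a * D.op b * D.op μ) := by
  rw [← mul_assoc, op_comm, smul_mul_assoc, mul_assoc, op_comm D μ b, mul_smul_comm, smul_smul,
    mul_assoc]
  push_cast
  rfl

/-- The operators which are skew for the inner product of `S`. -/
def skewOp : Submodule ℝ (Module.End ℝ D.S) where
  carrier := {M | ∀ s t, D.ip (M s) t = -D.ip s (M t)}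
  zero_mem' := by intro s t; simp
  add_mem' hf hg := fun s t => by
    simp only [LinearMap.add_apply, map_add, hf s t, hg s t]; ring
  smul_mem' c _ hf := fun s t => by
    simp only [LinearMap.smul_apply, map_smul, hf s t, smul_eq_mul]; ring

theorem mem_skewOp_of_self {M : Module.End ℝ D.S} (h : ∀ s, D.ip s (M s) = 0) :
    M ∈ D.skewOp := by
  intro s t
  have := h (s + t)
  simp only [map_add, LinearMap.add_apply, h, zero_add, add_zero] at this
  rw [D.ip_symm (M s)]
  linarith

theorem ip_self_of_mem_skewOp {M : Module.End ℝ D.S} (h : M ∈ D.skewOp) (s : D.S) :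
    D.ip s (M s) = 0 := by
  have := h s s
  rw [D.ip_symm] at this
  linarith

/-- The coefficient of `op a * op b` in an operator on `S`. -/
noncomputable def opCoef (a b : Fin 8) : Module.End ℝ D.S →ₗ[ℝ] ℝ :=
  ((commSign a b * sqSign a * sqSign b : ℤ) / 8 : ℝ) •
    (LinearMap.trace ℝ D.S ∘ₗ LinearMap.mulLeft ℝ (D.op a * D.op b))

theorem opCoef_apply (a b : Fin 8) (M : Module.End ℝ D.S) : D.opCoef a b M =
    ((commSign a b * sqSign a * sqSign b : ℤ) / 8 : ℝ) *
      LinearMap.trace ℝ D.S (D.op a * D.op b * M) := rfl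

/-- Each row of a signed permutation matrix has one nonzero entry, so the trace is a signed sum of
single entries. -/
theorem trace_op_mul (B : D.SpinFrame) (a b : Fin 8) (M : Module.End ℝ D.S) :
    LinearMap.trace ℝ D.S (D.op a * D.op b * M) =
    ∑ j, (pairSign a b j : ℝ) * B.b.repr (M (B.b j)) (j ^^^ opShift a ^^^ opShift b) := by
  rw [LinearMap.trace_eq_matrix_trace ℝ B.b, Matrix.trace]
  refine Finset.sum_congr rfl fun j _ => ?_
  rw [Matrix.diag_apply, LinearMap.toMatrix_apply, Module.End.mul_apply, Module.End.mul_apply,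
    B.repr_op_apply, B.repr_op_apply, pairSign]
  push_cast
  ring

theorem repr_skew (B : D.SpinFrame) {M : Module.End ℝ D.S} (hM : M ∈ D.skewOp) (i j : Fin 8) :
    B.b.repr (M (B.b j)) i = -(spinSign i * spinSign j * B.b.repr (M (B.b i)) j) := by
  have key : ∀ (s : D.S) (i : Fin 8), D.ip (B.b i) s = B.c * spinSign i * B.b.repr s i := by
    intro s i
    conv_lhs => rw [← B.b.sum_repr s]
    simp only [map_sum, map_smul, B.ip_b, smul_eq_mul, mul_ite, mul_zero, Finset.sum_ite_eq,
      Finset.mem_univ, if_true]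
    ring
  have h := hM (B.b i) (B.b j)
  rw [D.ip_symm, key, key] at h
  have hs : ∀ i : Fin 8, (spinSign i : ℝ) * spinSign i = 1 := by
    intro i
    have : ∀ i : Fin 8, spinSign i * spinSign i = 1 := by decide
    exact_mod_cast this i
  have h' : (spinSign j : ℝ) * B.b.repr (M (B.b i)) j =
      -(spinSign i * B.b.repr (M (B.b j)) i) := by
    refine mul_left_cancel₀ B.c_ne ?_
    linarith
  rw [mul_assoc, h']
  linear_combination (-(B.b.repr (M (B.b j)) i)) * hs i

/-- The products `op a * op b` with `a < b` span the skew operators. -/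
theorem skewOp_expand {M : Module.End ℝ D.S} (hM : M ∈ D.skewOp) :
    M = ∑ p ∈ opPairs, D.opCoef p.1 p.2 M • (D.op p.1 * D.op p.2) := by
  obtain ⟨B⟩ := D.nonempty_spinFrame
  have hx : ∀ i j k : Fin 8, j ^^^ k = i ↔ j = i ^^^ k := by decide
  refine B.b.ext fun k => B.b.repr.injective (Finsupp.ext fun i => ?_)
  have hT : ∀ a b, B.b.repr ((D.op a * D.op b) (B.b k)) i =
      if k = i ^^^ opShift a ^^^ opShift b then (pairSign a b i : ℝ) else 0 := by
    intro a b
    rw [Module.End.mul_apply, B.repr_op_apply, B.repr_op_apply, B.b.repr_self,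
      Finsupp.single_apply, pairSign]
    split_ifs
    · push_cast; ring
    · simp
  rw [LinearMap.sum_apply, map_sum, Finsupp.finsetSum_apply]
  simp only [LinearMap.smul_apply, map_smul, Finsupp.smul_apply, smul_eq_mul, hT, opCoef_apply,
    D.trace_op_mul B]
  -- Only pairs whose total shift carries i to k contribute. For these the shift is `i ^^^ k`, so
  -- the entry of `M` no longer depends on the pair and the sum over pairs can be done first, on
  -- integers.
  have h1 : ∀ p ∈ opPairs, ((commSign p.1 p.2 * sqSign p.1 * sqSign p.2 : ℤ) / 8 : ℝ) *
      (∑ j, (pairSign p.1 p.2 j : ℝ) *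
        B.b.repr (M (B.b j)) (j ^^^ opShift p.1 ^^^ opShift p.2)) *
      (if k = i ^^^ opShift p.1 ^^^ opShift p.2 then (pairSign p.1 p.2 i : ℝ) else 0) =
      ∑ j, (1 / 8 : ℝ) * B.b.repr (M (B.b j)) (j ^^^ (i ^^^ k)) *
        ((if k = i ^^^ opShift p.1 ^^^ opShift p.2 then
          commSign p.1 p.2 * sqSign p.1 * sqSign p.2 * pairSign p.1 p.2 j * pairSign p.1 p.2 i
          else 0 : ℤ) : ℝ) := by
    intro p _
    rw [mul_assoc, Finset.sum_mul, Finset.mul_sum]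
    refine Finset.sum_congr rfl fun j _ => ?_
    by_cases h : k = i ^^^ opShift p.1 ^^^ opShift p.2
    · have hx' : ∀ i j x y : Fin 8, j ^^^ x ^^^ y = j ^^^ (i ^^^ (i ^^^ x ^^^ y)) := by
        decide +kernel
      rw [if_pos h, if_pos h, hx' i j, ← h]
      push_cast
      ring
    · rw [if_neg h, if_neg h]; simp
  rw [Finset.sum_congr rfl h1, Finset.sum_comm]
  simp only [← Finset.mul_sum, ← Int.cast_sum, pairSign_completeness]
  have x1 : ∀ i k : Fin 8, k ^^^ (i ^^^ k) = i := by decide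
  have x2 : ∀ i k : Fin 8, i ^^^ (i ^^^ k) = k := by decide
  by_cases hik : i = k
  · subst hik
    have := D.repr_skew B hM i i
    have hs : (spinSign i : ℝ) * spinSign i = 1 := by
      have : ∀ i : Fin 8, spinSign i * spinSign i = 1 := by decide
      exact_mod_cast this i
    rw [hs] at this
    simp only [if_true, Int.cast_zero, mul_zero, Finset.sum_const_zero]
    linarith
  · simp only [if_neg hik]
    push_cast
    simp only [mul_sub, mul_ite, mul_zero, mul_one, Finset.sum_sub_distrib, Finset.sum_ite_eq',
      Finset.mem_univ, if_true, x1, x2]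
    have := D.repr_skew B hM i k
    linarith

/-- The coefficients of an operator which anticommutes with an operator commuting with
`op a * op b`. -/
theorem opCoef_eq_zero {a b : Fin 8} {g M : Module.End ℝ D.S} {c : ℝ} (hc : c ≠ 0)
    (hg : g * g = c • 1) (hT : g * (D.op a * D.op b) = D.op a * D.op b * g)
    (hM : g * M = -(M * g)) : D.opCoef a b M = 0 := by
  have h : LinearMap.trace ℝ D.S (D.op a * D.op b * M) = 0 := by
    set T := D.op a * D.op b
    have h1 : c • (T * M) = T * M * g * g := by
      rw [mul_assoc (T * M), hg, mul_smul_comm, mul_one]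
    -- Cycling one g to the front and moving it past T and M costs exactly one sign.
    have h2 : LinearMap.trace ℝ D.S (T * M * g * g) =
        -LinearMap.trace ℝ D.S (T * M * g * g) := by
      conv_lhs => rw [LinearMap.trace_mul_comm, ← mul_assoc, ← mul_assoc, hT, mul_assoc T, hM,
        mul_neg, neg_mul, map_neg, ← mul_assoc]
    have h3 : LinearMap.trace ℝ D.S (c • (T * M)) = 0 := by
      rw [h1]; linarith
    rw [map_smul] at h3
    exact (smul_eq_zero.1 h3).resolve_left hc
  rw [opCoef_apply, h, mul_zero]

end SpinorModule

end SkewOperators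

/-! ### Solving the cocycle condition on `V ⊗ ⊙²S`. -/

section Uniqueness

variable {V : Type*} [AddCommGroup V] [Module ℝ V] {η : LinearMap.BilinForm ℝ V}
  {e : LorentzFrame η} {Sg : Type*} [AddCommGroup Sg] [Module ℂ Sg]
  {M : Type*} [AddCommGroup M] [Module ℝ M]

namespace SpinorModule

variable (D : SpinorModule e Sg)

/-- The operator of Clifford multiplication by a basis vector, as one of the `op`. -/
theorem op_cl (μ : Fin 5) : D.op (Fin.castLE (by norm_num) μ) = D.cl (e.basis μ) := by
  fin_cases μ <;> rfl

theorem op_qu (k : Fin 3) : D.op (Fin.natAdd 5 k) = D.qu (quatUnit k) := by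
  fin_cases k <;> rfl

theorem ip_op (a : Fin 8) (s t : D.S) :
    D.ip (D.op a s) t = (if a < 5 then (1 : ℝ) else -1) * D.ip s (D.op a t) := by
  fin_cases a <;> simp [op, ip_cl, ip_qu]

/-- Clifford generators are self-adjoint and quaternion units skew. Two of the same kind anticommute
and two of different kinds commute, so the product is skew in every case. -/
theorem op_mul_op_mem {a b : Fin 8} (h : a < b) : D.op a * D.op b ∈ D.skewOp := by
  have hab : ∀ a b : Fin 8, a < b → (if a < 5 then (1 : ℤ) else -1) * (if b < 5 then 1 else -1) *
      commSign b a = -1 := by decide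
  intro s t
  have h1 := LinearMap.congr_fun (D.op_comm b a) t
  simp only [Module.End.mul_apply, LinearMap.smul_apply] at h1
  rw [Module.End.mul_apply, Module.End.mul_apply, ip_op, ip_op, h1, map_smul, smul_eq_mul]
  have := hab a b h
  have h2 : (((if a < 5 then (1 : ℤ) else -1) * (if b < 5 then 1 else -1) *
      commSign b a : ℤ) : ℝ) = -1 := by rw [this]; norm_num
  push_cast at h2
  linear_combination (D.ip s (D.op a (D.op b t))) * h2

/-- The operators by which bivectors and `sp(1)`-valued vectors act. -/
theorem mem_range_cliff {φ : M →ₗ[ℝ] sp1} (hφ : Function.Surjective φ) {a b : Fin 8}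
    (hab : a < b) (ha : a < 5) : ∃ x : (V ⊗[ℝ] V) × (V ⊗[ℝ] M),
      D.cliffTwo x.1 + D.cliffOne φ x.2 = D.op a * D.op b := by
  obtain ⟨μ, rfl⟩ : ∃ μ : Fin 5, a = Fin.castLE (by norm_num) μ := ⟨⟨a, ha⟩, rfl⟩
  by_cases hb : b < 5
  · obtain ⟨ν, rfl⟩ : ∃ ν : Fin 5, b = Fin.castLE (by norm_num) ν := ⟨⟨b, hb⟩, rfl⟩
    have hne : ν ≠ μ := fun h => by subst h; exact lt_irrefl _ hab
    refine ⟨((2 : ℝ) • e.basis μ ⊗ₜ e.basis ν, 0), LinearMap.ext fun s => ?_⟩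
    simp only [op_cl, map_smul, cliffTwo_tmul, map_zero, add_zero, LinearMap.smul_apply,
      LinearMap.sub_apply, Module.End.mul_apply, D.cl_basis_swap hne]
    module
  · obtain ⟨k, rfl⟩ : ∃ k : Fin 3, b = Fin.natAdd 5 k :=
      ⟨⟨b - 5, by omega⟩, Fin.ext (by simp; omega)⟩
    obtain ⟨f, hf⟩ := hφ (quatUnit k)
    refine ⟨(0, e.basis μ ⊗ₜ f), ?_⟩
    rw [map_zero, zero_add, cliffOne_tmul, hf, op_cl, op_qu]

theorem ip_polarise {β : V →ₗ[ℝ] Module.End ℝ D.S} (h : ∀ v s, D.ip s (D.cl v (β v s)) = 0)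
    (v : V) : D.cl v * β v ∈ D.skewOp := D.mem_skewOp_of_self fun s => h v s

theorem skew_polarise {β : V →ₗ[ℝ] Module.End ℝ D.S} (h : ∀ v s, D.ip s (D.cl v (β v s)) = 0)
    (v w : V) : D.cl v * β w + D.cl w * β v ∈ D.skewOp := by
  have h1 := D.ip_polarise h (v + w)
  have h2 := D.skewOp.sub_mem (D.skewOp.sub_mem h1 (D.ip_polarise h v)) (D.ip_polarise h w)
  convert h2 using 1
  simp only [map_add, add_mul, mul_add]
  abel

/-- Solution of the cocycle condition on `V ⊗ ⊙²S`. -/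
theorem exists_of_skew {φ : M →ₗ[ℝ] sp1} (hφ : Function.Surjective φ)
    {β : V →ₗ[ℝ] Module.End ℝ D.S} (h : ∀ v s, D.ip s (D.cl v (β v s)) = 0) :
    ∃ P ∈ D.skewOp, ∃ x : (V ⊗[ℝ] V) × (V ⊗[ℝ] M),
      β = D.clMul P + D.mulCl (D.cliffTwo x.1 + D.cliffOne φ x.2) := by
  let i8 : Fin 5 → Fin 8 := Fin.castLE (by norm_num)
  -- Defined so that β(e_μ) = Γ_μ X_μ; the condition at v = e_μ says that X_μ is skew.
  let X : Fin 5 → Module.End ℝ D.S := fun μ => sgn μ • (D.cl (e.basis μ) * β (e.basis μ))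
  have hX : ∀ μ, X μ ∈ D.skewOp := fun μ => D.skewOp.smul_mem _ (D.ip_polarise h _)
  have hsq : ∀ μ, D.cl (e.basis μ) * D.cl (e.basis μ) = sgn μ • 1 := fun μ =>
    LinearMap.ext fun s => D.cl_basis_sq μ s
  have hβ : ∀ μ, β (e.basis μ) = D.cl (e.basis μ) * X μ := fun μ => by
    rw [mul_smul_comm, ← mul_assoc, hsq, smul_mul_assoc, one_mul, smul_smul, sgn_mul_sgn, one_smul]
  have hsw : ∀ μ ν, μ ≠ ν → D.cl (e.basis μ) * D.cl (e.basis ν) =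
      -(D.cl (e.basis ν) * D.cl (e.basis μ)) := fun μ ν hμν =>
    LinearMap.ext fun s => D.cl_basis_swap hμν s
  -- The polarised condition makes Γ_μΓ_ν(X_ν - X_μ) skew. Both factors are skew as well, so they
  -- anticommute.
  have hanti : ∀ μ ν, μ ≠ ν → (D.cl (e.basis μ) * D.cl (e.basis ν)) * (X ν - X μ) =
      -((X ν - X μ) * (D.cl (e.basis μ) * D.cl (e.basis ν))) := by
    intro μ ν hμν
    have h1 : D.cl (e.basis μ) * D.cl (e.basis ν) * (X ν - X μ) ∈ D.skewOp := by
      have := D.skew_polarise h (e.basis μ) (e.basis ν)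
      rw [hβ, hβ, ← mul_assoc, ← mul_assoc, hsw ν μ hμν.symm, neg_mul, ← sub_eq_add_neg,
        ← mul_sub] at this
      exact this
    have h2 := D.skewOp.sub_mem (hX ν) (hX μ)
    refine LinearMap.ext fun s => ?_
    refine sub_eq_zero.1 (D.ip_nondeg _ fun t => ?_)
    rw [map_sub, LinearMap.sub_apply, h1, LinearMap.neg_apply, map_neg, LinearMap.neg_apply,
      Module.End.mul_apply (X ν - X μ), h2]
    simp only [Module.End.mul_apply, ip_cl]
    have h3 := LinearMap.congr_fun (hsw μ ν hμν) ((X ν - X μ) t)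
    simp only [Module.End.mul_apply, LinearMap.neg_apply] at h3
    rw [h3, map_neg]
    ring
  -- A product that commutes with Γ_μΓ_ν has coefficient zero in X_ν - X_μ. So its coefficient in
  -- X_μ depends only on whether Γ_μ is one of its factors.
  have hcoef : ∀ (a b : Fin 8) (μ ν : Fin 5), a < b →
      ((a = i8 μ ∨ b = i8 μ) ↔ (a = i8 ν ∨ b = i8 ν)) →
      D.opCoef a b (X μ) = D.opCoef a b (X ν) := by
    intro a b μ ν hab hiff
    by_cases hμν : μ = ν
    · rw [hμν]
    have h8 : i8 μ ≠ i8 ν := fun h => hμν (Fin.castLE_injective _ h)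
    have hc := commSign_pair a b (i8 μ) (i8 ν) hab (by simp [i8, Fin.lt_def])
      (by simp [i8, Fin.lt_def]) h8 hiff
    have := D.opCoef_eq_zero (a := a) (b := b) (g := D.cl (e.basis μ) * D.cl (e.basis ν))
      (M := X ν - X μ) (c := -(sgn μ * sgn ν)) ?_ ?_ ?_ (hanti μ ν hμν)
    · rw [map_sub] at this; linarith
    · intro h0
      have : sgn μ * sgn ν * (sgn μ * sgn ν) = 1 := by
        rw [mul_mul_mul_comm, sgn_mul_sgn, sgn_mul_sgn, one_mul]
      rw [neg_eq_zero.1 h0] at this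
      simp at this
    · rw [hsw μ ν hμν]
      rw [neg_mul_neg, ← mul_assoc, mul_assoc (D.cl (e.basis ν)), hsw μ ν hμν, mul_neg,
        ← mul_assoc, hsq, neg_mul, smul_mul_assoc, one_mul, smul_mul_assoc, hsq, smul_smul,
        neg_smul, mul_comm (sgn ν)]
    · have e1 := D.op_mul_pair (i8 μ) a b
      have e2 := D.op_mul_pair (i8 ν) a b
      rw [D.op_cl] at e1 e2
      rw [mul_assoc, e2, mul_smul_comm, ← mul_assoc, e1, smul_mul_assoc, smul_smul, mul_assoc]
      rw [← Int.cast_mul, mul_comm, hc, Int.cast_one, one_smul]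
  have hout : ∀ a b : Fin 8, ∃ μ : Fin 5, ¬(a = i8 μ ∨ b = i8 μ) := by decide
  choose mo hmo using hout
  let xo : Fin 8 → Fin 8 → ℝ := fun a b => D.opCoef a b (X (mo a b))
  -- `xi` is the coefficient when Γ_μ is a factor, `xo` when it is not. A product of two quaternion
  -- units has no Clifford factor; the default `xo` then makes its coefficient in `R` zero.
  let xi : Fin 8 → Fin 8 → ℝ := fun a b => if ha : a < 5 then D.opCoef a b (X ⟨a, ha⟩) else xo a b
  have hxo : ∀ a b μ, a < b → ¬(a = i8 μ ∨ b = i8 μ) → D.opCoef a b (X μ) = xo a b :=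
    fun a b μ hab hn => hcoef a b μ (mo a b) hab (iff_of_false hn (hmo a b))
  have hxi : ∀ a b μ, a < b → (a = i8 μ ∨ b = i8 μ) → D.opCoef a b (X μ) = xi a b := by
    intro a b μ hab hy
    have ha : a < 5 := by
      rcases hy with hy | hy
      · rw [hy]; simp [i8, Fin.lt_def]
      · rw [hy] at hab
        have := μ.2
        simp only [i8, Fin.lt_def, Fin.val_castLE] at hab ⊢
        exact lt_trans hab this
    simp only [xi, dif_pos ha]
    exact hcoef a b μ ⟨a, ha⟩ hab (iff_of_true hy (Or.inl rfl))
  -- The sign with which Γ_μ commutes past the product when it is a factor; when it is not, the sign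
  -- is opposite.
  let σ : Fin 8 → Fin 8 → ℤ := fun a b => if b < 5 then -1 else 1
  have hσ : ∀ (a b : Fin 8) (μ : Fin 5), a < b → a < 5 → commSign (i8 μ) a * commSign (i8 μ) b =
      if (a = i8 μ ∨ b = i8 μ) then σ a b else -σ a b := by
    decide
  -- The half-sum multiplies from the right of Γ_μ. The half-difference multiplies from the left,
  -- where the commutation sign distinguishes the two cases, so the two together reproduce `xi` or
  -- `xo` as required.
  let P := ∑ p ∈ opPairs, ((xi p.1 p.2 + xo p.1 p.2) / 2) • (D.op p.1 * D.op p.2)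
  let R := ∑ p ∈ opPairs,
    ((xi p.1 p.2 - xo p.1 p.2) / 2 * σ p.1 p.2) • (D.op p.1 * D.op p.2)
  have hβ' : β = D.clMul P + D.mulCl R := by
    refine e.basis.ext fun μ => ?_
    rw [hβ, D.skewOp_expand (hX μ)]
    change _ = D.cl (e.basis μ) * P + R * D.cl (e.basis μ)
    simp only [P, R, Finset.mul_sum, Finset.sum_mul, ← Finset.sum_add_distrib]
    refine Finset.sum_congr rfl fun p hp => ?_
    obtain ⟨a, b⟩ := p
    have hab : a < b := (Finset.mem_filter.1 hp).2
    simp only [mul_smul_comm, smul_mul_assoc]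
    have e1 := D.op_mul_pair (i8 μ) a b
    rw [D.op_cl] at e1
    rw [e1, smul_smul, smul_smul, ← add_smul]
    congr 1
    by_cases ha : a < 5
    · rw [hσ a b μ hab ha]
      have h1 : (σ a b : ℝ) * σ a b = 1 := by
        simp only [σ]; split_ifs <;> norm_num
      by_cases hy : (a = i8 μ ∨ b = i8 μ)
      · rw [if_pos hy, hxi a b μ hab hy]
        ring
      · rw [if_neg hy, hxo a b μ hab hy]
        push_cast
        ring
    · have hn : ¬(a = i8 μ ∨ b = i8 μ) := by
        have := μ.2
        simp only [Fin.lt_def, Fin.ext_iff, i8, Fin.val_castLE] at ha hab ⊢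
        have h5 : ((5 : Fin 8) : ℕ) = 5 := rfl
        omega
      rw [hxo a b μ hab hn]
      simp only [xi, dif_neg ha]
      ring
  refine ⟨P, D.skewOp.sum_mem fun p hp => D.skewOp.smul_mem _
    (D.op_mul_op_mem (Finset.mem_filter.1 hp).2), ?_⟩
  let Q : (V ⊗[ℝ] V) × (V ⊗[ℝ] M) →ₗ[ℝ] Module.End ℝ D.S :=
    D.cliffTwo.coprod (D.cliffOne φ)
  have hR : R ∈ LinearMap.range Q := by
    refine Submodule.sum_mem _ fun p hp => ?_
    by_cases ha : p.1 < 5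
    · exact Submodule.smul_mem _ _ (D.mem_range_cliff hφ (Finset.mem_filter.1 hp).2 ha)
    · simp only [xi, dif_neg ha, sub_self, zero_div, zero_mul, zero_smul]
      exact Submodule.zero_mem _
  obtain ⟨x, hx⟩ := hR
  exact ⟨x, by rw [hβ', ← hx]; rfl⟩

end SpinorModule

end Uniqueness

/-! ### Solving the cocycle condition on `⊙³S`. -/

/-- The generator relating the two halves of the standard basis by a given shift. -/
def mixIndex : Fin 8 → Fin 8 := ![0, 0, 0, 0, 4, 1, 2, 3]

/-- The sign relating the matrix entries `(j, i)` and `(k, i + j + k)`. -/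
def mixSign (j k i : Fin 8) : ℤ :=
  -1 * (opSign (mixIndex (j ^^^ k)) k * opSign (mixIndex (j ^^^ k)) (i ^^^ j ^^^ k))

/-- A closed chain of three sign relations with total sign -1, which forces the entry at its start
to vanish. -/
theorem mixSign_spec : ∀ j i : Fin 8, j < 4 → ¬ i < 4 → ¬ i ^^^ 1 < 4 ∧ ¬ i ^^^ 2 < 4 ∧
    mixSign j (i ^^^ 1) i * mixSign (i ^^^ j ^^^ (i ^^^ 1)) (i ^^^ 2) (i ^^^ 1) *
      mixSign (i ^^^ j ^^^ (i ^^^ 2)) i (i ^^^ 2) = -1 := by decide +kernel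

/-- Half of `(μ_x + κ_x) w` in coordinates, in terms of the squared norms of the two halves of `x`
and of the spatial components of its current. -/
def currentVec (p n a b c d : ℝ) (w : Fin 8 → ℝ) : Fin 8 → ℝ :=
  ![p * w 0 + a * w 5 + b * w 6 + c * w 7 + d * w 4,
    p * w 1 - a * w 4 + b * w 7 - c * w 6 + d * w 5,
    p * w 2 - a * w 7 - b * w 4 + c * w 5 + d * w 6,
    p * w 3 + a * w 6 - b * w 5 - c * w 4 + d * w 7,
    -n * w 4 + a * w 1 + b * w 2 + c * w 3 - d * w 0,
    -n * w 5 - a * w 0 + b * w 3 - c * w 2 - d * w 1,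
    -n * w 6 - a * w 3 - b * w 0 + c * w 1 - d * w 2,
    -n * w 7 + a * w 2 - b * w 1 - c * w 0 - d * w 3]

theorem two_smul_currentVec (x w : Fin 8 → ℝ) : (2 : ℝ) • currentVec
      (x 0 * x 0 + x 1 * x 1 + x 2 * x 2 + x 3 * x 3)
      (x 4 * x 4 + x 5 * x 5 + x 6 * x 6 + x 7 * x 7)
      (-x 0 * x 5 + x 1 * x 4 + x 2 * x 7 - x 3 * x 6)
      (-x 0 * x 6 - x 1 * x 7 + x 2 * x 4 + x 3 * x 5)
      (-x 0 * x 7 + x 1 * x 6 - x 2 * x 5 + x 3 * x 4)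
      (-x 0 * x 4 - x 1 * x 5 - x 2 * x 6 - x 3 * x 7) w =
    ipCoord x x • w + ∑ μ, (sgn μ * ipCoord x (clCoord μ x)) • clCoord μ w := by
  ext i
  simp only [Fin.sum_univ_five, Pi.add_apply, Pi.smul_apply, smul_eq_mul]
  fin_cases i <;> simp [clCoord, opCoord, ipCoord, sgn, currentVec] <;> ring

set_option maxHeartbeats 2000000 in
/-- A skew matrix `P` with `(μ_s + κ_s) P s = 0` for all `s` vanishes. -/
theorem eq_zero_of_coord (y : Fin 8 → Fin 8 → ℝ)
    (hy : ∀ i j, y j i = -(spinSign i * spinSign j * y i j))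
    (h : ∀ x : Fin 8 → ℝ, ipCoord x x • (∑ j, x j • y j) +
      ∑ μ, (sgn μ * ipCoord x (clCoord μ x)) • clCoord μ (∑ j, x j • y j) = 0) : y = 0 := by
  have h' : ∀ x : Fin 8 → ℝ, currentVec
      (x 0 * x 0 + x 1 * x 1 + x 2 * x 2 + x 3 * x 3)
      (x 4 * x 4 + x 5 * x 5 + x 6 * x 6 + x 7 * x 7)
      (-x 0 * x 5 + x 1 * x 4 + x 2 * x 7 - x 3 * x 6)
      (-x 0 * x 6 - x 1 * x 7 + x 2 * x 4 + x 3 * x 5)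
      (-x 0 * x 7 + x 1 * x 6 - x 2 * x 5 + x 3 * x 4)
      (-x 0 * x 4 - x 1 * x 5 - x 2 * x 6 - x 3 * x 7) (∑ j, x j • y j) = 0 := fun x => by
    refine smul_right_injective _ (two_ne_zero' ℝ) ?_
    simp only [smul_zero]
    rw [two_smul_currentVec, h]
  -- At a basis vector the operator is, up to sign, the projection onto the half containing that
  -- vector, so both diagonal blocks vanish.
  have hb : ∀ j i : Fin 8, (j < 4 ↔ i < 4) → y j i = 0 := by
    intro j i hij
    have e0 := congrFun (h' (Pi.single j 1)) i
    simp only [Pi.single_apply, ite_smul, one_smul, zero_smul, Finset.sum_ite_eq',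
      Finset.mem_univ, if_true] at e0
    fin_cases j <;> fin_cases i <;>
      first
      | (exfalso; revert hij; decide)
      | (simp [currentVec] at e0; exact e0)
  -- The two halves have opposite norms, so skewness means symmetry between them.
  have hs : ∀ j i : Fin 8, j < 4 → ¬ i < 4 → y i j = y j i := by
    intro j i hj hi
    have : ∀ j i : Fin 8, j < 4 → ¬ i < 4 → spinSign j * spinSign i = -1 := by decide
    have h2 : (spinSign j : ℝ) * spinSign i = -1 := by exact_mod_cast this j i hj hi
    rw [hy j i, h2]; ring
  have hlt : ∀ j k i : Fin 8, j < 4 → ¬ k < 4 → ¬ i < 4 → i ^^^ j ^^^ k < 4 := by decide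
  have hm : ∀ j k i : Fin 8, j < 4 → ¬ k < 4 → ¬ i < 4 →
      y j i = mixSign j k i * y k (i ^^^ j ^^^ k) := by
    intro j k i hj hk hi
    -- A combination of one vector from each half has exactly one nonzero spatial current component,
    -- which links two off-diagonal entries. The value 2 is immaterial: both surviving terms are
    -- quadratic in it.
    have e0 := congrFun (h' (Pi.single j 1 + Pi.single k 2)) i
    have z1 := hb k i (by tauto)
    have z2 := hb j (i ^^^ j ^^^ k) (iff_of_true hj (hlt j k i hj hk hi))
    simp only [Pi.add_apply, Pi.single_apply, ite_smul, one_smul, zero_smul, Finset.sum_ite_eq', Finset.mem_univ,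
      if_true, add_smul, Finset.sum_add_distrib] at e0
    fin_cases j <;> first | (exfalso; revert hj; decide) | skip
    all_goals fin_cases k <;> first | (exfalso; revert hk; decide) | skip
    all_goals fin_cases i <;> first | (exfalso; revert hi; decide) | skip
    all_goals
      simp [currentVec] at e0
      simp at z1 z2
      simp [mixSign, mixIndex, opSign]
      linarith
  have x1 : ∀ i j k l : Fin 8, k ^^^ (i ^^^ j ^^^ k) ^^^ l = i ^^^ j ^^^ l := by
    have : ∀ m k : Fin 8, k ^^^ (m ^^^ k) = m := by decide
    intro i j k l
    rw [this]
  have x2 : ∀ i j l : Fin 8, l ^^^ (i ^^^ j ^^^ l) ^^^ i = j := by decide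
  have main : ∀ j i : Fin 8, j < 4 → ¬ i < 4 → y j i = 0 := by
    intro j i hj hi
    -- The relation `hm`, alternated with the symmetry `hs`, is followed through k = `i ^^^ 1` and l
    -- = `i ^^^ 2` back to the entry (j, i), which comes out as its own negative.
    obtain ⟨hk, hl, hkl⟩ := mixSign_spec j i hj hi
    generalize i ^^^ 1 = k at hk hkl
    generalize i ^^^ 2 = l at hl hkl
    have s1 := hlt j k i hj hk hi
    have s2 := hlt j l i hj hl hi
    have e1 := hm j k i hj hk hi
    have e2 := hm _ l k s1 hl hk
    have e3 := hm _ i l s2 hi hl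
    rw [hs _ k s1 hk] at e1
    rw [x1, hs _ l s2 hl] at e2
    rw [x2, hs j i hj hi] at e3
    have h1 : (mixSign j k i * mixSign (i ^^^ j ^^^ k) l k * mixSign (i ^^^ j ^^^ l) i l : ℝ) =
      -1 := by exact_mod_cast hkl
    rw [e2, e3] at e1
    have : y j i = -1 * y j i := by
      rw [← h1]; linarith
    linarith
  funext j i
  by_cases hj : j < 4
  · by_cases hi : i < 4
    · exact hb j i (iff_of_true hj hi)
    · exact main j i hj hi
  · by_cases hi : i < 4
    · rw [hs i j hi hj]; exact main i j hi hj
    · exact hb j i (iff_of_false hj hi)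

section Uniqueness

variable {V : Type*} [AddCommGroup V] [Module ℝ V] {η : LinearMap.BilinForm ℝ V}
  {e : LorentzFrame η} {Sg : Type*} [AddCommGroup Sg] [Module ℂ Sg]
  {M : Type*} [AddCommGroup M] [Module ℝ M]

namespace SpinorModule

variable (D : SpinorModule e Sg)

/-- By `cubic_clMul` the cubic condition is (μ_s + κ_s)Ps = 0 for all s. The columns of P in a
standard basis then satisfy `eq_zero_of_coord`. -/
theorem eq_zero_of_clMul_mem {P : Module.End ℝ D.S} (hP : P ∈ D.skewOp)
    (h : D.clMul P ∈ D.cocycleBeta) : P = 0 := by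
  obtain ⟨B⟩ := D.nonempty_spinFrame
  have h0 := eq_zero_of_coord (fun j => ⇑(B.b.repr (P (B.b j)))) (D.repr_skew B hP) ?_
  · refine B.b.ext fun j => B.b.repr.injective (DFunLike.coe_injective ?_)
    rw [congrFun h0 j]; simp
  · intro x
    set s := B.b.equivFun.symm x with hs
    have hsx : ⇑(B.b.repr s) = x := B.b.equivFun.apply_symm_apply x
    have hPs : ⇑(B.b.repr (P s)) = ∑ j, x j • ⇑(B.b.repr (P (B.b j))) := by
      rw [hs, B.b.equivFun_symm_apply, map_sum, map_sum, Finsupp.coe_finsetSum]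
      simp only [map_smul, Finsupp.coe_smul]
    have e0 := h.2 s
    rw [D.cubic_clMul P s (D.ip_self_of_mem_skewOp hP s)] at e0
    have e1 : D.ip s s • P s + D.cl (D.kappa s s) (P s) = 0 :=
      (smul_eq_zero.1 e0).resolve_left (by norm_num)
    have e2 := congrArg (fun z => ⇑(B.b.repr z)) e1
    simp only [cl_kappa, map_add, map_sum, map_smul, map_zero, Finsupp.coe_add, Finsupp.coe_smul,
      Finsupp.coe_finsetSum, Finsupp.coe_zero, B.repr_cl, B.ip_eq, hsx, hPs] at e2
    refine smul_right_injective _ B.c_ne ?_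
    simp only [smul_zero, smul_add, Finset.smul_sum, smul_smul]
    rw [← e2]
    simp only [mul_left_comm _ B.c, Finset.smul_sum, smul_smul, mul_assoc]

/-- The components `β` of normalised cocycles. -/
theorem exists_betaMap {φ : M →ₗ[ℝ] sp1} (hφ : Function.Surjective φ)
    {β : V →ₗ[ℝ] Module.End ℝ D.S} (h : β ∈ D.cocycleBeta) : ∃ x, D.betaMap φ x = β := by
  obtain ⟨P, hP, x, hx⟩ := D.exists_of_skew hφ h.1
  -- These factors match the terms in which C and F act after v, with coefficients -3/4 and -3/8 in
  -- `betaMap`. The difference from β is then purely of the form v·P'.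
  refine ⟨((-4 / 3 : ℝ) • x.1, (-8 / 3 : ℝ) • x.2), ?_⟩
  set x' : (V ⊗[ℝ] V) × (V ⊗[ℝ] M) := ((-4 / 3 : ℝ) • x.1, (-8 / 3 : ℝ) • x.2)
  have hC : D.cliffTwo x.1 ∈ D.skewOp := D.mem_skewOp_of_self (D.ip_cliffTwo_self x.1)
  have hF : D.cliffOne φ x.2 ∈ D.skewOp := D.mem_skewOp_of_self (D.ip_cliffOne_self φ x.2)
  set P' := P + (1 / 3 : ℝ) • D.cliffTwo x.1 - (1 / 3 : ℝ) • D.cliffOne φ x.2 with hP'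
  have key : β - D.betaMap φ x' = D.clMul P' := by
    refine LinearMap.ext fun v => LinearMap.ext fun s => ?_
    rw [hx, LinearMap.sub_apply, LinearMap.sub_apply, betaMap_apply]
    simp only [x', hP', LinearMap.add_apply, LinearMap.sub_apply, LinearMap.smul_apply,
      clMul_apply, mulCl_apply, map_add, map_sub, map_smul]
    module
  have h0 : P' = 0 := D.eq_zero_of_clMul_mem
    (D.skewOp.sub_mem (D.skewOp.add_mem hP (D.skewOp.smul_mem _ hC)) (D.skewOp.smul_mem _ hF))
    (key ▸ D.cocycleBeta.sub_mem h (D.betaMap_mem φ x'))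
  rw [h0] at key
  have h1 : D.clMul (0 : Module.End ℝ D.S) = 0 :=
    LinearMap.ext fun v => LinearMap.ext fun s => by simp [clMul_apply]
  rw [h1] at key
  exact (sub_eq_zero.1 key).symm

end SpinorModule

end Uniqueness

/-! ### Normalised cocycles and their component β. -/

section Cochains

variable {V : Type*} [AddCommGroup V] [Module ℝ V] {η : LinearMap.BilinForm ℝ V}
  {e : LorentzFrame η} {Sg : Type*} [AddCommGroup Sg] [Module ℂ Sg] (D : SpinorModule e Sg)

theorem mem_so_of (A : Module.End ℝ V) (h : ∀ v w, η (A v) w = -η v (A w)) : A ∈ so η :=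
  (LinearMap.mem_skewAdjointSubmodule _).2 fun v w => by simpa using h v w

/-! ### Components of cochains -/

variable {D}

theorem C22_apply_VV {f : Neg D →ₗ[ℝ] Neg D →ₗ[ℝ] Poinc D} (hf : f ∈ C22 D) (v w : V) :
    f (v, 0) (w, 0) = ((f (v, 0) (w, 0)).1, 0, 0) := by
  have h := hf.1 (-2) (-2) (v, 0) ⟨fun h => absurd rfl h, fun _ => rfl⟩ (w, 0)
    ⟨fun h => absurd rfl h, fun _ => rfl⟩
  exact Prod.ext rfl (Prod.ext (h.2.1 (by norm_num)) (h.2.2 (by norm_num)))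

theorem C22_apply_VS {f : Neg D →ₗ[ℝ] Neg D →ₗ[ℝ] Poinc D} (hf : f ∈ C22 D) (v : V) (s : D.S) :
    f (v, 0) (0, s) = (0, (f (v, 0) (0, s)).2.1, 0) := by
  have h := hf.1 (-2) (-1) (v, 0) ⟨fun h => absurd rfl h, fun _ => rfl⟩ (0, s)
    ⟨fun _ => rfl, fun h => absurd rfl h⟩
  exact Prod.ext (h.1 (by norm_num)) (Prod.ext rfl (h.2.2 (by norm_num)))

theorem C22_apply_SV {f : Neg D →ₗ[ℝ] Neg D →ₗ[ℝ] Poinc D} (hf : f ∈ C22 D) (v : V) (s : D.S) :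
    f (0, s) (v, 0) = -f (v, 0) (0, s) := by
  simpa [par_zero, par_one] using hf.2 1 0 (0, s) (v, 0)

theorem C22_apply_SS {f : Neg D →ₗ[ℝ] Neg D →ₗ[ℝ] Poinc D} (hf : f ∈ C22 D) (s t : D.S) :
    f (0, s) (0, t) = (0, 0, (f (0, s) (0, t)).2.2) := by
  have h := hf.1 (-1) (-1) (0, s) ⟨fun _ => rfl, fun h => absurd rfl h⟩ (0, t)
    ⟨fun _ => rfl, fun h => absurd rfl h⟩
  exact Prod.ext (h.1 (by norm_num)) (Prod.ext (h.2.1 (by norm_num)) rfl)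

theorem C22_VV_swap {f : Neg D →ₗ[ℝ] Neg D →ₗ[ℝ] Poinc D} (hf : f ∈ C22 D) (v w : V) :
    f (v, 0) (w, 0) = -f (w, 0) (v, 0) := by
  simpa [par_zero, par_one] using hf.2 0 0 (v, 0) (w, 0)

theorem cochain_split (f : Neg D →ₗ[ℝ] Neg D →ₗ[ℝ] Poinc D) (X Y : Neg D) :
    f X Y = f (X.1, 0) (Y.1, 0) + f (X.1, 0) (0, Y.2) + f (0, X.2) (Y.1, 0) +
      f (0, X.2) (0, Y.2) := by
  have hX : X = (X.1, 0) + (0, X.2) := by simp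
  have hY : Y = (Y.1, 0) + (0, Y.2) := by simp
  conv_lhs => rw [hX, hY]
  simp only [map_add, LinearMap.add_apply]
  abel

/-- The component `V ⊗ S → S` of a cochain. -/
noncomputable def betaOf (f : Neg D →ₗ[ℝ] Neg D →ₗ[ℝ] Poinc D) : V →ₗ[ℝ] Module.End ℝ D.S :=
  LinearMap.mk₂ ℝ (fun v s => (f (v, 0) (0, s)).2.1)
    (fun v w s => by
      rw [show ((v + w, 0) : Neg D) = (v, 0) + (w, 0) by simp, map_add]; rfl)
    (fun c v s => by
      rw [show ((c • v, 0) : Neg D) = c • (v, 0) by simp, map_smul]; rfl)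
    (fun v s t => by
      rw [show ((0, s + t) : Neg D) = (0, s) + (0, t) by simp, map_add]; rfl)
    (fun c v s => by
      rw [show ((0, c • s) : Neg D) = c • (0, s) by simp, map_smul]; rfl)

theorem betaOf_apply (f : Neg D →ₗ[ℝ] Neg D →ₗ[ℝ] Poinc D) (v : V) (s : D.S) :
    betaOf f v s = (f (v, 0) (0, s)).2.1 := rfl

theorem d2h_zero_left (f : Neg D →ₗ[ℝ] Neg D →ₗ[ℝ] Poinc D) (x y z : Fin 2) (Y Z : Neg D) :
    d2h D f x y z 0 Y Z = 0 := by
  simp only [d2h, map_zero, LinearMap.zero_apply, smul_zero, sub_zero, add_zero]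

theorem d2h_zero_mid (f : Neg D →ₗ[ℝ] Neg D →ₗ[ℝ] Poinc D) (x y z : Fin 2) (X Z : Neg D) :
    d2h D f x y z X 0 Z = 0 := by
  simp only [d2h, map_zero, LinearMap.zero_apply, smul_zero, sub_zero, add_zero]

theorem d2h_zero_right (f : Neg D →ₗ[ℝ] Neg D →ₗ[ℝ] Poinc D) (x y z : Fin 2) (X Y : Neg D) :
    d2h D f x y z X Y 0 = 0 := by
  simp only [d2h, map_zero, LinearMap.zero_apply, smul_zero, sub_zero, add_zero]

theorem mk_zero_zero : ((0, 0) : Neg D) = 0 := rfl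

/-- The differential on `V ⊗ ⊙²S`. -/
theorem d2_VSS (f : Neg D →ₗ[ℝ] Neg D →ₗ[ℝ] Poinc D) (v : V) (s t : D.S) :
    d2 D f (v, 0) (0, s) (0, t) =
      bracket D (v, 0, 0) (f (0, s) (0, t)) + bracket D (0, s, 0) (f (0, t) (v, 0)) -
        bracket D (0, t, 0) (f (v, 0) (0, s)) - f (D.kappa s t, 0) (v, 0) := by
  simp only [d2, Fin.sum_univ_two, par_zero, par_one, mk_zero_zero, d2h_zero_left, d2h_zero_mid,
    d2h_zero_right, zero_add, add_zero]
  simp [d2h, bracketNeg_apply, incl_apply, mk_zero_zero, sub_eq_add_neg]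

/-- The differential on `⊙³S`. -/
theorem d2_SSS (f : Neg D →ₗ[ℝ] Neg D →ₗ[ℝ] Poinc D) (r s t : D.S) :
    d2 D f (0, r) (0, s) (0, t) =
      bracket D (0, r, 0) (f (0, s) (0, t)) + bracket D (0, s, 0) (f (0, t) (0, r)) +
        bracket D (0, t, 0) (f (0, r) (0, s)) - f (D.kappa r s, 0) (0, t) -
        f (D.kappa s t, 0) (0, r) - f (D.kappa t r, 0) (0, s) := by
  simp only [d2, Fin.sum_univ_two, par_zero, par_one, mk_zero_zero, d2h_zero_left, d2h_zero_mid,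
    d2h_zero_right, zero_add]
  simp [d2h, bracketNeg_apply, incl_apply]

/-- The cocycle condition on `V ⊗ ⊙²S` determines the component `⊙²S → so(V)`. -/
theorem gamma_of_cocycle {f : Neg D →ₗ[ℝ] Neg D →ₗ[ℝ] Poinc D} (hf : f ∈ Z22 D)
    (hn : IsNormalised D f) (s t : D.S) :
    ((f (0, s) (0, t)).2.2 : Module.End ℝ V) = D.gammaEnd (betaOf f) s t := by
  ext v
  have h := hf.2 (v, 0) (0, s) (0, t)
  have hnn := hn (D.kappa s t) v
  rw [d2_VSS, C22_apply_SV hf.1] at h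
  have h1 := congrArg Prod.fst h
  simp only [bracket_apply, Prod.fst_add, Prod.fst_sub, hnn, Prod.snd_neg, Prod.fst_neg] at h1
  rw [SpinorModule.gammaEnd_apply, betaOf_apply, betaOf_apply]
  simp only [Prod.fst_zero, map_zero, ZeroMemClass.coe_zero, LinearMap.zero_apply, map_neg] at h1
  linear_combination (norm := module) (-1 : ℝ) • h1

/-- The cocycle condition on `⊙³S`. -/
theorem cubic_of_cocycle {f : Neg D →ₗ[ℝ] Neg D →ₗ[ℝ] Poinc D} (hf : f ∈ Z22 D)
    (hn : IsNormalised D f) (s : D.S) : D.cubic (betaOf f) s = 0 := by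
  have h := hf.2 (0, s) (0, s) (0, s)
  rw [d2_SSS] at h
  have h1 := congrArg (fun p => p.2.1) h
  simp only [bracket_apply, Prod.fst_add, Prod.fst_sub, Prod.snd_add, Prod.snd_sub] at h1
  rw [SpinorModule.cubic, ← gamma_of_cocycle hf hn, ← SpinorModule.soS_eq, betaOf_apply]
  simp only [map_zero, LinearMap.zero_apply, zero_sub, Prod.snd_zero, Prod.fst_zero] at h1
  -- On the diagonal the three cyclic terms coincide.
  linear_combination (norm := module) (-1 / 3 : ℝ) • h1

theorem betaOf_mem {f : Neg D →ₗ[ℝ] Neg D →ₗ[ℝ] Poinc D} (hf : f ∈ Z22 D)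
    (hn : IsNormalised D f) : betaOf f ∈ D.cocycleBeta := by
  refine ⟨fun v s => ?_, cubic_of_cocycle hf hn⟩
  have h := so_skew (f (0, s) (0, s)).2.2 v v
  rw [gamma_of_cocycle hf hn, e.symm v, SpinorModule.gammaEnd_self, map_smul,
    LinearMap.smul_apply, SpinorModule.eta_kappa_cl, smul_eq_mul] at h
  linarith

/-- A normalised cocycle is determined by its component `V ⊗ S → S`. -/
theorem eq_of_betaOf_eq {f g : Neg D →ₗ[ℝ] Neg D →ₗ[ℝ] Poinc D} (hf : f ∈ Z22 D)
    (hfn : IsNormalised D f) (hg : g ∈ Z22 D) (hgn : IsNormalised D g)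
    (h : betaOf f = betaOf g) : f = g := by
  refine LinearMap.ext fun X => LinearMap.ext fun Y => ?_
  have hb : ∀ v s, f (v, 0) (0, s) = g (v, 0) (0, s) := fun v s => by
    rw [C22_apply_VS hf.1, C22_apply_VS hg.1, ← betaOf_apply, ← betaOf_apply, h]
  rw [cochain_split f, cochain_split g, C22_apply_SV hf.1, C22_apply_SV hg.1, hb, hb,
    C22_apply_VV hf.1, C22_apply_VV hg.1, hfn, hgn, C22_apply_SS hf.1, C22_apply_SS hg.1,
    show (f (0, X.2) (0, Y.2)).2.2 = (g (0, X.2) (0, Y.2)).2.2 from Subtype.ext (by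
      rw [gamma_of_cocycle hf hfn, gamma_of_cocycle hg hgn, h])]

namespace SpinorModule

/-- Skewness for polarised arguments follows from the diagonal condition by polarising in v and in
s. -/
theorem gammaEnd_mem {β : V →ₗ[ℝ] Module.End ℝ D.S} (hβ : β ∈ D.cocycleBeta) (s t : D.S) :
    D.gammaEnd β s t ∈ so η := by
  refine mem_so_of _ fun v w => ?_
  have h := D.skew_polarise hβ.1 w v s t
  simp only [LinearMap.add_apply, Module.End.mul_apply, map_add] at h
  rw [e.symm v, gammaEnd_apply, gammaEnd_apply]
  simp only [map_neg, map_add, LinearMap.neg_apply, LinearMap.add_apply, eta_kappa_cl]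
  rw [D.ip_symm t, D.ip_symm t]
  linarith

/-- The component `⊙²S → so(V)` of a normalised cocycle. -/
noncomputable def gammaSo {β : V →ₗ[ℝ] Module.End ℝ D.S} (hβ : β ∈ D.cocycleBeta) :
    D.S →ₗ[ℝ] D.S →ₗ[ℝ] so η :=
  LinearMap.mk₂ ℝ (fun s t => ⟨D.gammaEnd β s t, gammaEnd_mem hβ s t⟩)
    (fun s s' t => Subtype.ext (by simp))
    (fun c s t => Subtype.ext (by simp))
    (fun s t t' => Subtype.ext (by simp))
    (fun c s t => Subtype.ext (by simp))

theorem coe_gammaSo {β : V →ₗ[ℝ] Module.End ℝ D.S} (hβ : β ∈ D.cocycleBeta) (s t : D.S) :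
    (gammaSo hβ s t : Module.End ℝ V) = D.gammaEnd β s t := rfl

theorem gammaSo_symm {β : V →ₗ[ℝ] Module.End ℝ D.S} (hβ : β ∈ D.cocycleBeta) (s t : D.S) :
    gammaSo hβ s t = gammaSo hβ t s := Subtype.ext (D.gammaEnd_symm β s t)

theorem cubic_polarise {β : V →ₗ[ℝ] Module.End ℝ D.S} (hβ : β ∈ D.cocycleBeta) (r s t : D.S) :
    β (D.kappa r s) t + soS D (gammaSo hβ r s) t + (β (D.kappa s t) r + soS D (gammaSo hβ s t) r) +
      (β (D.kappa t r) s + soS D (gammaSo hβ t r) s) = 0 := by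
  have h : ∀ s, β (D.kappa s s) s + soS D (gammaSo hβ s s) s = 0 := fun s => by
    rw [soS_eq, coe_gammaSo]; exact hβ.2 s
  have h1 := h (r + s + t)
  have h2 := h (r + s)
  have h3 := h (s + t)
  have h4 := h (r + t)
  have h5 := h r
  have h6 := h s
  have h7 := h t
  simp only [map_add, LinearMap.add_apply, D.kappa_symm s r, D.kappa_symm t s, D.kappa_symm t r,
    gammaSo_symm hβ s r, gammaSo_symm hβ t s, gammaSo_symm hβ t r] at h1 h2 h3 h4 ⊢
  -- Third-order polarisation of a cubic form. Each of the three terms occurs twice because κ and γ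
  -- are symmetric.
  linear_combination (norm := module) (1 / 2 : ℝ) • (h1 - h2 - h3 - h4 + h5 + h6 + h7)

/-- The normalised cocycle with a given component `V ⊗ S → S`. -/
noncomputable def cocycleOf {β : V →ₗ[ℝ] Module.End ℝ D.S} (hβ : β ∈ D.cocycleBeta) :
    Neg D →ₗ[ℝ] Neg D →ₗ[ℝ] Poinc D :=
  LinearMap.mk₂ ℝ (fun X Y => (0, β X.1 Y.2 - β Y.1 X.2, gammaSo hβ X.2 Y.2))
    (by intro X X' Y; ext1 <;> [skip; ext1] <;> simp; abel)
    (by intro c X Y; ext1 <;> [skip; ext1] <;> simp [smul_sub])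
    (by intro X X' Y; ext1 <;> [skip; ext1] <;> simp; abel)
    (by intro c X Y; ext1 <;> [skip; ext1] <;> simp [smul_sub])

theorem cocycleOf_apply {β : V →ₗ[ℝ] Module.End ℝ D.S} (hβ : β ∈ D.cocycleBeta) (X Y : Neg D) :
    cocycleOf hβ X Y = (0, β X.1 Y.2 - β Y.1 X.2, gammaSo hβ X.2 Y.2) := rfl

theorem cocycleOf_mem {β : V →ₗ[ℝ] Module.End ℝ D.S} (hβ : β ∈ D.cocycleBeta) :
    cocycleOf hβ ∈ Z22 D := by
  refine ⟨⟨?_, ?_⟩, ?_⟩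
  · rintro i j X ⟨hX, hX'⟩ Y ⟨hY, hY'⟩
    rw [cocycleOf_apply]
    refine ⟨fun _ => rfl, fun h => ?_, fun h => ?_⟩
    · by_cases hi : i = -2
      · rw [show Y.2 = 0 from hY' (by omega), show X.2 = 0 from hX' (by omega)]; simp
      · rw [hX hi]
        by_cases hj : j = -2
        · rw [show X.2 = 0 from hX' (by omega)]; simp
        · rw [hY hj]; simp
    · by_cases hi : i = -1
      · rw [show Y.2 = 0 from hY' (by omega)]; simp
      · rw [hX' hi]; simp
  · intro x y X Y
    rw [cocycleOf_apply, cocycleOf_apply]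
    fin_cases x <;> fin_cases y <;> simp [par_zero, par_one, gammaSo_symm hβ X.2 Y.2]
  · intro X Y Z
    have hg : ∀ (s t : D.S) (v : V), ((gammaSo hβ s t : so η) : Module.End ℝ V) v =
        -(D.kappa s (β v t) + D.kappa t (β v s)) := fun s t v => rfl
    refine Finset.sum_eq_zero fun x _ => Finset.sum_eq_zero fun y _ =>
      Finset.sum_eq_zero fun z _ => ?_
    simp only [d2h, cocycleOf_apply, bracketNeg_apply, bracket_apply, incl_apply]
    -- Where `V` and `⊙²S` meet, the condition holds by the definition of γ through β; on `⊙³S` it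
    -- is `cubic_polarise`.
    fin_cases x <;> fin_cases y <;> fin_cases z <;>
      simp [par_zero, par_one, hg]
    · abel
    · have := cubic_polarise hβ X.2 Y.2 Z.2
      linear_combination (norm := module) (-1 : ℝ) • this

theorem cocycleOf_normalised {β : V →ₗ[ℝ] Module.End ℝ D.S} (hβ : β ∈ D.cocycleBeta) :
    IsNormalised D (cocycleOf hβ) := fun _ _ => rfl

theorem betaOf_cocycleOf {β : V →ₗ[ℝ] Module.End ℝ D.S} (hβ : β ∈ D.cocycleBeta) :
    betaOf (cocycleOf hβ) = β := by
  refine LinearMap.ext fun v => LinearMap.ext fun s => ?_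
  rw [betaOf_apply, cocycleOf_apply]
  simp

end SpinorModule

end Cochains

/-! ### Injectivity and equivariance of (C, F) ↦ β. -/

section Equivariance

variable {V : Type*} [AddCommGroup V] [Module ℝ V] {η : LinearMap.BilinForm ℝ V}
  {e : LorentzFrame η} {Sg : Type*} [AddCommGroup Sg] [Module ℂ Sg]
  {M : Type*} [AddCommGroup M] [Module ℝ M]

/-- Contraction of the first factor of a tensor with a vector. -/
noncomputable def contract (η : LinearMap.BilinForm ℝ V) : V ⊗[ℝ] M →ₗ[ℝ] V →ₗ[ℝ] M :=
  TensorProduct.lift (LinearMap.mk₂ ℝ (fun v f => (η v).smulRight f)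
    (by intro v v' w; ext1 u; simp [add_smul])
    (by intro c v w; ext1 u; simp [mul_smul])
    (by intro v w w'; ext1 u; simp)
    (by intro c v w; ext1 u; simp [smul_comm c]))

theorem contract_tmul (v u : V) (f : M) : contract η (v ⊗ₜ[ℝ] f) u = η v u • f := rfl

theorem sum_tmul_contract (e : LorentzFrame η) (t : V ⊗[ℝ] M) :
    ∑ μ, e.basis μ ⊗ₜ[ℝ] (sgn μ • contract η t (e.basis μ)) = t := by
  induction t with
  | zero => simp
  | tmul v f =>
    conv_rhs => rw [← e.expand v, TensorProduct.sum_tmul]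
    refine Finset.sum_congr rfl fun μ _ => ?_
    rw [contract_tmul, smul_smul, TensorProduct.tmul_smul, TensorProduct.smul_tmul', e.symm v]
  | add s t hs ht =>
    conv_rhs => rw [← hs, ← ht]
    rw [← Finset.sum_add_distrib]
    refine Finset.sum_congr rfl fun μ _ => ?_
    rw [map_add, LinearMap.add_apply, smul_add, TensorProduct.tmul_add]

theorem contract_injective (e : LorentzFrame η) :
    Function.Injective (contract (M := M) η) := by
  intro s t h
  rw [← sum_tmul_contract e s, h, sum_tmul_contract]

theorem contractOne_eq (φ : M →ₗ[ℝ] sp1) (t : V ⊗[ℝ] M) :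
    SpinorModule.contractOne η φ t = φ ∘ₗ contract η t := by
  induction t with
  | zero => simp
  | tmul v f =>
    refine LinearMap.ext fun u => ?_
    rw [SpinorModule.contractOne_tmul, LinearMap.comp_apply, contract_tmul, map_smul]
  | add s t hs ht => rw [map_add, hs, ht, map_add, LinearMap.comp_add]

theorem bivectorEnd_eq (t : V ⊗[ℝ] V) : SpinorModule.bivectorEnd η t =
    contract η (TensorProduct.comm ℝ V V t) - contract η t := by
  induction t with
  | zero => simp
  | tmul v w => rfl
  | add s t hs ht => simp only [map_add, hs, ht]; abel

namespace SpinorModule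

variable (D : SpinorModule e Sg)

theorem eq_zero_of_cl {v : V} (h : D.cl v = 0) : v = 0 := by
  refine e.nondeg fun u => ?_
  have h2 := D.cl_mul_cl v u
  rw [h, zero_mul, mul_zero, sub_zero] at h2
  have : Nontrivial D.S := Module.nontrivial_of_finrank_pos (R := ℝ) (by rw [D.finrank_S]; norm_num)
  obtain ⟨s, hs⟩ := exists_ne (0 : D.S)
  have h3 := LinearMap.congr_fun h2 s
  rw [LinearMap.zero_apply, LinearMap.smul_apply, Module.End.one_apply, eq_comm,
    smul_eq_zero_iff_left hs] at h3
  rw [map_zero, LinearMap.zero_apply]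
  linarith

theorem eq_zero_of_qu {a : sp1} (h : D.qu a = 0) : a = 0 := by
  obtain ⟨f, rfl⟩ := sp1_eq_sum a
  have : Nontrivial D.S := Module.nontrivial_of_finrank_pos (R := ℝ) (by rw [D.finrank_S]; norm_num)
  obtain ⟨s, hs⟩ := exists_ne (0 : D.S)
  have h3 := LinearMap.congr_fun h s
  simp only [Fin.sum_univ_three, map_add, map_smul, LinearMap.add_apply, LinearMap.smul_apply,
    LinearMap.zero_apply] at h3
  obtain ⟨-, h0, h1, h2⟩ := D.quat_smul_eq_zero hs 0 (f 0) (f 1) (f 2) (by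
    rw [zero_smul, zero_add, h3])
  rw [Fin.sum_univ_three, h0, h1, h2]
  simp

/-- Contraction with Γ^μ recovers the bivector and, in the companion lemma `sum_cl_qu`, the
`sp(1)`-valued vector. -/
theorem sum_cl_cl_bivectorEnd (t : V ⊗[ℝ] V) :
    ∑ μ, sgn μ • (D.cl (e.basis μ) * D.cl (bivectorEnd η t (e.basis μ))) =
      (-4 : ℝ) • D.cliffTwo t := by
  induction t with
  | zero => simp
  | tmul v w =>
    have h : ∀ w : V, ∑ μ, (sgn μ * η w (e.basis μ)) • D.cl (e.basis μ) = D.cl w := by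
      intro w
      conv_rhs => rw [← e.expand w]
      simp [e.symm w]
    have h1 : ∀ v w : V, ∑ μ, sgn μ • (D.cl (e.basis μ) * η w (e.basis μ) • D.cl v) =
        D.cl w * D.cl v := by
      intro v w
      rw [← h w, Finset.sum_mul]
      refine Finset.sum_congr rfl fun μ _ => ?_
      rw [mul_smul_comm, smul_mul_assoc, smul_smul]
    simp only [bivectorEnd_tmul, map_sub, map_smul, mul_sub, smul_sub, Finset.sum_sub_distrib, h1,
      cliffTwo_tmul]
    module
  | add s t hs ht =>
    simp only [map_add, LinearMap.add_apply, mul_add, smul_add, Finset.sum_add_distrib, hs, ht]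

theorem sum_cl_qu (φ : M →ₗ[ℝ] sp1) (t : V ⊗[ℝ] M) :
    ∑ μ, sgn μ • (D.cl (e.basis μ) * D.qu (contractOne η φ t (e.basis μ))) = D.cliffOne φ t := by
  induction t with
  | zero => simp
  | tmul v f =>
    have h : ∀ w : V, ∑ μ, (sgn μ * η w (e.basis μ)) • D.cl (e.basis μ) = D.cl w := by
      intro w
      conv_rhs => rw [← e.expand w]
      simp [e.symm w]
    rw [cliffOne_tmul, ← h v, Finset.sum_mul]
    refine Finset.sum_congr rfl fun μ _ => ?_
    rw [contractOne_tmul, map_smul, mul_smul_comm, smul_mul_assoc, smul_smul]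
  | add s t hs ht =>
    simp only [map_add, LinearMap.add_apply, mul_add, smul_add, Finset.sum_add_distrib, hs, ht]

theorem sum_cl_sq (P : Module.End ℝ D.S) :
    ∑ μ, sgn μ • (D.cl (e.basis μ) * (D.cl (e.basis μ) * P)) = (5 : ℝ) • P := by
  have h : ∀ μ, sgn μ • (D.cl (e.basis μ) * (D.cl (e.basis μ) * P)) = P := by
    intro μ
    refine LinearMap.ext fun s => ?_
    rw [LinearMap.smul_apply, Module.End.mul_apply, Module.End.mul_apply, cl_cl_self,
      e.orthonormal, if_pos rfl, smul_smul, sgn_mul_sgn, one_smul]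
  rw [Finset.sum_congr rfl fun μ _ => h μ, Fin.sum_univ_five]
  module

/-- The parametrisation of the normalised cocycles is injective on bivectors. -/
theorem eq_zero_of_betaMap {φ : M →ₗ[ℝ] sp1} (hφ : Function.Injective φ)
    {x : (V ⊗[ℝ] V) × (V ⊗[ℝ] M)} (hx : TensorProduct.comm ℝ V V x.1 = -x.1)
    (h : D.betaMap φ x = 0) : x = 0 := by
  set C := D.cliffTwo x.1 with hC
  set F := D.cliffOne φ x.2 with hF
  set A := bivectorEnd η x.1 with hA
  set f := contractOne η φ x.2 with hf
  have h1 : ∀ v, (-1 / 2 : ℝ) • (D.cl v * C) + (-3 / 4 : ℝ) • D.cl (A v) +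
      (1 / 4 : ℝ) • (D.cl v * F) + (-3 / 4 : ℝ) • D.qu (f v) = 0 := fun v => by
    have := LinearMap.congr_fun h v
    rw [betaMap_eq] at this
    exact this
  -- Contract with Γ^μ, using Γ^μΓ_μ = 5. The coefficients are -5/2 + 3 = 1/2 for C and 5/4 - 3/4 =
  -- 1/2 for F.
  have hCF : C = -F := by
    have h2 : ∑ μ, sgn μ • (D.cl (e.basis μ) * ((-1 / 2 : ℝ) • (D.cl (e.basis μ) * C) +
      (-3 / 4 : ℝ) • D.cl (A (e.basis μ)) + (1 / 4 : ℝ) • (D.cl (e.basis μ) * F) +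
      (-3 / 4 : ℝ) • D.qu (f (e.basis μ)))) = 0 :=
      Finset.sum_eq_zero fun μ _ => by rw [h1, mul_zero, smul_zero]
    have h3 : ∀ P : V → Module.End ℝ D.S, ∀ c : ℝ,
        ∑ μ, sgn μ • (D.cl (e.basis μ) * c • P (e.basis μ)) =
          c • ∑ μ, sgn μ • (D.cl (e.basis μ) * P (e.basis μ)) := fun P c => by
      rw [Finset.smul_sum]
      exact Finset.sum_congr rfl fun μ _ => by rw [mul_smul_comm, smul_comm]
    simp only [mul_add, smul_add, Finset.sum_add_distrib] at h2
    rw [h3 (fun v => D.cl v * C), h3 (fun v => D.cl (A v)), h3 (fun v => D.cl v * F),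
      h3 (fun v => D.qu (f v)), sum_cl_sq, sum_cl_sq, sum_cl_cl_bivectorEnd, sum_cl_qu, ← hC,
      ← hF] at h2
    linear_combination (norm := module) (2 : ℝ) • h2
  have h4 : ∀ v, D.cl v * F = D.cl (A v) + D.qu (f v) := fun v => by
    have := h1 v
    rw [hCF, mul_neg] at this
    linear_combination (norm := module) (4 / 3 : ℝ) • this
  have hCv : ∀ v, C * D.cl v = D.cl v * C + D.cl (A v) := fun v =>
    LinearMap.ext fun s => D.cliffTwo_cl x.1 v s
  have hFv : ∀ v, F * D.cl v = -(D.cl v * F) + (2 : ℝ) • D.qu (f v) := fun v =>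
    LinearMap.ext fun s => D.cliffOne_cl φ x.2 v s
  -- Substituting C = -F in the commutator with v, and using the anticommutator of F with v, gives
  -- 2v·F = Av + 2f(v). Comparison with twice `h4` leaves Av = 0.
  have hA0 : ∀ v, A v = 0 := fun v => by
    refine D.eq_zero_of_cl ?_
    have h5 := hCv v
    rw [hCF, neg_mul, hFv, mul_neg] at h5
    linear_combination (norm := module) (1 : ℝ) • h5 - (2 : ℝ) • h4 v
  -- Now v·F = f(v), and contraction with Γ^μ gives 5F = F.
  have hF0 : F = 0 := by
    have h6 := D.sum_cl_sq F
    simp only [h4, hA0, map_zero, zero_add] at h6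
    rw [sum_cl_qu, ← hF] at h6
    linear_combination (norm := module) (-1 / 4 : ℝ) • h6
  have hf0 : ∀ v, f v = 0 := fun v => by
    refine D.eq_zero_of_qu ?_
    have := h4 v
    rw [hF0, mul_zero, hA0, map_zero, zero_add] at this
    exact this.symm
  refine Prod.ext (contract_injective e ?_) (contract_injective e ?_)
  · refine LinearMap.ext fun v => ?_
    have h7 := hA0 v
    -- Skew-symmetry of the tensor enters only here: on skew tensors the endomorphism is -2 times
    -- the contraction, so it determines the tensor.
    rw [hA, bivectorEnd_eq, hx, map_neg, LinearMap.sub_apply, LinearMap.neg_apply] at h7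
    rw [Prod.fst_zero, map_zero, LinearMap.zero_apply]
    linear_combination (norm := module) (-1 / 2 : ℝ) • h7
  · refine LinearMap.ext fun v => hφ ?_
    have h7 := hf0 v
    rw [hf, contractOne_eq, LinearMap.comp_apply] at h7
    rw [h7, Prod.snd_zero, map_zero, LinearMap.zero_apply, map_zero]

theorem cl_lie (T : SoSp η) (v : V) (s : D.S) :
    ⁅T, D.cl v s⁆ = D.cl ⁅T, v⁆ s + D.cl v ⁅T, s⁆ := D.cliff_lie T v s

theorem qu_lie (T : SoSp η) (a : sp1) (s : D.S) :
    ⁅T, D.qu a s⁆ = D.qu ⁅T.2, a⁆ s + D.qu a ⁅T, s⁆ := by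
  rw [qu_apply, qu_apply, qu_apply, leibniz_lie]
  congr 2
  exact Prod.ext (by simp) rfl

theorem cliffTwo_lie (T : SoSp η) (t : V ⊗[ℝ] V) (s : D.S) :
    ⁅T, D.cliffTwo t s⁆ = D.cliffTwo ⁅T, t⁆ s + D.cliffTwo t ⁅T, s⁆ := by
  induction t with
  | zero => simp
  | tmul v w =>
    rw [TensorProduct.LieModule.lie_tmul_right, map_add]
    simp only [cliffTwo_tmul, LinearMap.smul_apply, LinearMap.sub_apply, LinearMap.add_apply,
      Module.End.mul_apply, lie_smul, lie_sub, cl_lie, map_add]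
    module
  | add s t hs ht =>
    simp only [lie_add, map_add, LinearMap.add_apply, hs, ht]; abel

variable [LieRingModule (SoSp η) M] [LieModule ℝ (SoSp η) M]

theorem cliffOne_lie {φ : M →ₗ[ℝ] sp1} (hφ : ∀ (T : SoSp η) f, φ ⁅T, f⁆ = ⁅T.2, φ f⁆)
    (T : SoSp η) (t : V ⊗[ℝ] M) (s : D.S) :
    ⁅T, D.cliffOne φ t s⁆ = D.cliffOne φ ⁅T, t⁆ s + D.cliffOne φ t ⁅T, s⁆ := by
  induction t with
  | zero => simp
  | tmul v w =>
    rw [TensorProduct.LieModule.lie_tmul_right, map_add]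
    simp only [cliffOne_tmul, LinearMap.add_apply, Module.End.mul_apply, cl_lie, qu_lie, hφ,
      map_add]
    abel
  | add s t hs ht =>
    simp only [lie_add, map_add, LinearMap.add_apply, hs, ht]; abel

theorem betaMap_lie {φ : M →ₗ[ℝ] sp1} (hφ : ∀ (T : SoSp η) f, φ ⁅T, f⁆ = ⁅T.2, φ f⁆)
    (T : SoSp η) (x : (V ⊗[ℝ] V) × (V ⊗[ℝ] M)) (v : V) (s : D.S) :
    ⁅T, D.betaMap φ x v s⁆ = D.betaMap φ ⁅T, x⁆ v s + D.betaMap φ x ⁅T, v⁆ s +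
      D.betaMap φ x v ⁅T, s⁆ := by
  simp only [betaMap_apply, lie_sub, lie_smul, cl_lie, cliffTwo_lie, D.cliffOne_lie hφ, prod_lie,
    map_add]
  module

end SpinorModule

end Equivariance

/-! ### Normalisation of cocycles through torsion. -/

section Torsion

variable {V : Type*} [AddCommGroup V] [Module ℝ V] {η : LinearMap.BilinForm ℝ V}
  {e : LorentzFrame η} {Sg : Type*} [AddCommGroup Sg] [Module ℂ Sg] {D : SpinorModule e Sg}

/-- A metric connection is determined by its torsion. -/
theorem so_eq_zero_of_symm (e : LorentzFrame η) (φ : V →ₗ[ℝ] so η)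
    (h : ∀ v w, (φ v : Module.End ℝ V) w = (φ w : Module.End ℝ V) v) : φ = 0 := by
  refine LinearMap.ext fun u => Subtype.ext (LinearMap.ext fun v => ?_)
  refine e.nondeg fun w => ?_
  have k : ∀ a b c : V, η ((φ a : Module.End ℝ V) b) c = -η ((φ a : Module.End ℝ V) c) b :=
    fun a b c => by rw [so_skew, e.symm b]
  -- A trilinear form symmetric in its first two slots and skew in its last two vanishes: three
  -- exchanges of each kind return the arguments with a sign -1.
  have k1 : η ((φ u : Module.End ℝ V) v) w = -η ((φ u : Module.End ℝ V) v) w := by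
    conv_lhs => rw [k, h u w, k, neg_neg, h w v, k, h v u]
  rw [LinearMap.zero_apply, ZeroMemClass.coe_zero, LinearMap.zero_apply, map_zero,
    LinearMap.zero_apply]
  linarith

/-- There is a metric connection with any given torsion. -/
theorem exists_so_of_torsion (e : LorentzFrame η) (α : V →ₗ[ℝ] V →ₗ[ℝ] V)
    (hα : ∀ v w, α v w = -α w v) : ∃ φ : V →ₗ[ℝ] so η, ∀ v w,
      (φ v : Module.End ℝ V) w - (φ w : Module.End ℝ V) v = α v w := by
  -- The Koszul formula for the connection with torsion α; ψ is obtained from it by raising the last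
  -- argument.
  let p : V → V → V → ℝ := fun v w u =>
    1 / 2 * (η (α v w) u - η (α w u) v + η (α u v) w)
  let ψ : V →ₗ[ℝ] Module.End ℝ V := LinearMap.mk₂ ℝ
    (fun v w => ∑ μ, (sgn μ * p v w (e.basis μ)) • e.basis μ)
    (by
      intro v v' w
      rw [← Finset.sum_add_distrib]
      refine Finset.sum_congr rfl fun μ _ => ?_
      simp only [p, map_add, LinearMap.add_apply]; module)
    (by
      intro c v w
      rw [Finset.smul_sum]
      refine Finset.sum_congr rfl fun μ _ => ?_
      simp only [p, map_smul, LinearMap.smul_apply, smul_eq_mul]; module)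
    (by
      intro v w w'
      rw [← Finset.sum_add_distrib]
      refine Finset.sum_congr rfl fun μ _ => ?_
      simp only [p, map_add, LinearMap.add_apply]; module)
    (by
      intro c v w
      rw [Finset.smul_sum]
      refine Finset.sum_congr rfl fun μ _ => ?_
      simp only [p, map_smul, LinearMap.smul_apply, smul_eq_mul]; module)
  have hψ : ∀ v w u, η (ψ v w) u = p v w u := by
    intro v w u
    have h1 : η (ψ v w) u = ∑ μ, (sgn μ * η (e.basis μ) u) * p v w (e.basis μ) := by
      simp only [ψ, LinearMap.mk₂_apply, map_sum, LinearMap.sum_apply, map_smul,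
        LinearMap.smul_apply, smul_eq_mul]
      exact Finset.sum_congr rfl fun μ _ => by ring
    have h2 : p v w u = p v w (∑ μ, (sgn μ * η (e.basis μ) u) • e.basis μ) := by rw [e.expand]
    rw [h1, h2]
    simp only [p, map_sum, map_smul, LinearMap.sum_apply, LinearMap.smul_apply, smul_eq_mul,
      ← Finset.sum_sub_distrib, ← Finset.sum_add_distrib, Finset.mul_sum]
    exact Finset.sum_congr rfl fun μ _ => by ring
  have hso : ∀ v, ψ v ∈ so η := fun v => mem_so_of _ fun w u => by
    rw [e.symm w, hψ, hψ]
    simp only [p]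
    rw [hα u w, hα v u, hα w v, map_neg, map_neg, map_neg, LinearMap.neg_apply, LinearMap.neg_apply,
      LinearMap.neg_apply]
    ring
  refine ⟨ψ.codRestrict (so η).toSubmodule hso, fun v w => e.nondeg fun u => ?_⟩
  change η (ψ v w - ψ w v) u = _
  rw [map_sub, LinearMap.sub_apply, hψ, hψ]
  simp only [p]
  rw [hα w v, hα v u, hα u w, map_neg, map_neg, map_neg, LinearMap.neg_apply, LinearMap.neg_apply,
    LinearMap.neg_apply]
  ring

/-- The cochain `V → so(V)`, extended by zero to `S`. -/
noncomputable def connCochain (D : SpinorModule e Sg) (φ : V →ₗ[ℝ] so η) : Neg D →ₗ[ℝ] Poinc D :=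
  LinearMap.inr ℝ V (D.S × so η) ∘ₗ LinearMap.inr ℝ D.S (so η) ∘ₗ φ ∘ₗ LinearMap.fst ℝ V D.S

theorem connCochain_mem (φ : V →ₗ[ℝ] so η) : connCochain D φ ∈ C21 D := by
  rintro i X ⟨hX, -⟩
  refine ⟨fun _ => rfl, fun _ => rfl, fun h => ?_⟩
  change φ X.1 = 0
  rw [hX (by omega), map_zero]

theorem mk_Z22_eq_iff {z w : Z22 D} :
    LieSubmodule.Quotient.mk (N := B22' D) z = LieSubmodule.Quotient.mk (N := B22' D) w ↔
      z.1 - w.1 ∈ B22 D := by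
  change Submodule.Quotient.mk z = Submodule.Quotient.mk w ↔ _
  rw [Submodule.Quotient.eq]
  rfl

/-- A normalised coboundary vanishes. -/
theorem eq_zero_of_mem_B22 {g : Neg D →ₗ[ℝ] Neg D →ₗ[ℝ] Poinc D} (hg : g ∈ B22 D)
    (hn : IsNormalised D g) : g = 0 := by
  obtain ⟨f, hf, rfl⟩ := (LieSubmodule.mem_map g).1 hg
  have h0 : ∀ v : V, (f (v, 0)).2.2 = 0 := by
    have := so_eq_zero_of_symm e (LinearMap.snd ℝ D.S (so η) ∘ₗ LinearMap.snd ℝ V (D.S × so η) ∘ₗ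
      f ∘ₗ LinearMap.inl ℝ V D.S) (fun v w => by
        have h := hn v w
        rw [d1_explicit D hf] at h
        exact sub_eq_zero.1 h)
    exact fun v => LinearMap.congr_fun this v
  refine LinearMap.ext fun X => LinearMap.ext fun Y => ?_
  rw [d1_explicit D hf, h0, h0, h0]
  simp

/-- The component `V ⊗ V → V` of a cochain. -/
noncomputable def torsionOf (f : Neg D →ₗ[ℝ] Neg D →ₗ[ℝ] Poinc D) : V →ₗ[ℝ] V →ₗ[ℝ] V :=
  LinearMap.mk₂ ℝ (fun v w => (f (v, 0) (w, 0)).1)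
    (fun v w s => by
      rw [show ((v + w, 0) : Neg D) = (v, 0) + (w, 0) by simp, map_add]; rfl)
    (fun c v s => by
      rw [show ((c • v, 0) : Neg D) = c • (v, 0) by simp, map_smul]; rfl)
    (fun v s t => by
      rw [show ((s + t, 0) : Neg D) = (s, 0) + (t, 0) by simp, map_add]; rfl)
    (fun c v s => by
      rw [show ((c • s, 0) : Neg D) = c • (s, 0) by simp, map_smul]; rfl)

/-- Every cohomology class has a normalised representative. -/
theorem exists_normalised (z : Z22 D) : ∃ w : Z22 D, IsNormalised D w ∧
    LieSubmodule.Quotient.mk (N := B22' D) w = LieSubmodule.Quotient.mk (N := B22' D) z := by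
  obtain ⟨φ, hφ⟩ := exists_so_of_torsion e (torsionOf z.1)
    (fun v w => congrArg Prod.fst (C22_VV_swap z.2.1 v w))
  have hB : d1 D (connCochain D φ) ∈ B22 D :=
    (LieSubmodule.mem_map _).2 ⟨_, connCochain_mem φ, rfl⟩
  refine ⟨⟨z.1 - d1 D (connCochain D φ), sub_mem z.2 (B22_le_Z22 D hB)⟩, fun v w => ?_, ?_⟩
  · change (z.1 (v, 0) (w, 0) - d1 D (connCochain D φ) (v, 0) (w, 0)).1 = 0
    rw [d1_explicit D (connCochain_mem φ), Prod.fst_sub]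
    exact sub_eq_zero.2 (hφ v w).symm
  · rw [mk_Z22_eq_iff]
    exact (congrArg (· ∈ B22 D) (sub_sub_cancel_left z.1 _)).mpr (neg_mem hB)

theorem eq_of_mk_eq {z w : Z22 D} (hz : IsNormalised D z) (hw : IsNormalised D w)
    (h : LieSubmodule.Quotient.mk (N := B22' D) z = LieSubmodule.Quotient.mk (N := B22' D) w) :
    z = w := by
  refine Subtype.ext (sub_eq_zero.1 (eq_zero_of_mem_B22 (mk_Z22_eq_iff.1 h) fun u v => ?_))
  rw [LinearMap.sub_apply, LinearMap.sub_apply, Prod.fst_sub, hz, hw, sub_zero]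

end Torsion

/-! ### The module (∧²V ⊗ ∧²Δ) ⊕ (V ⊗ ⊙²Δ). -/

section Source

variable {V : Type*} [AddCommGroup V] [Module ℝ V] {η : LinearMap.BilinForm ℝ V}

/-- Lowering an index, as a map onto `sp(1)`. -/
noncomputable def symToSp (η : LinearMap.BilinForm ℝ V) : sym2Delta η →ₗ[ℝ] sp1 where
  toFun t := ⟨lowerIndex t, (mem_sym2Delta_iff _).1 t.2⟩
  map_add' _ _ := Subtype.ext (add_mul _ _ _)
  map_smul' _ _ := Subtype.ext (smul_mul_assoc _ _ _)

theorem coe_symToSp (t : sym2Delta η) :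
    (symToSp η t : Matrix (Fin 2) (Fin 2) ℂ) = lowerIndex t := rfl

theorem eps2_transpose_mul : eps2.transpose * eps2 = 1 := by
  ext i j; fin_cases i <;> fin_cases j <;> simp [eps2, Matrix.mul_apply, Fin.sum_univ_two]

theorem eps2_mul_transpose : eps2 * eps2.transpose = 1 := by
  ext i j; fin_cases i <;> fin_cases j <;> simp [eps2, Matrix.mul_apply, Fin.sum_univ_two]

theorem symToSp_injective : Function.Injective (symToSp η) := by
  intro s t h
  have h1 : (s : Matrix (Fin 2) (Fin 2) ℂ) * eps2.transpose = t * eps2.transpose :=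
    congrArg Subtype.val h
  have h2 := congrArg (· * eps2) h1
  simp only [mul_assoc, eps2_transpose_mul, mul_one] at h2
  exact Subtype.ext h2

theorem symToSp_surjective : Function.Surjective (symToSp η) := by
  intro a
  have h : lowerIndex ((a : Matrix (Fin 2) (Fin 2) ℂ) * eps2) = a := by
    rw [lowerIndex, mul_assoc, eps2_mul_transpose, mul_one]
  exact ⟨⟨a * eps2, (mem_sym2Delta_iff _).2 (by rw [h]; exact a.2)⟩, Subtype.ext h⟩

/-- Elements of `sp(1)` preserve ε, so lowering an index with ε turns the tensor action into the
commutator. -/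
theorem symToSp_lie (T : SoSp η) (t : sym2Delta η) : symToSp η ⁅T, t⁆ = ⁅T.2, symToSp η t⁆ := by
  refine Subtype.ext ?_
  have h : (T.2 : Matrix (Fin 2) (Fin 2) ℂ).transpose * eps2 =
      -(eps2 * (T.2 : Matrix (Fin 2) (Fin 2) ℂ)) := eq_neg_of_add_eq_zero_left T.2.2.1
  have h2 : (T.2 : Matrix (Fin 2) (Fin 2) ℂ).transpose * eps2.transpose =
      -(eps2.transpose * (T.2 : Matrix (Fin 2) (Fin 2) ℂ)) := by
    rw [show eps2.transpose = -eps2 by ext i j; fin_cases i <;> fin_cases j <;> simp [eps2],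
      mul_neg, h, neg_mul, neg_neg]
  rw [coe_symToSp, LieSubmodule.coe_bracket, delta_lie, LieSubalgebra.coe_bracket,
    LieRing.of_associative_ring_bracket, coe_symToSp, lowerIndex, lowerIndex, add_mul,
    mul_assoc _ _ eps2.transpose, mul_assoc _ _ eps2.transpose, h2]
  noncomm_ring

theorem wedge2Delta_eq_smul (w : wedge2Delta η) :
    w = ((w : Matrix (Fin 2) (Fin 2) ℂ) 0 1).re • epsUp η := by
  obtain ⟨w, hw, hw'⟩ := w
  refine Subtype.ext ?_
  have h00 := congrFun (congrFun hw 0) 0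
  have h11 := congrFun (congrFun hw 1) 1
  have h10 := congrFun (congrFun hw 0) 1
  have k := congrFun (congrFun hw' 0) 1
  simp [deltaReal, eps2, Matrix.mul_apply, Fin.sum_univ_two, Matrix.map_apply,
    -Matrix.cons_mul] at h00 h11 h10 k
  rw [self_eq_neg] at h00 h11
  have k' : (starRingEnd ℂ) (w 0 1) = w 0 1 := by
    rw [h10, map_neg, neg_neg] at k; exact k
  have k2 : (((w 0 1).re : ℝ) : ℂ) = w 0 1 := Complex.conj_eq_iff_re.1 k'
  change w = (w 0 1).re • eps2
  ext i j
  fin_cases i <;> fin_cases j <;> simp [eps2, h00, h11, h10, k2]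

/-- The module is the line ℝε, which `sp(1)` annihilates. The defining relation aᵀε + εa = 0 becomes
aε + εaᵀ = 0 after multiplication by ε on both sides. Hence tensoring with it changes nothing. -/
theorem lie_wedge2Delta (T : SoSp η) (w : wedge2Delta η) : ⁅T, w⁆ = 0 := by
  have h : (T.2 : Matrix (Fin 2) (Fin 2) ℂ).transpose * eps2 +
      eps2 * (T.2 : Matrix (Fin 2) (Fin 2) ℂ) = 0 := T.2.2.1
  have he : eps2 * eps2 = -1 := by
    ext i j; fin_cases i <;> fin_cases j <;> simp [eps2, Matrix.mul_apply, Fin.sum_univ_two]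
  have h2 := congrArg (eps2 * · * eps2) (eq_neg_of_add_eq_zero_left h)
  simp only [mul_assoc, he, mul_neg, mul_one, neg_mul] at h2
  rw [← mul_assoc, he, neg_mul, one_mul, neg_neg] at h2
  rw [wedge2Delta_eq_smul w, lie_smul, show ⁅T, epsUp η⁆ = 0 from Subtype.ext ?_, smul_zero]
  rw [LieSubmodule.coe_bracket, delta_lie]
  change (T.2 : Matrix (Fin 2) (Fin 2) ℂ) * eps2 +
    eps2 * (T.2 : Matrix (Fin 2) (Fin 2) ℂ).transpose = 0
  rw [← h2, neg_add_cancel]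

/-- The component of an element of `∧²Δ = ℝ ε`. -/
noncomputable def epsCoord (η : LinearMap.BilinForm ℝ V) : wedge2Delta η →ₗ[ℝ] ℝ where
  toFun w := ((w : Matrix (Fin 2) (Fin 2) ℂ) 0 1).re
  map_add' _ _ := by simp
  map_smul' _ _ := by simp

theorem epsCoord_epsUp : epsCoord η (epsUp η) = 1 := by
  change (eps2 0 1).re = 1
  simp [eps2]

/-- `∧²V ⊗ ∧²Δ → ∧²V`. -/
noncomputable def wedgeContract (η : LinearMap.BilinForm ℝ V) :
    wedge2V η ⊗[ℝ] wedge2Delta η →ₗ[ℝ] wedge2V η :=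
  TensorProduct.lift ((LinearMap.lsmul ℝ (wedge2V η)).flip.compl₂ (epsCoord η))

theorem wedgeContract_tmul (C : wedge2V η) (w : wedge2Delta η) :
    wedgeContract η (C ⊗ₜ w) = epsCoord η w • C := rfl

theorem wedgeContract_tmul_epsUp (t : wedge2V η ⊗[ℝ] wedge2Delta η) :
    wedgeContract η t ⊗ₜ[ℝ] epsUp η = t := by
  induction t with
  | zero => simp
  | tmul C w =>
    rw [wedgeContract_tmul, TensorProduct.smul_tmul]
    exact congrArg _ (wedge2Delta_eq_smul w).symm
  | add s t hs ht => rw [map_add, TensorProduct.add_tmul, hs, ht]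

theorem wedgeContract_lie (T : SoSp η) (t : wedge2V η ⊗[ℝ] wedge2Delta η) :
    wedgeContract η ⁅T, t⁆ = ⁅T, wedgeContract η t⁆ := by
  induction t with
  | zero => simp
  | tmul C w =>
    rw [TensorProduct.LieModule.lie_tmul_right, lie_wedge2Delta, TensorProduct.tmul_zero, add_zero,
      wedgeContract_tmul, wedgeContract_tmul, lie_smul]
  | add s t hs ht => rw [lie_add, map_add, hs, ht, map_add, lie_add]

end Source

/-! ### The isomorphism with the cohomology. -/

section Isomorphism

variable {V : Type*} [AddCommGroup V] [Module ℝ V] {η : LinearMap.BilinForm ℝ V}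
  {e : LorentzFrame η} {Sg : Type*} [AddCommGroup Sg] [Module ℂ Sg] {D : SpinorModule e Sg}

theorem betaOf_add (f g : Neg D →ₗ[ℝ] Neg D →ₗ[ℝ] Poinc D) :
    betaOf (f + g) = betaOf f + betaOf g := rfl

theorem betaOf_smul (c : ℝ) (f : Neg D →ₗ[ℝ] Neg D →ₗ[ℝ] Poinc D) :
    betaOf (c • f) = c • betaOf f := rfl

theorem betaOf_lie (T : SoSp η) (f : Neg D →ₗ[ℝ] Neg D →ₗ[ℝ] Poinc D) (v : V) (s : D.S) :
    betaOf ⁅T, f⁆ v s = ⁅T, betaOf f v s⁆ - betaOf f ⁅T, v⁆ s - betaOf f v ⁅T, s⁆ := by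
  simp only [betaOf_apply, LieHom.lie_apply, LinearMap.sub_apply, Prod.snd_sub, Prod.fst_sub,
    prod_lie, lie_zero]
  abel

theorem isNormalised_lie (T : SoSp η) {f : Neg D →ₗ[ℝ] Neg D →ₗ[ℝ] Poinc D}
    (hf : IsNormalised D f) : IsNormalised D ⁅T, f⁆ := fun v w => by
  simp only [LieHom.lie_apply, LinearMap.sub_apply, Prod.fst_sub, prod_lie, lie_zero]
  rw [hf, hf, hf, lie_zero, sub_zero, sub_zero]

theorem isNormalised_add {f g : Neg D →ₗ[ℝ] Neg D →ₗ[ℝ] Poinc D}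
    (hf : IsNormalised D f) (hg : IsNormalised D g) : IsNormalised D (f + g) := fun v w => by
  rw [LinearMap.add_apply, LinearMap.add_apply, Prod.fst_add, hf, hg, add_zero]

theorem isNormalised_smul (c : ℝ) {f : Neg D →ₗ[ℝ] Neg D →ₗ[ℝ] Poinc D}
    (hf : IsNormalised D f) : IsNormalised D (c • f) := fun v w => by
  rw [LinearMap.smul_apply, LinearMap.smul_apply, Prod.smul_fst, hf, smul_zero]

/-- The module `(∧²V ⊗ ∧²Δ) ⊕ (V ⊗ ⊙²Δ)`. -/
abbrev Source (η : LinearMap.BilinForm ℝ V) : Type _ :=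
  (wedge2V η ⊗[ℝ] wedge2Delta η) × (V ⊗[ℝ] sym2Delta η)

/-- The tensors underlying an element of `(∧²V ⊗ ∧²Δ) ⊕ (V ⊗ ⊙²Δ)`. -/
noncomputable def toTensors (η : LinearMap.BilinForm ℝ V) :
    Source η →ₗ[ℝ] (V ⊗[ℝ] V) × (V ⊗[ℝ] sym2Delta η) :=
  ((wedge2V η).toSubmodule.subtype ∘ₗ wedgeContract η).prodMap LinearMap.id

theorem toTensors_apply (x : Source η) :
    toTensors η x = ((wedgeContract η x.1 : V ⊗[ℝ] V), x.2) := rfl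

theorem toTensors_injective : Function.Injective (toTensors η) := by
  intro x y h
  refine Prod.ext ?_ (congrArg Prod.snd h :)
  have h1 : wedgeContract η x.1 = wedgeContract η y.1 := Subtype.ext (congrArg Prod.fst h :)
  rw [← wedgeContract_tmul_epsUp x.1, ← wedgeContract_tmul_epsUp y.1, h1]

theorem toTensors_lie (T : SoSp η) (x : Source η) : toTensors η ⁅T, x⁆ = ⁅T, toTensors η x⁆ := by
  rw [toTensors_apply, toTensors_apply, prod_lie, prod_lie]
  simp only [wedgeContract_lie, LieSubmodule.coe_bracket]

/-- The component `V ⊗ S → S` of the normalised cocycle of an element of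
`(∧²V ⊗ ∧²Δ) ⊕ (V ⊗ ⊙²Δ)`. -/
noncomputable def betaSource (D : SpinorModule e Sg) : Source η →ₗ[ℝ] V →ₗ[ℝ] Module.End ℝ D.S :=
  D.betaMap (symToSp η) ∘ₗ toTensors η

theorem betaSource_mem (x : Source η) : betaSource D x ∈ D.cocycleBeta := D.betaMap_mem _ _

theorem betaSource_injective : Function.Injective (betaSource D) := by
  refine (injective_iff_map_eq_zero _).2 fun x hx => toTensors_injective ?_
  rw [map_zero]
  exact D.eq_zero_of_betaMap symToSp_injective (wedgeContract η x.1).2 hx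

theorem betaSource_surjective {β : V →ₗ[ℝ] Module.End ℝ D.S} (h : β ∈ D.cocycleBeta) :
    ∃ x, betaSource D x = β := by
  obtain ⟨y, rfl⟩ := D.exists_betaMap (symToSp_surjective (η := η)) h
  -- `exists_betaMap` gives an arbitrary tensor in `V ⊗ V`. Its symmetric part acts trivially on
  -- `S`, so it may be replaced by its skew part.
  have hy : (1 / 2 : ℝ) • (y.1 - TensorProduct.comm ℝ V V y.1) ∈ wedge2V η := by
    change TensorProduct.comm ℝ V V _ = -_
    rw [map_smul, map_sub, TensorProduct.comm_comm, ← smul_neg, neg_sub]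
  have hc : ∀ t : V ⊗[ℝ] V, D.cliffTwo (TensorProduct.comm ℝ V V t) = -D.cliffTwo t := by
    intro t
    induction t with
    | zero => simp
    | tmul v w =>
      rw [TensorProduct.comm_tmul, SpinorModule.cliffTwo_tmul, SpinorModule.cliffTwo_tmul,
        ← smul_neg, neg_sub]
    | add s t hs ht => rw [map_add, map_add, hs, ht, map_add, neg_add]
  refine ⟨(⟨_, hy⟩ ⊗ₜ epsUp η, y.2), LinearMap.ext fun v => LinearMap.ext fun s => ?_⟩
  have hC : D.cliffTwo ((1 / 2 : ℝ) • (y.1 - TensorProduct.comm ℝ V V y.1)) = D.cliffTwo y.1 := by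
    rw [map_smul, map_sub, hc]; module
  rw [betaSource, LinearMap.comp_apply, SpinorModule.betaMap_apply, SpinorModule.betaMap_apply,
    toTensors_apply, wedgeContract_tmul, epsCoord_epsUp, one_smul]
  simp only [hC]

theorem betaSource_lie (T : SoSp η) (x : Source η) (v : V) (s : D.S) :
    betaSource D ⁅T, x⁆ v s = ⁅T, betaSource D x v s⁆ - betaSource D x ⁅T, v⁆ s -
      betaSource D x v ⁅T, s⁆ := by
  rw [betaSource, LinearMap.comp_apply, LinearMap.comp_apply, toTensors_lie,
    D.betaMap_lie symToSp_lie]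
  abel

/-- The normalised cochain of an element of `(∧²V ⊗ ∧²Δ) ⊕ (V ⊗ ⊙²Δ)`. -/
noncomputable def sourceCochain (D : SpinorModule e Sg) (x : Source η) :
    Neg D →ₗ[ℝ] Neg D →ₗ[ℝ] Poinc D := SpinorModule.cocycleOf (betaSource_mem (D := D) x)

theorem sourceCochain_mem (x : Source η) : sourceCochain D x ∈ Z22 D :=
  SpinorModule.cocycleOf_mem _

theorem sourceCochain_normalised (x : Source η) : IsNormalised D (sourceCochain D x) :=
  SpinorModule.cocycleOf_normalised _

theorem betaOf_sourceCochain (x : Source η) : betaOf (sourceCochain D x) = betaSource D x :=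
  SpinorModule.betaOf_cocycleOf _

/-- A normalised cocycle is determined by β, so linearity and equivariance of x ↦ cocycle reduce to
those of x ↦ β. -/
theorem sourceCochain_eq {x : Source η} {f : Neg D →ₗ[ℝ] Neg D →ₗ[ℝ] Poinc D} (hf : f ∈ Z22 D)
    (hn : IsNormalised D f) (h : betaSource D x = betaOf f) : sourceCochain D x = f :=
  eq_of_betaOf_eq (sourceCochain_mem x) (sourceCochain_normalised x) hf hn
    (by rw [betaOf_sourceCochain, h])

theorem sourceCochain_add (x y : Source η) :
    sourceCochain D (x + y) = sourceCochain D x + sourceCochain D y :=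
  sourceCochain_eq (add_mem (sourceCochain_mem x) (sourceCochain_mem y))
    (isNormalised_add (sourceCochain_normalised x) (sourceCochain_normalised y))
    (by rw [betaOf_add, betaOf_sourceCochain, betaOf_sourceCochain, map_add])

theorem sourceCochain_smul (c : ℝ) (x : Source η) :
    sourceCochain D (c • x) = c • sourceCochain D x :=
  sourceCochain_eq ((Z22 D).toSubmodule.smul_mem c (sourceCochain_mem x))
    (isNormalised_smul c (sourceCochain_normalised x))
    (by rw [betaOf_smul, betaOf_sourceCochain, map_smul])

theorem sourceCochain_lie (T : SoSp η) (x : Source η) :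
    sourceCochain D ⁅T, x⁆ = ⁅T, sourceCochain D x⁆ := by
  refine sourceCochain_eq ((Z22 D).lie_mem (sourceCochain_mem x))
    (isNormalised_lie T (sourceCochain_normalised x)) ?_
  refine LinearMap.ext fun v => LinearMap.ext fun s => ?_
  rw [betaOf_lie, betaOf_sourceCochain, betaSource_lie]

/-- The normalised cocycle of an element of `(∧²V ⊗ ∧²Δ) ⊕ (V ⊗ ⊙²Δ)`. -/
noncomputable def sourceCocycle (D : SpinorModule e Sg) (x : Source η) : Z22 D :=
  ⟨sourceCochain D x, sourceCochain_mem x⟩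

set_option synthInstance.maxHeartbeats 200000 in
set_option maxHeartbeats 1000000 in
/-- The class of the normalised cocycle of an element of `(∧²V ⊗ ∧²Δ) ⊕ (V ⊗ ⊙²Δ)`. -/
noncomputable def sourceClass (D : SpinorModule e Sg) : Source η →ₗ⁅ℝ, SoSp η⁆ H22 D where
  toFun x := LieSubmodule.Quotient.mk (N := B22' D) (sourceCocycle D x)
  map_add' x y := congrArg (LieSubmodule.Quotient.mk (N := B22' D))
    (Subtype.ext (sourceCochain_add x y) :
      sourceCocycle D (x + y) = sourceCocycle D x + sourceCocycle D y)
  map_smul' c x := congrArg (LieSubmodule.Quotient.mk (N := B22' D))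
    (Subtype.ext (sourceCochain_smul c x) : sourceCocycle D (c • x) = c • sourceCocycle D x)
  map_lie' {T x} := congrArg (LieSubmodule.Quotient.mk (N := B22' D))
    (Subtype.ext (sourceCochain_lie T x) : sourceCocycle D ⁅T, x⁆ = ⁅T, sourceCocycle D x⁆)

theorem sourceClass_injective : Function.Injective (sourceClass D) := by
  intro x y h
  refine betaSource_injective (D := D) ?_
  rw [← betaOf_sourceCochain, ← betaOf_sourceCochain]
  exact congrArg (fun z : Z22 D => betaOf z.1)
    (eq_of_mk_eq (z := sourceCocycle D x) (w := sourceCocycle D y) (sourceCochain_normalised x)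
      (sourceCochain_normalised y) h)

end Isomorphism

section Isomorphism

variable {V : Type*} [AddCommGroup V] [Module ℝ V] {η : LinearMap.BilinForm ℝ V}
  {e : LorentzFrame η} {Sg : Type*} [AddCommGroup Sg] [Module ℂ Sg] {D : SpinorModule e Sg}

theorem exists_sourceCocycle (w : Z22 D) (hw : IsNormalised D w.1) :
    ∃ x : Source η, sourceCocycle D x = w := by
  obtain ⟨x, hx⟩ := betaSource_surjective (betaOf_mem w.2 hw)
  exact ⟨x, Subtype.ext (sourceCochain_eq w.2 hw hx)⟩

theorem sourceClass_eq_of_mk_eq {z w : Z22 D}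
    (hwz : LieSubmodule.Quotient.mk (N := B22' D) w = LieSubmodule.Quotient.mk (N := B22' D) z)
    {x : Source η} (h : sourceCocycle D x = w) :
    sourceClass D x = LieSubmodule.Quotient.mk (N := B22' D) z := by
  subst h
  exact hwz

theorem exists_sourceClass (z : Z22 D) :
    ∃ x, sourceClass D x = LieSubmodule.Quotient.mk (N := B22' D) z :=
  (exists_normalised z).elim fun w hw => (exists_sourceCocycle w hw.1).elim fun x hx =>
    ⟨x, sourceClass_eq_of_mk_eq hw.2 hx⟩

theorem sourceClass_surjective : Function.Surjective (sourceClass D) :=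
  fun c => Quot.inductionOn c exists_sourceClass

/-- The isomorphism `(∧²V ⊗ ∧²Δ) ⊕ (V ⊗ ⊙²Δ) ≅ H^{2,2}(s₋; s)`. -/
noncomputable def spencerEquiv (D : SpinorModule e Sg) : Source η ≃ₗ⁅ℝ, SoSp η⁆ H22 D :=
  { sourceClass D, LinearEquiv.ofBijective (sourceClass D : Source η →ₗ[ℝ] H22 D)
      ⟨sourceClass_injective, sourceClass_surjective⟩ with }

theorem spencerEquiv_apply (x : Source η) : spencerEquiv D x =
    LieSubmodule.Quotient.mk (N := B22' D) (sourceCocycle D x) := rfl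

end Isomorphism

/-! ### The Levi-Civita symbol and the volume element. -/

section LeviCivita

theorem levi_eq_zero {μ ν ρ σ τ : Fin 5} (h : ¬ Function.Injective ![μ, ν, ρ, σ, τ]) :
    levi μ ν ρ σ τ = 0 := by
  simp only [Function.Injective, not_forall] at h
  obtain ⟨i, j, hij, hne⟩ := h
  refine Matrix.det_zero_of_row_eq hne (funext fun k => ?_)
  simp only [Matrix.of_apply, hij]

theorem levi_perm (π : Equiv.Perm (Fin 5)) :
    levi (π 0) (π 1) (π 2) (π 3) (π 4) = ((Equiv.Perm.sign π : ℤ) : ℝ) := by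
  rw [← Matrix.det_permutation, levi]
  congr 1
  ext i j
  rw [Equiv.Perm.permMatrix, PEquiv.toMatrix_apply, Equiv.toPEquiv_apply]
  change (if _ then (1 : ℝ) else 0) = _
  have : ![π 0, π 1, π 2, π 3, π 4] i = π i := by fin_cases i <;> rfl
  simp [this, eq_comm]

/-- The operators `op` for the Clifford generators. -/
def clIndex (μ : Fin 5) : Fin 8 := Fin.castLE (by norm_num) μ

/-- On the standard basis, Γ_0Γ_1Γ_2Γ_3Γ_4 = 1 in any order of the factors is a statement about
finitely many signs and shifts. -/
theorem volume_sign : ∀ (π : Equiv.Perm (Fin 5)) (i : Fin 8),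
    opSign (clIndex (π 4)) i * (opSign (clIndex (π 3)) (i ^^^ opShift (clIndex (π 4))) *
      (opSign (clIndex (π 2)) (i ^^^ opShift (clIndex (π 4)) ^^^ opShift (clIndex (π 3))) *
      (opSign (clIndex (π 1)) (i ^^^ opShift (clIndex (π 4)) ^^^ opShift (clIndex (π 3)) ^^^
        opShift (clIndex (π 2))) *
      opSign (clIndex (π 0)) (i ^^^ opShift (clIndex (π 4)) ^^^ opShift (clIndex (π 3)) ^^^
        opShift (clIndex (π 2)) ^^^ opShift (clIndex (π 1)))))) = (Equiv.Perm.sign π : ℤ) ∧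
    i ^^^ opShift (clIndex (π 4)) ^^^ opShift (clIndex (π 3)) ^^^ opShift (clIndex (π 2)) ^^^
      opShift (clIndex (π 1)) ^^^ opShift (clIndex (π 0)) = i := by
  decide +kernel

end LeviCivita

/-! ### Duality of Clifford products and component formulas. -/

section Formula

variable {V : Type*} [AddCommGroup V] [Module ℝ V] {η : LinearMap.BilinForm ℝ V}
  {e : LorentzFrame η} {Sg : Type*} [AddCommGroup Sg] [Module ℂ Sg]

namespace SpinorModule

variable (D : SpinorModule e Sg)

theorem cl_volume_perm (π : Equiv.Perm (Fin 5)) (s : D.S) :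
    D.cl (e.basis (π 0)) (D.cl (e.basis (π 1)) (D.cl (e.basis (π 2)) (D.cl (e.basis (π 3))
      (D.cl (e.basis (π 4)) s)))) = ((Equiv.Perm.sign π : ℤ) : ℝ) • s := by
  obtain ⟨B⟩ := D.nonempty_spinFrame
  have h : D.cl (e.basis (π 0)) * (D.cl (e.basis (π 1)) * (D.cl (e.basis (π 2)) *
      (D.cl (e.basis (π 3)) * D.cl (e.basis (π 4))))) = ((Equiv.Perm.sign π : ℤ) : ℝ) • 1 := by
    refine B.b.ext fun i => ?_
    obtain ⟨h1, h2⟩ := volume_sign π i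
    simp only [← op_cl, Module.End.mul_apply]
    change D.op (clIndex (π 0)) (D.op (clIndex (π 1)) (D.op (clIndex (π 2))
      (D.op (clIndex (π 3)) (D.op (clIndex (π 4)) (B.b i))))) = _
    simp only [B.op_b, map_smul, h2, smul_smul, LinearMap.smul_apply, Module.End.one_apply]
    rw [← h1]
    push_cast
    simp only [mul_assoc]
  exact LinearMap.congr_fun h s

theorem cl_levi {μ ν ρ σ τ : Fin 5} (h : Function.Injective ![μ, ν, ρ, σ, τ]) :
    levi μ ν ρ σ τ * levi μ ν ρ σ τ = 1 ∧ ∀ s : D.S,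
      D.cl (e.basis μ) (D.cl (e.basis ν) (D.cl (e.basis ρ) (D.cl (e.basis σ)
        (D.cl (e.basis τ) s)))) = levi μ ν ρ σ τ • s := by
  obtain ⟨π, hπ⟩ : ∃ π : Equiv.Perm (Fin 5), ∀ i, ![μ, ν, ρ, σ, τ] i = π i :=
    ⟨Equiv.ofBijective _ (Finite.injective_iff_bijective.1 h), fun i => rfl⟩
  obtain rfl : μ = π 0 := hπ 0
  obtain rfl : ν = π 1 := hπ 1
  obtain rfl : ρ = π 2 := hπ 2
  obtain rfl : σ = π 3 := hπ 3
  obtain rfl : τ = π 4 := hπ 4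
  rw [levi_perm]
  refine ⟨?_, D.cl_volume_perm π⟩
  rw [← Int.cast_mul, ← Units.val_mul, Int.units_mul_self]
  simp

theorem ip_four_swap (s : D.S) (u v w x : V) : D.ip s (D.cl u (D.cl v (D.cl w (D.cl x s)))) =
    2 * η w x * η u v * D.ip s s - D.ip s (D.cl u (D.cl v (D.cl x (D.cl w s)))) := by
  have h := congrArg (fun y => D.ip s (D.cl u (D.cl v y))) (D.cl_cl_add_apply w x s)
  simp only [map_add, map_smul, smul_eq_mul, ip_cl_cl_self] at h
  linarith

theorem ip_four_outer (s : D.S) (v w x : V) : D.ip s (D.cl v (D.cl w (D.cl x (D.cl v s)))) =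
    η v v * η w x * D.ip s s := by
  rw [← ip_cl, ip_cl_cl_self, ip_cl, ip_cl_cl_self]
  ring

theorem ip_four_inner (s : D.S) (v w x : V) : D.ip s (D.cl v (D.cl w (D.cl w (D.cl x s)))) =
    η w w * η v x * D.ip s s := by
  rw [cl_cl_self, map_smul, map_smul, ip_cl_cl_self, smul_eq_mul]
  ring

theorem ip_four_left (s : D.S) (v w x : V) : D.ip s (D.cl v (D.cl v (D.cl w (D.cl x s)))) =
    η v v * η w x * D.ip s s := by
  rw [cl_cl_self, map_smul, ip_cl_cl_self, smul_eq_mul]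
  ring

theorem count_three : ∀ μ ν ρ : Fin 5, μ ≠ ν → μ ≠ ρ → ν ≠ ρ →
    (∑ σ : Fin 5, ∑ τ : Fin 5, if Function.Injective ![μ, ν, ρ, σ, τ] then (1 : ℤ) else 0) = 2 := by
  decide +kernel

theorem count_four : ∀ μ ν σ τ : Fin 5, μ ≠ ν ∧ μ ≠ σ ∧ μ ≠ τ ∧ ν ≠ σ ∧ ν ≠ τ ∧ σ ≠ τ →
    (∑ ρ : Fin 5, if Function.Injective ![μ, ν, ρ, σ, τ] then (1 : ℤ) else 0) = 1 := by
  decide +kernel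

/-- `⟨s, Γ_μ Γ_ν Γ_{στ} s⟩` in terms of the Dirac current. -/
theorem ip_gamma_four (s : D.S) (μ ν σ τ : Fin 5) :
    1 / 4 * (D.ip s (D.cl (e.basis μ) (D.cl (e.basis ν) (D.cl (e.basis σ) (D.cl (e.basis τ) s)))) -
      D.ip s (D.cl (e.basis μ) (D.cl (e.basis ν) (D.cl (e.basis τ) (D.cl (e.basis σ) s))))) =
    1 / 2 * D.ip s s * (η (e.basis ν) (e.basis σ) * η (e.basis μ) (e.basis τ) -
      η (e.basis μ) (e.basis σ) * η (e.basis ν) (e.basis τ)) +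
    1 / 2 * ∑ ρ, e.basis.repr (D.kappa s s) ρ * levi μ ν ρ σ τ := by
  by_cases h : μ ≠ ν ∧ μ ≠ σ ∧ μ ≠ τ ∧ ν ≠ σ ∧ ν ≠ τ ∧ σ ≠ τ
  · obtain ⟨h1, h2, h3, h4, h5, h6⟩ := h
    -- For distinct indices exactly one ρ is missing. Γ_ρ passes Γ_σ and Γ_τ without a net sign, so
    -- the volume relation turns the four-fold product into Γ_ρ, whose expectation in s is a
    -- component of κ_s.
    have hρ : ∀ ρ, e.basis.repr (D.kappa s s) ρ * levi μ ν ρ σ τ =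
        ((if Function.Injective ![μ, ν, ρ, σ, τ] then (1 : ℤ) else 0 : ℤ) : ℝ) *
          D.ip s (D.cl (e.basis μ) (D.cl (e.basis ν) (D.cl (e.basis σ) (D.cl (e.basis τ) s)))) := by
      intro ρ
      split_ifs with hi
      · obtain ⟨hl, hv⟩ := D.cl_levi hi
        have hρσ : ρ ≠ σ := fun h => absurd (hi (a₁ := 2) (a₂ := 3) h) (by decide)
        have hρτ : ρ ≠ τ := fun h => absurd (hi (a₁ := 2) (a₂ := 4) h) (by decide)
        have h7 := congrArg (D.ip s) (hv (D.cl (e.basis ρ) s))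
        rw [D.cl_basis_swap hρσ, D.cl_basis_swap hρτ, cl_cl_self, e.orthonormal, if_pos rfl] at h7
        simp only [map_neg, neg_neg, map_smul, smul_eq_mul] at h7
        rw [e.repr_eq, e.symm, eta_kappa_cl, Int.cast_one, one_mul]
        linear_combination (-sgn ρ) * h7 + D.ip s (D.cl (e.basis μ) (D.cl (e.basis ν)
          (D.cl (e.basis σ) (D.cl (e.basis τ) s)))) * sgn_mul_sgn ρ
      · rw [levi_eq_zero hi, mul_zero, Int.cast_zero, zero_mul]
    simp only [hρ, ← Finset.sum_mul, ← Int.cast_sum, count_four μ ν σ τ ⟨h1, h2, h3, h4, h5, h6⟩]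
    rw [D.ip_four_swap s (e.basis μ) (e.basis ν) (e.basis τ)]
    simp only [e.orthonormal, if_neg h1, if_neg h2, if_neg h3, if_neg h4, if_neg h5]
    push_cast
    ring
  -- With a repeated index there is no Levi-Civita term, and the four-fold products reduce to ⟨s, s⟩
  -- by the Clifford relation.
  · have hl : ∀ ρ, levi μ ν ρ σ τ = 0 := fun ρ => levi_eq_zero fun hi => h
      ⟨fun h => absurd (hi (a₁ := 0) (a₂ := 1) h) (by decide),
        fun h => absurd (hi (a₁ := 0) (a₂ := 3) h) (by decide),
        fun h => absurd (hi (a₁ := 0) (a₂ := 4) h) (by decide),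
        fun h => absurd (hi (a₁ := 1) (a₂ := 3) h) (by decide),
        fun h => absurd (hi (a₁ := 1) (a₂ := 4) h) (by decide),
        fun h => absurd (hi (a₁ := 3) (a₂ := 4) h) (by decide)⟩
    simp only [hl, mul_zero, Finset.sum_const_zero, add_zero]
    by_cases h1 : μ = ν
    · subst h1; rw [ip_four_left, ip_four_left, e.symm (e.basis τ)]; ring
    by_cases h6 : σ = τ
    · subst h6; ring
    by_cases h2 : μ = σ
    · subst h2
      rw [D.ip_four_swap s (e.basis μ) (e.basis ν) (e.basis μ), ip_four_outer,
        e.symm (e.basis ν) (e.basis μ)]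
      ring
    by_cases h3 : μ = τ
    · subst h3
      rw [D.ip_four_swap s (e.basis μ) (e.basis ν) (e.basis μ), ip_four_outer,
        e.symm (e.basis ν) (e.basis μ)]
      ring
    by_cases h4 : ν = σ
    · subst h4
      rw [D.ip_four_swap s (e.basis μ) (e.basis ν) (e.basis τ), ip_four_inner,
        e.symm (e.basis τ) (e.basis ν)]
      ring
    by_cases h5 : ν = τ
    · subst h5
      rw [D.ip_four_swap s (e.basis μ) (e.basis ν) (e.basis σ), ip_four_inner,
        e.symm (e.basis σ) (e.basis ν)]
      ring
    exact absurd ⟨h1, h2, h3, h4, h5, h6⟩ h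

/-- `⟨s, Γ_μ Γ_ν Γ_ρ q s⟩` for `q ∈ sp(1)`. -/
theorem ip_gamma_three (s : D.S) (q : sp1) (μ ν ρ : Fin 5) :
    -(1 / 2) * D.ip s (D.cl (e.basis μ) (D.cl (e.basis ν) (D.cl (e.basis ρ) (D.qu q s)))) =
    1 / 4 * ∑ σ, ∑ τ, levi μ ν ρ σ τ * sgn σ * sgn τ *
      (1 / 2 * (D.ip s (D.cl (e.basis σ) (D.cl (e.basis τ) (D.qu q s))) -
        D.ip s (D.cl (e.basis τ) (D.cl (e.basis σ) (D.qu q s))))) := by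
  by_cases h : μ ≠ ν ∧ μ ≠ ρ ∧ ν ≠ ρ
  · obtain ⟨h1, h2, h3⟩ := h
    -- For distinct μ, ν, ρ the two orderings of the remaining indices contribute equally, each
    -- minus the three-fold expectation. This accounts for -1/2 = 1/4 · 2 · (-1).
    have hστ : ∀ σ τ, levi μ ν ρ σ τ * sgn σ * sgn τ *
        (1 / 2 * (D.ip s (D.cl (e.basis σ) (D.cl (e.basis τ) (D.qu q s))) -
          D.ip s (D.cl (e.basis τ) (D.cl (e.basis σ) (D.qu q s))))) =
        ((if Function.Injective ![μ, ν, ρ, σ, τ] then (1 : ℤ) else 0 : ℤ) : ℝ) *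
          -D.ip s (D.cl (e.basis μ) (D.cl (e.basis ν) (D.cl (e.basis ρ) (D.qu q s)))) := by
      intro σ τ
      split_ifs with hi
      · obtain ⟨hl, hv⟩ := D.cl_levi hi
        have hne : σ ≠ τ := fun h => absurd (hi (a₁ := 3) (a₂ := 4) h) (by decide)
        have h7 := congrArg (D.ip s) (hv (D.cl (e.basis τ) (D.cl (e.basis σ) (D.qu q s))))
        rw [cl_cl_self, map_smul, cl_cl_self, e.orthonormal, e.orthonormal, if_pos rfl,
          if_pos rfl] at h7
        simp only [map_smul, smul_eq_mul] at h7
        rw [D.cl_basis_swap hne, map_neg, Int.cast_one, one_mul]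
        linear_combination (sgn σ * sgn τ) * h7 - (D.ip s (D.cl (e.basis μ) (D.cl (e.basis ν)
          (D.cl (e.basis ρ) (D.qu q s))))) * (sgn τ * sgn τ * sgn_mul_sgn σ + sgn_mul_sgn τ)
      · rw [levi_eq_zero hi]; simp
    simp only [hστ, ← Finset.sum_mul, ← Int.cast_sum, count_three μ ν ρ h1 h2 h3]
    push_cast
    ring
  · have hl : ∀ σ τ, levi μ ν ρ σ τ = 0 := fun σ τ => levi_eq_zero fun hi => h
      ⟨fun h => absurd (hi (a₁ := 0) (a₂ := 1) h) (by decide),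
        fun h => absurd (hi (a₁ := 0) (a₂ := 2) h) (by decide),
        fun h => absurd (hi (a₁ := 1) (a₂ := 2) h) (by decide)⟩
    simp only [hl, zero_mul, Finset.sum_const_zero, mul_zero]
    by_cases h1 : μ = ν
    · subst h1; rw [cl_cl_self, map_smul, ip_cl_qu_self]; simp
    by_cases h3 : ν = ρ
    · subst h3; rw [cl_cl_self, map_smul, map_smul, ip_cl_qu_self]; simp
    by_cases h2 : μ = ρ
    · subst h2
      rw [D.cl_basis_swap (Ne.symm h1), map_neg, cl_cl_self, map_neg, map_smul, ip_cl_qu_self]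
      simp
    exact absurd ⟨h1, h2, h3⟩ h

theorem tensor_expand (e : LorentzFrame η) (t : V ⊗[ℝ] V) :
    t = ∑ σ, ∑ τ, (e.basis.tensorProduct e.basis).repr t (σ, τ) •
      (e.basis σ ⊗ₜ[ℝ] e.basis τ) := by
  conv_lhs => rw [← (e.basis.tensorProduct e.basis).sum_repr t, Fintype.sum_prod_type]
  simp only [Module.Basis.tensorProduct_apply]

theorem upC_swap (e : LorentzFrame η) (C : wedge2V η) (σ τ : Fin 5) :
    upC e C τ σ = -upC e C σ τ := by
  have h : TensorProduct.comm ℝ V V (C : V ⊗[ℝ] V) = -C := C.2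
  have k : ∀ t : V ⊗[ℝ] V, (e.basis.tensorProduct e.basis).repr (TensorProduct.comm ℝ V V t) (σ, τ) =
      (e.basis.tensorProduct e.basis).repr t (τ, σ) := by
    intro t
    induction t with
    | zero => simp
    | tmul v w => simp [Module.Basis.tensorProduct_repr_tmul_apply, mul_comm]
    | add s t hs ht => rw [map_add, map_add, Finsupp.add_apply, hs, ht, map_add, Finsupp.add_apply]
  rw [upC, upC, ← k, h, map_neg, Finsupp.neg_apply]

/-- The Clifford action of a bivector in components. -/
theorem cliffTwo_eq_sum (C : wedge2V η) (s : D.S) : D.cliffTwo (C : V ⊗[ℝ] V) s =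
    ∑ σ, ∑ τ, upC e C σ τ • (1 / 4 : ℝ) • (D.cl (e.basis σ) (D.cl (e.basis τ) s) -
      D.cl (e.basis τ) (D.cl (e.basis σ) s)) := by
  conv_lhs => rw [tensor_expand e (C : V ⊗[ℝ] V)]
  simp only [map_sum, map_smul, LinearMap.sum_apply, LinearMap.smul_apply, cliffTwo_tmul,
    LinearMap.sub_apply, Module.End.mul_apply]
  rfl

theorem eta_bivectorEnd_eq_sum (C : wedge2V η) (μ ν : Fin 5) :
    η (e.basis μ) (bivectorEnd η (C : V ⊗[ℝ] V) (e.basis ν)) =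
      ∑ σ, ∑ τ, upC e C σ τ * (η (e.basis τ) (e.basis ν) * η (e.basis μ) (e.basis σ) -
        η (e.basis σ) (e.basis ν) * η (e.basis μ) (e.basis τ)) := by
  conv_lhs => rw [tensor_expand e (C : V ⊗[ℝ] V)]
  simp only [map_sum, map_smul, LinearMap.sum_apply, LinearMap.smul_apply, bivectorEnd_tmul,
    map_sub, smul_eq_mul]
  rfl

theorem two_downC (e : LorentzFrame η) (C : wedge2V η) (μ ν : Fin 5) :
    2 * downC e C μ ν = ∑ σ, ∑ τ, upC e C σ τ *
      (η (e.basis ν) (e.basis τ) * η (e.basis μ) (e.basis σ) -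
        η (e.basis ν) (e.basis σ) * η (e.basis μ) (e.basis τ)) := by
  simp only [e.orthonormal, mul_sub, Finset.sum_sub_distrib, mul_ite, ite_mul, mul_zero, zero_mul,
    Finset.sum_ite_eq, Finset.mem_univ, if_true]
  rw [downC, upC_swap e C μ ν]
  simp
  ring

end SpinorModule

end Formula

/-! ### Agreement with the stated formulas for β and γ. -/

section Main

variable {V : Type*} [AddCommGroup V] [Module ℝ V] {η : LinearMap.BilinForm ℝ V}
  {e : LorentzFrame η} {Sg : Type*} [AddCommGroup Sg] [Module ℂ Sg] (D : SpinorModule e Sg)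

/-- The element of `(∧²V ⊗ ∧²Δ) ⊕ (V ⊗ ⊙²Δ)` with components `C` and `F`. -/
noncomputable def sourceOf (e : LorentzFrame η) (C : wedge2V η) (F : Fin 5 → sym2Delta η) :
    Source η := (C ⊗ₜ[ℝ] epsUp η, ∑ μ, e.basis μ ⊗ₜ[ℝ] F μ)

theorem toTensors_sourceOf (C : wedge2V η) (F : Fin 5 → sym2Delta η) :
    toTensors η (sourceOf e C F) = ((C : V ⊗[ℝ] V), ∑ μ, e.basis μ ⊗ₜ[ℝ] F μ) := by
  rw [toTensors_apply, sourceOf, wedgeContract_tmul, epsCoord_epsUp, one_smul]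

theorem cliffTwo_val (C : wedge2V η) (s : D.S) (b : Fin 2) :
    (D.cliffTwo (C : V ⊗[ℝ] V) s).1 b = cliffC D C (s.1 b) := by
  rw [D.cliffTwo_eq_sum]
  simp only [SpinorModule.S_sum, SpinorModule.S_smul, SpinorModule.S_sub, D.cl_val, cliffC,
    gamma2, LinearMap.smul_apply, LinearMap.sum_apply, LinearMap.sub_apply,
    Module.End.mul_apply, Finset.smul_sum, smul_smul]
  refine Finset.sum_congr rfl fun σ _ => Finset.sum_congr rfl fun τ _ => ?_
  congr 1
  ring

theorem cliffOne_eq_sum (F : Fin 5 → sym2Delta η) (s : D.S) :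
    D.cliffOne (symToSp η) (∑ μ, e.basis μ ⊗ₜ[ℝ] F μ) s =
      ∑ μ, D.cl (e.basis μ) (D.qu (symToSp η (F μ)) s) := by
  simp only [map_sum, LinearMap.sum_apply, SpinorModule.cliffOne_tmul, Module.End.mul_apply]

theorem cliffOne_val (F : Fin 5 → sym2Delta η) (s : D.S) (b : Fin 2) :
    (D.cliffOne (symToSp η) (∑ μ, e.basis μ ⊗ₜ[ℝ] F μ) s).1 b =
      ∑ c, cliffF D F b c (s.1 c) := by
  rw [cliffOne_eq_sum]
  simp only [SpinorModule.S_sum, D.cl_val, D.qu_val, cliffF, LinearMap.sum_apply,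
    LinearMap.smul_apply, map_sum, map_smul]
  rw [Finset.sum_comm]
  rfl

theorem betaSource_val (C : wedge2V η) (F : Fin 5 → sym2Delta η) (v : V) (s : D.S) (b : Fin 2) :
    (betaSource D (sourceOf e C F) v s).1 b = betaFormula D C F v s b := by
  rw [betaSource, LinearMap.comp_apply, toTensors_sourceOf, SpinorModule.betaMap_apply]
  simp only [SpinorModule.S_sub, SpinorModule.S_smul, D.cl_val, cliffTwo_val, cliffOne_val,
    betaFormula]
  rw [map_sum]

/-- The ε that lowers the index of F is the one in the inner product of `S`, so contracting F with ω
is an expectation of Γ_{στ} times the quaternion F^ρ. -/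
theorem downF_mul_omega (F : Fin 5 → sym2Delta η) (s : D.S) (ρ σ τ : Fin 5) :
    ∑ a, ∑ b, downF F ρ a b * omega D s a b σ τ =
      ((1 / 2 * (D.ip s (D.cl (e.basis σ) (D.cl (e.basis τ) (D.qu (symToSp η (F ρ)) s))) -
        D.ip s (D.cl (e.basis τ) (D.cl (e.basis σ) (D.qu (symToSp η (F ρ)) s)))) : ℝ) : ℂ) := by
  rw [← map_sub, ← smul_eq_mul (a := (1 / 2 : ℝ)), ← map_smul, D.ip_apply, SpinorModule.pairing]
  simp only [SpinorModule.S_smul, SpinorModule.S_sub, D.cl_val, D.qu_val, downF, omega, gamma2,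
    LinearMap.smul_apply, LinearMap.sub_apply, Module.End.mul_apply, map_smul,
    Fin.sum_univ_two, ← Complex.coe_smul, map_sub, map_add, smul_eq_mul]
  simp only [mixedF, coe_symToSp]
  ring

/-- The component `⊙²S → so(V)` of the normalised cocycle. -/
theorem gamma_val (C : wedge2V η) (F : Fin 5 → sym2Delta η) (s : D.S) (μ ν : Fin 5) :
    ((η (e.basis μ) (D.gammaEnd (betaSource D (sourceOf e C F)) s s (e.basis ν)) : ℝ) : ℂ) =
      gammaFormula D C F s μ ν := by
  -- The coefficients are -2 times those of `betaMap_eq`; the term F(v) drops out because κ(s, qs) =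
  -- 0.
  have h1 : η (e.basis μ) (D.gammaEnd (betaSource D (sourceOf e C F)) s s (e.basis ν)) =
      D.ip s (D.cl (e.basis μ) (D.cl (e.basis ν) (D.cliffTwo (C : V ⊗[ℝ] V) s))) +
      3 / 2 * D.ip s s * η (e.basis μ) (SpinorModule.bivectorEnd η (C : V ⊗[ℝ] V) (e.basis ν)) +
      -(1 / 2) * D.ip s (D.cl (e.basis μ) (D.cl (e.basis ν)
        (D.cliffOne (symToSp η) (∑ μ, e.basis μ ⊗ₜ[ℝ] F μ) s))) := by
    rw [D.gammaEnd_self, betaSource, LinearMap.comp_apply, toTensors_sourceOf,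
      SpinorModule.betaMap_eq]
    simp only [LinearMap.add_apply, LinearMap.smul_apply, SpinorModule.clMul_apply,
      LinearMap.comp_apply, map_add, map_smul, D.kappa_cl_self, D.kappa_qu_self, smul_eq_mul,
      map_zero]
    rw [e.symm _ (D.kappa _ _), e.symm _ (D.kappa _ _), D.eta_kappa_cl, D.eta_kappa_cl]
    ring
  have h2 : D.ip s (D.cl (e.basis μ) (D.cl (e.basis ν) (D.cliffTwo (C : V ⊗[ℝ] V) s))) =
      -(1 / 2) * D.ip s s * (2 * downC e C μ ν) + 1 / 2 * ∑ ρ, ∑ σ, ∑ τ,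
        e.basis.repr (D.kappa s s) ρ * levi μ ν ρ σ τ * upC e C σ τ := by
    have hsum : ∑ ρ, ∑ σ, ∑ τ, e.basis.repr (D.kappa s s) ρ * levi μ ν ρ σ τ * upC e C σ τ =
        ∑ σ, ∑ τ, upC e C σ τ * ∑ ρ, e.basis.repr (D.kappa s s) ρ * levi μ ν ρ σ τ := by
      rw [Finset.sum_comm]
      refine Finset.sum_congr rfl fun σ _ => ?_
      rw [Finset.sum_comm]
      refine Finset.sum_congr rfl fun τ _ => ?_
      rw [Finset.mul_sum]
      exact Finset.sum_congr rfl fun ρ _ => mul_comm _ _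
    rw [D.cliffTwo_eq_sum, hsum, SpinorModule.two_downC]
    simp only [map_sum, map_smul, map_sub, smul_eq_mul, D.ip_gamma_four]
    simp only [Finset.mul_sum, ← Finset.sum_add_distrib]
    refine Finset.sum_congr rfl fun σ _ => Finset.sum_congr rfl fun τ _ => ?_
    simp only [← Finset.mul_sum]
    ring
  have h3 : η (e.basis μ) (SpinorModule.bivectorEnd η (C : V ⊗[ℝ] V) (e.basis ν)) =
      2 * downC e C μ ν := by
    rw [SpinorModule.eta_bivectorEnd_eq_sum, SpinorModule.two_downC]
    simp only [e.symm (e.basis ν)]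
  have h4 : -(1 / 2) * D.ip s (D.cl (e.basis μ) (D.cl (e.basis ν)
      (D.cliffOne (symToSp η) (∑ μ, e.basis μ ⊗ₜ[ℝ] F μ) s))) =
      1 / 4 * ∑ ρ, ∑ σ, ∑ τ, levi μ ν ρ σ τ * sgn σ * sgn τ *
      (1 / 2 * (D.ip s (D.cl (e.basis σ) (D.cl (e.basis τ) (D.qu (symToSp η (F ρ)) s))) -
        D.ip s (D.cl (e.basis τ) (D.cl (e.basis σ) (D.qu (symToSp η (F ρ)) s))))) := by
    rw [cliffOne_eq_sum]
    simp only [map_sum]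
    rw [Finset.mul_sum, Finset.mul_sum]
    exact Finset.sum_congr rfl fun ρ _ => D.ip_gamma_three s _ μ ν ρ
  -- The coefficient of μ_s C_{μν} is -1 from `h2` plus 3 from `h3`.
  rw [h1, h2, h3, h4, gammaFormula]
  simp only [downF_mul_omega]
  push_cast
  ring

end Main

end Spencer5


theorem theorem3 {V : Type*} [AddCommGroup V] [Module ℝ V] (η : LinearMap.BilinForm ℝ V)
    (e : Spencer5.LorentzFrame η) {Sg : Type*} [AddCommGroup Sg] [Module ℂ Sg]
    (D : Spencer5.SpinorModule e Sg) :
    ∃ Φ : ((Spencer5.wedge2V η ⊗[ℝ] Spencer5.wedge2Delta η) × (V ⊗[ℝ] Spencer5.sym2Delta η))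
        ≃ₗ⁅ℝ, Spencer5.SoSp η⁆ Spencer5.H22 D,
      ∀ (C : Spencer5.wedge2V η) (F : Fin 5 → Spencer5.sym2Delta η),
        ∃ z : Spencer5.Z22 D,
          Φ (C ⊗ₜ[ℝ] Spencer5.epsUp η, ∑ μ, e.basis μ ⊗ₜ[ℝ] F μ) =
              LieSubmodule.Quotient.mk (N := Spencer5.B22' D) z ∧
            Spencer5.IsNormalised D z ∧
            (∀ z' : Spencer5.Z22 D, Spencer5.IsNormalised D z' →
              LieSubmodule.Quotient.mk (N := Spencer5.B22' D) z' =
                LieSubmodule.Quotient.mk (N := Spencer5.B22' D) z → z' = z) ∧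
            (∀ (v : V) (s : D.S) (b : Fin 2),
              (z.1 (v, 0) (0, s)).2.1.1 b = Spencer5.betaFormula D C F v s b) ∧
            (∀ (s : D.S) (μ ν : Fin 5),
              ((η (e.basis μ) (((z.1 (0, s) (0, s)).2.2 : Module.End ℝ V) (e.basis ν)) : ℝ) : ℂ) =
                Spencer5.gammaFormula D C F s μ ν) := by
  refine ⟨Spencer5.spencerEquiv D, fun C F =>
    ⟨Spencer5.sourceCocycle D (Spencer5.sourceOf e C F),
      Spencer5.spencerEquiv_apply (Spencer5.sourceOf e C F),
      Spencer5.sourceCochain_normalised _,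
      fun z' hz' h => Spencer5.eq_of_mk_eq hz' (Spencer5.sourceCochain_normalised _) h,
      fun v s b => ?_, fun s μ ν => ?_⟩⟩
  · rw [← Spencer5.betaSource_val, ← Spencer5.betaOf_sourceCochain]
    rfl
  · rw [← Spencer5.gamma_val, ← Spencer5.betaOf_sourceCochain,
      ← Spencer5.gamma_of_cocycle (Spencer5.sourceCochain_mem _)
        (Spencer5.sourceCochain_normalised _)]
    rfl
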